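/- **Theorem (Correctness).** For every deterministic off-line Turing machine $M$, the loop $\texttt{Simulate!}$ of the SGP 2 program $\texttt{Sim}(M)$ simulates $M$. That is, for every nonempty input with initial configuration $I$ and all configurations $S,S'$ of $M$ with $I\Rightarrow_M^* S\Rightarrow_M S'$, there is an integer $k\ge 0$ such that $\mathrm{enc}_k(S)$ and $\mathrm{enc}_k(S')$ exist and $$\mathrm{enc}_0(I)\;\Rightarrow^*_{\texttt{Simulate!}}\;\mathrm{enc}_k(S)\;\Rightarrow^*_{\texttt{Simulate}}\;\mathrm{enc}_k(S').$$ In terms of the operational semantics: $\langle\texttt{Simulate!},\mathrm{enc}_0(I)\rangle\to^*\langle\texttt{Simulate!},\mathrm{enc}_k(S)\rangle$ and $\langle\texttt{Simulate},\mathrm{enc}_k(S)\rangle\to^*\mathrm{enc}_k(S')$. **Turing machines.** $M$ has a finite set $Q\subset\mathbb Z$ of states, an initial state $q_0$, an accepting state, and a (possibly partial) transition function $\delta:Q\times\{0,1\}\times\{0,1,2\}\rightharpoonup Q\times\{0,1,2\}\times\{\mathrm L,\mathrm R,\mathrm S\}^2$; $\delta(q,a,x)=(p,y,X,Y)$ means: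 in state $q$, reading $a$ on the read-only finite input tape over $\{0,1\}$ and $x$ on the one-way infinite working tape over $\{0,1,2\}$ ($2$ is the blank), go to state $p$, write $y$, move the input head in direction $X$ and the working head in direction $Y$. A configuration consists of both tapes, both head positions and the state. There is no transition if $\delta$ is undefined or if a head would leave its tape. Initially the state is $q_0$, both heads are on the first square, and the working tape is blank. **Graphs and programs.** Labels consist of an atom (an integer, $\mathtt L$, $\mathtt R$, $\mathtt I$ or $\mathtt{empty}$) and an optional mark (red, green, blue, grey, dashed). Host graphs are finite directed graphs with parallel edges, loops and a set of roots, whose nodes and edges are labelled; they are considered up to isomorphism. A rule $L\Rightarrow R$ is applied by the double-pushout construction with an injective match preserving sources, targets and labels, preserving and reflecting roots, and satisfying the dangling condition. A rule set is applied by applying one of its rules; it fails if none applies. Command sequences are built from rule set calls, $P;Q$, $\texttt{if }C\texttt{ then }P\texttt{ else }Q$, $\texttt{try }C\texttt{ then }P\texttt{ else }Q$, $P!$ and $\texttt{break}$ (an omitted branch is the empty rule). Configurations $\langle P,G\rangle$, $G$, $\mathrm{fail}$ are related by the least relation $\to$ such that: a call of $R$ yields $H$ if $G\Rightarrow_R H$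 and $\mathrm{fail}$ if $R$ is not applicable; in $P;Q$ the sequence $P$ is executed first, and failure of $P$ is failure of $P;Q$; $\texttt{if}$ continues with $\langle P,G\rangle$, and $\texttt{try}$ with $\langle P,H\rangle$, if $\langle C,G\rangle\to^+H$, and both continue with $\langle Q,G\rangle$ if $\langle C,G\rangle\to^+\mathrm{fail}$; $\langle P!,G\rangle\to\langle P!,H\rangle$ if $\langle P,G\rangle\to^+H$, $\langle P!,G\rangle\to G$ if $\langle P,G\rangle\to^+\mathrm{fail}$, $\langle P!,G\rangle\to H$ if $\langle P,G\rangle\to^*\langle\texttt{break},H\rangle$; and $\langle\texttt{break};P,G\rangle\to\langle\texttt{break},G\rangle$. **Encoding.** Let $c=k+2$, $b=3^{c}$. The graph $\mathrm{enc}_k(S)$ exists iff the working head and all nonblank squares of $S$ are among the first $bc$ squares. Its nodes are a central node $C$ (the only root, labelled with the state), one node for each input square (labelled with its symbol), $b$ unlabelled block nodes $0,\dots,b-1$ (BLOCKSET), and $c$ cache nodes (CACHE). All are unmarked. The block of index $i$ consists of the squares $ic,\dots,ic+c-1$; the active block contains the working head, and the cache nodes carry its symbols. Each of the three families of nodes is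 a doubly linked list, with red edges to the right and blue edges to the left. From $C$ there are: a green edge labelled $\mathtt I$ to the first input node, a green edge to the scanned input node, a blue edge to block node $0$, a dashed edge to the active block node, a red edge to the last cache node, an unmarked edge to the scanned cache node. The active block node has a dashed edge to block node $0$; every other block node $i$ has a dashed edge to block node $j$, where $j$ is the number whose $c$ ternary digits (most significant first) are the symbols of block $i$. Except for $\mathtt I$, edges have atom $\mathtt{empty}$. **The program.** - $\texttt{Simulate}$ = $\texttt{Transitions}$; $\texttt{try MoveLeft}$; $\texttt{try MoveRight}$; $\texttt{try Left then PrevBlock}$; $\texttt{try Right then NextBlock}$; $\texttt{try Flag then Restart}$ - $\texttt{NextBlock}$ = $\texttt{Encode}$; $\texttt{try Next then (HeadLeft!; Decode) else SetFlag}$ - $\texttt{PrevBlock}$ = $\texttt{Encode; Prev; HeadRight!; Decode}$ - $\texttt{Encode}$ = $\texttt{EncodeInit; Encoding!; Update}$ - $\texttt{Encoding}$ = $\texttt{CacheDec; try Finish then break; try next\_value}$ - $\texttt{CacheDec}$ = $\texttt{CacheInit; Decrement!; if Unfinished then Reset!}$ - $\texttt{Decrement}$ = $\texttt{try Dec then (Finish;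 break) else (underflow; try CacheNext else break)}$ - $\texttt{Reset}$ = $\texttt{overflow; try CachePrev else break}$ - $\texttt{Decode}$ = $\texttt{DecodeInit; Decoding!; Update}$ - $\texttt{Decoding}$ = $\texttt{(try prev\_value else break); CacheInc}$ - $\texttt{CacheInc}$ = $\texttt{CacheInit; Increment!; if Unfinished then (Reset!; Finish)}$ - $\texttt{Increment}$ = $\texttt{try Inc then (Finish; break) else (overflow; try CacheNext else break)}$ - $\texttt{Restart}$ = $\texttt{RewindTapes; ResetCache; ResetBlockset}$ - $\texttt{RewindTapes}$ = $\texttt{try RewindInput; try rewind\_blockset; RewindCache!}$ - $\texttt{ResetCache}$ = $\texttt{CInit; Erase!; end}$ - $\texttt{ResetBlockset}$ = $\texttt{binit; try Undirect; (copy; try Undirect)!; glue; direct!; unroot}$ **The rules** (for all states $q$ and symbols; everything not mentioned is unchanged; unless stated otherwise nodes are unmarked non-roots, and $C$ is the central root, labelled with an arbitrary $q\in Q$). "Block node" means a node with atom $\mathtt{empty}$. - $\texttt{Transitions}$: for each $\delta(q,a,x)=(p,y,X,Y)$: if $C$ is labelled $q$, its green edge points to a node labelled $a$ and its unmarked edge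 (atom $\mathtt{empty}$) to a node labelled $x$, relabel $C$ to $p$ and $x$ to $y$, put the atom $\mathtt L$, $\mathtt R$ or $\mathtt{empty}$ on the unmarked edge for $Y=\mathrm L,\mathrm R,\mathrm S$, and move the green edge along a blue edge for $X=\mathrm L$, along a red edge for $X=\mathrm R$ (to a node labelled $0$ or $1$), not at all for $X=\mathrm S$. - $\texttt{MoveLeft}$, $\texttt{MoveRight}$: move the unmarked edge of $C$, carrying $\mathtt L$, resp. $\mathtt R$, along a blue, resp. red, edge of CACHE and remove the atom. $\texttt{HeadLeft}$, $\texttt{HeadRight}$: the same for the unmarked edge with atom $\mathtt{empty}$. $\texttt{Left}$, $\texttt{Right}$: remove the atom $\mathtt L$, resp. $\mathtt R$, from the unmarked edge of $C$. - $\texttt{SetFlag}$: mark $C$ grey. $\texttt{Flag}$: unmark a grey $C$ and label it $q_0$. - $\texttt{Next}$, $\texttt{Prev}$: move the dashed edge of $C$ along a red, resp. blue, edge of BLOCKSET. - $\texttt{CacheInit}$: the target of the red edge of $C$ becomes a red root. $\texttt{Dec}$ ($1\to0$, $2\to1$), $\texttt{Inc}$ ($0\to1$, $1\to2$), $\texttt{underflow}$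 ($0\to2$), $\texttt{overflow}$ ($2\to0$) relabel a red root. $\texttt{Finish}$: a red root becomes an unmarked non-root. $\texttt{Unfinished}$: there is a red root (no change). $\texttt{CacheNext}$, $\texttt{CachePrev}$: move the red mark and root status along a blue, resp. red, edge. - $\texttt{EncodeInit}$: the target of the blue edge of $C$ becomes a blue root. $\texttt{DecodeInit}$: the target of the dashed edge of the active block node (possibly that node itself) becomes a blue root. $\texttt{next\_value}$, $\texttt{prev\_value}$: move the blue mark and root status along a red, resp. blue, edge of BLOCKSET. $\texttt{Update}$ (five rules, for the possible coincidences of active block node, old target and blue root): redirect the dashed edge of the active block node to the blue root, which becomes an unmarked non-root. - $\texttt{RewindInput}$: redirect the green edge of $C$ to the target of its edge $\mathtt I$, if different. $\texttt{rewind\_blockset}$: redirect the dashed edge of $C$ to the target of its blue edge, if different. $\texttt{RewindCache}$: as $\texttt{HeadLeft}$. $\texttt{CInit}$: the target of the unmarked edge of $C$ becomes a red root labelled $2$. $\texttt{Erase}$: move the red mark and root status along a red edge and label both nodes $2$. $\texttt{end}$: the target of the red edge of $C$, a red root labelled $2$, becomes an unmarked non-root; append a new node labelled $2$ to its right and redirect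 the red edge of $C$ to it. (In this and the next item, $C$, where it occurs, is labelled $q_0$.) - $\texttt{binit}$: the target of the blue edge of $C$ becomes a blue root; create two blue roots labelled $1$ and $2$, with blue edges from $C$ labelled $1$ and $2$ to them. $\texttt{copy}$: move the blue root of atom $\mathtt{empty}$ along a red edge, and append to each of the blue roots labelled $1$ and $2$ a new node on the right, linked to it by a red and a blue edge, which takes over its label, mark and root status (the old node becomes a block node). $\texttt{Undirect}$ (two rules, non-loop and loop): delete the dashed edge leaving the blue root of atom $\mathtt{empty}$. $\texttt{glue}$: link the blue root of atom $\mathtt{empty}$ to the target of the blue edge of $C$ labelled $1$, and the blue root labelled $1$ to the target of the blue edge of $C$ labelled $2$, by red edges to the right and blue edges to the left; delete these two edges of $C$; the blue roots other than the one labelled $2$ become block nodes; the one labelled $2$ gets a dashed loop, and its left neighbour becomes an unmarked root. $\texttt{direct}$: the unmarked root of atom $\mathtt{empty}$ gets a dashed edge to the blue root labelled $2$, and root status moves along a blue edge. $\texttt{unroot}$: the unmarked root of atom $\mathtt{empty}$ gets a dashed loop, and it and the blue root labelled $2$ become unmarked non-rooted block nodes. -/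

import Mathlib

namespace SGP2

/-! ## Graphs, rules and rule application -/

inductive Atom
  | int (z : ℤ)
  | L
  | R
  | I
  | empty

inductive Mark
  | red
  | green
  | blue
  | grey
  | dashed

/-- A label is an atom together with an optional mark. -/
structure Label where
  atom : Atom
  mark : Option Mark

/-- A totally labelled finite graph with node type `V`: finitely many edges (parallel edges and
loops are allowed), a set of roots, source and target functions, node and edge labels. -/
structure GraphOn (V : Type) where
  E : Type
  finE : Finite E
  roots : Set V
  src : E → V
  tgt : E → V
  nodeLabel : V → Label
  edgeLabel : E → Label

attribute [instance] GraphOn.finE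

/-- Host graphs: totally labelled finite graphs. -/
structure HostGraph where
  V : Type
  finV : Finite V
  graph : GraphOn V

attribute [instance] HostGraph.finV

/-- Isomorphism of host graphs (bijections preserving the whole structure). -/
def HostGraph.Iso (G H : HostGraph) : Prop :=
  ∃ (φ : G.V ≃ H.V) (ψ : G.graph.E ≃ H.graph.E),
    (∀ e, H.graph.src (ψ e) = φ (G.graph.src e)) ∧
    (∀ e, H.graph.tgt (ψ e) = φ (G.graph.tgt e)) ∧
    (∀ v, H.graph.nodeLabel (φ v) = G.graph.nodeLabel v) ∧
    (∀ e, H.graph.edgeLabel (ψ e) = G.graph.edgeLabel e) ∧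
    (∀ v, φ v ∈ H.graph.roots ↔ v ∈ G.graph.roots)

/-- A rule `L ← K → R`. The interface consists of unlabelled nodes only, so it is just the set `K`
of nodes common to `L` and `R`; `D` is the set of nodes of `L` outside `K` (to be deleted) and `N`
the set of nodes of `R` outside `K` (to be created). -/
structure Rule where
  K : Type
  D : Type
  N : Type
  finK : Finite K
  finD : Finite D
  finN : Finite N
  left : GraphOn (K ⊕ D)
  right : GraphOn (K ⊕ N)

attribute [instance] Rule.finK Rule.finD Rule.finN

/-- An injective graph morphism from the left-hand side of `r` into `G`, preserving sources,
targets and labels, preserving and reflecting roots, and satisfying the dangling condition. -/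
structure Match (r : Rule) (G : HostGraph) where
  onV : r.K ⊕ r.D → G.V
  onE : r.left.E → G.graph.E
  injV : Function.Injective onV
  injE : Function.Injective onE
  src_eq : ∀ e, G.graph.src (onE e) = onV (r.left.src e)
  tgt_eq : ∀ e, G.graph.tgt (onE e) = onV (r.left.tgt e)
  nodeLabel_eq : ∀ v, G.graph.nodeLabel (onV v) = r.left.nodeLabel v
  edgeLabel_eq : ∀ e, G.graph.edgeLabel (onE e) = r.left.edgeLabel e
  roots_iff : ∀ v, onV v ∈ G.graph.roots ↔ v ∈ r.left.roots
  dangling : ∀ (d : r.D) (e : G.graph.E),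
    (G.graph.src e = onV (Sum.inr d) ∨ G.graph.tgt e = onV (Sum.inr d)) → e ∈ Set.range onE

namespace Match

variable {r : Rule} {G : HostGraph} (g : Match r G)

/-- Nodes of `G` that are not deleted. -/
abbrev KeptV : Type := {v : G.V // ∀ d : r.D, v ≠ g.onV (Sum.inr d)}

/-- Edges of `G` that are not deleted. -/
abbrev KeptE : Type := {e : G.graph.E // e ∉ Set.range g.onE}

/-- The nodes of `R` as nodes of the result. -/
def embed : r.K ⊕ r.N → g.KeptV ⊕ r.N
  | Sum.inl k => Sum.inl ⟨g.onV (Sum.inl k), fun _ h => by cases g.injV h⟩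
  | Sum.inr n => Sum.inr n

open Classical in
/-- The result of applying `r` to `G` with match `g`. -/
noncomputable def result : HostGraph where
  V := g.KeptV ⊕ r.N
  finV := inferInstance
  graph :=
    { E := g.KeptE ⊕ r.right.E
      finE := inferInstance
      roots := {v | match v with
        | Sum.inl v => (v.1 ∈ G.graph.roots ∧ v.1 ∉ Set.range g.onV) ∨
            ∃ k : r.K, g.onV (Sum.inl k) = v.1 ∧ Sum.inl k ∈ r.right.roots
        | Sum.inr n => Sum.inr n ∈ r.right.roots}
      src := fun e => match e with
        | Sum.inl e => Sum.inl ⟨G.graph.src e.1, fun d h => e.2 (g.dangling d e.1 (Or.inl h))⟩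
        | Sum.inr e => g.embed (r.right.src e)
      tgt := fun e => match e with
        | Sum.inl e => Sum.inl ⟨G.graph.tgt e.1, fun d h => e.2 (g.dangling d e.1 (Or.inr h))⟩
        | Sum.inr e => g.embed (r.right.tgt e)
      nodeLabel := fun v => match v with
        | Sum.inl v =>
            if h : ∃ k : r.K, g.onV (Sum.inl k) = v.1 then r.right.nodeLabel (Sum.inl h.choose)
            else G.graph.nodeLabel v.1
        | Sum.inr n => r.right.nodeLabel (Sum.inr n)
      edgeLabel := fun e => match e with
        | Sum.inl e => G.graph.edgeLabel e.1
        | Sum.inr e => r.right.edgeLabel e }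

end Match

/-- `H` results from `G` by applying `r` with some match (up to the names of nodes and edges). -/
def Rule.Derives (r : Rule) (G H : HostGraph) : Prop :=
  ∃ g : Match r G, g.result.Iso H

/-! ## Programs and their operational semantics -/

/-- Command sequences. A rule set call is a call of a finite family of rules. Procedure calls are
replaced by the procedure bodies. -/
inductive Com : Type 1
  | call {ι : Type} [Finite ι] (rules : ι → Rule)
  | seq (P Q : Com)
  | ite (C P Q : Com)
  | tryte (C P Q : Com)
  | alap (P : Com)
  | brk

/-- `G ⇒_R H` for a rule set `R`. -/
def Applies {ι : Type} (rules : ι → Rule) (G H : HostGraph) : Prop :=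
  ∃ i, (rules i).Derives G H

inductive Conf : Type 1
  | run (P : Com) (G : HostGraph)
  | done (G : HostGraph)
  | fail

mutual

/-- The small-step transition relation on configurations. -/
inductive Step : Conf → Conf → Prop
  | call1 {ι : Type} [Finite ι] {rules : ι → Rule} {G H : HostGraph} :
      Applies rules G H → Step (.run (.call rules) G) (.done H)
  | call2 {ι : Type} [Finite ι] {rules : ι → Rule} {G : HostGraph} :
      (¬ ∃ H, Applies rules G H) → Step (.run (.call rules) G) .fail
  | seq1 {P P' Q : Com} {G H : HostGraph} :
      Step (.run P G) (.run P' H) → Step (.run (.seq P Q) G) (.run (.seq P' Q) H)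
  | seq2 {P Q : Com} {G H : HostGraph} :
      Step (.run P G) (.done H) → Step (.run (.seq P Q) G) (.run Q H)
  | seq3 {P Q : Com} {G : HostGraph} :
      Step (.run P G) .fail → Step (.run (.seq P Q) G) .fail
  | if1 {C P Q : Com} {G H : HostGraph} :
      Plus (.run C G) (.done H) → Step (.run (.ite C P Q) G) (.run P G)
  | if2 {C P Q : Com} {G : HostGraph} :
      Plus (.run C G) .fail → Step (.run (.ite C P Q) G) (.run Q G)
  | try1 {C P Q : Com} {G H : HostGraph} :
      Plus (.run C G) (.done H) → Step (.run (.tryte C P Q) G) (.run P H)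
  | try2 {C P Q : Com} {G : HostGraph} :
      Plus (.run C G) .fail → Step (.run (.tryte C P Q) G) (.run Q G)
  | alap1 {P : Com} {G H : HostGraph} :
      Plus (.run P G) (.done H) → Step (.run (.alap P) G) (.run (.alap P) H)
  | alap2 {P : Com} {G : HostGraph} :
      Plus (.run P G) .fail → Step (.run (.alap P) G) (.done G)
  | alap3 {P : Com} {G H : HostGraph} :
      Star (.run P G) (.run .brk H) → Step (.run (.alap P) G) (.done H)
  | break1 {P : Com} {G : HostGraph} :
      Step (.run (.seq .brk P) G) (.run .brk G)

/-- The transitive closure of `Step`. -/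
inductive Plus : Conf → Conf → Prop
  | single {a b : Conf} : Step a b → Plus a b
  | head {a b c : Conf} : Step a b → Plus b c → Plus a c

/-- The reflexive-transitive closure of `Step`. -/
inductive Star : Conf → Conf → Prop
  | refl {a : Conf} : Star a a
  | head {a b c : Conf} : Step a b → Star b c → Star a c

end

/-! ## Off-line Turing machines -/

/-- Head movements: left, right, stay. -/
inductive Dir
  | L
  | R
  | S

instance : Finite Dir := by
  let f : Dir → Fin 3 := fun d => match d with
    | .L => 0
    | .R => 1
    | .S => 2
  refine Finite.of_injective f ?_
  intro a b h
  cases a <;> cases b <;> simp_all [f]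

/-- Deterministic off-line Turing machines with input alphabet `{0,1}`, working tape alphabet
`{0,1,2}` (where `2` is the blank) and a finite set of integers as states. The transition function
may be partial, the machine halting where it is undefined. -/
structure OffLineTM where
  Q : Finset ℤ
  start : Q
  accept : Q
  δ : Q → Fin 2 → Fin 3 → Option (Q × Fin 3 × Dir × Dir)

/-- `d.Moves i j`: moving from square `i` in direction `d` leads to square `j`. -/
def Dir.Moves : Dir → ℕ → ℕ → Prop
  | .L, i, j => i = j + 1
  | .R, i, j => j = i + 1
  | .S, i, j => j = i

namespace OffLineTM

/-- Configurations with an input tape of length `n`. -/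
structure Config (M : OffLineTM) (n : ℕ) where
  state : M.Q
  input : Fin n → Fin 2
  inHead : Fin n
  tape : ℕ → Fin 3
  head : ℕ

/-- The initial configuration on input `w`. -/
def init (M : OffLineTM) {n : ℕ} [NeZero n] (w : Fin n → Fin 2) : M.Config n where
  state := M.start
  input := w
  inHead := 0
  tape := fun _ => 2
  head := 0

/-- A single transition. There is none if a head would leave its tape. -/
def Trans (M : OffLineTM) {n : ℕ} (S S' : M.Config n) : Prop :=
  ∃ p y X Y, M.δ S.state (S.input S.inHead) (S.tape S.head) = some (p, y, X, Y) ∧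
    S'.state = p ∧ S'.input = S.input ∧ S'.tape = Function.update S.tape S.head y ∧
    X.Moves S.inHead S'.inHead ∧ Y.Moves S.head S'.head

end OffLineTM

/-! ## Graph encodings of Turing machine configurations -/

/-- An unmarked label. -/
def lab (a : Atom) : Label := ⟨a, none⟩

/-- The label with atom `empty` and mark `m`. -/
def col (m : Mark) : Label := ⟨.empty, some m⟩

/-- An integer as an atom. -/
def num (z : ℤ) : Atom := .int z

/-- A tape symbol as an atom. -/
def sym {m : ℕ} (x : Fin m) : Atom := .int ((x : ℕ) : ℤ)

open OffLineTM

/-- Block size, which is the number of CACHE nodes. -/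
abbrev cLen (k : ℕ) : ℕ := k + 2

/-- Number of blocks, which is the number of BLOCKSET nodes. -/
abbrev bLen (k : ℕ) : ℕ := 3 ^ (k + 2)

inductive EncNode (n k : ℕ)
  | center
  | input (i : Fin n)
  | block (i : Fin (bLen k))
  | cache (i : Fin (cLen k))

/-- Adjacent positions of a list of length `m`. -/
abbrev Link (m : ℕ) : Type := {p : Fin m × Fin m // (p.1 : ℕ) + 1 = p.2}

/-- The first six edges leave the central node; the `Right` and `Left` edges are the links of the
three doubly-linked lists; the last ones are the dashed edges of the block nodes. -/
inductive EncEdge (n k : ℕ)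
  | inputFirst
  | inputHead
  | blockFirst
  | blockActive
  | cacheLast
  | cacheHead
  | inputRight (l : Link n)
  | inputLeft (l : Link n)
  | blockRight (l : Link (bLen k))
  | blockLeft (l : Link (bLen k))
  | cacheRight (l : Link (cLen k))
  | cacheLeft (l : Link (cLen k))
  | content (i : Fin (bLen k))

instance (n k : ℕ) : Finite (EncNode n k) := by
  let f : EncNode n k → Unit ⊕ Fin n ⊕ Fin (bLen k) ⊕ Fin (cLen k) := fun v => match v with
    | .center => .inl ()
    | .input i => .inr (.inl i)
    | .block i => .inr (.inr (.inl i))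
    | .cache i => .inr (.inr (.inr i))
  refine Finite.of_injective f ?_
  intro a b h
  cases a <;> cases b <;> simp_all [f]

instance (n k : ℕ) : Finite (EncEdge n k) := by
  let f : EncEdge n k → Fin 6 ⊕ (Link n ⊕ Link n) ⊕ (Link (bLen k) ⊕ Link (bLen k)) ⊕
      (Link (cLen k) ⊕ Link (cLen k)) ⊕ Fin (bLen k) := fun e => match e with
    | .inputFirst => .inl 0
    | .inputHead => .inl 1
    | .blockFirst => .inl 2
    | .blockActive => .inl 3
    | .cacheLast => .inl 4
    | .cacheHead => .inl 5
    | .inputRight l => .inr (.inl (.inl l))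
    | .inputLeft l => .inr (.inl (.inr l))
    | .blockRight l => .inr (.inr (.inl (.inl l)))
    | .blockLeft l => .inr (.inr (.inl (.inr l)))
    | .cacheRight l => .inr (.inr (.inr (.inl (.inl l))))
    | .cacheLeft l => .inr (.inr (.inr (.inl (.inr l))))
    | .content i => .inr (.inr (.inr (.inr i)))
  refine Finite.of_injective f ?_
  intro a b h
  cases a <;> cases b <;> simp_all [f]

variable {M : OffLineTM} {n : ℕ}

/-- The configuration fits on a tape of `bLen k` blocks of `cLen k` squares. -/
structure Fits (k : ℕ) (S : M.Config n) : Prop where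
  head_lt : S.head < bLen k * cLen k
  blank : ∀ i, bLen k * cLen k ≤ i → S.tape i = 2

theorem fits_init [NeZero n] (k : ℕ) (w : Fin n → Fin 2) : Fits k (M.init w) where
  head_lt := by
    change 0 < 3 ^ (k + 2) * (k + 2)
    positivity
  blank := fun _ _ => rfl

/-- The content of block `i` of the tape, read as a ternary number whose most significant digit is
the leftmost one: square `i * (k + 2) + j` contributes its symbol times `3 ^ (k + 1 - j)`. -/
def blockContent (k : ℕ) (tape : ℕ → Fin 3) (i : ℕ) : Fin (bLen k) :=
  finFunctionFinEquiv (fun j : Fin (k + 2) => tape (i * (k + 2) + (j.rev : ℕ)))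

theorem blockContent_val (k : ℕ) (tape : ℕ → Fin 3) (i : ℕ) :
    (blockContent k tape i : ℕ) =
      ∑ j : Fin (k + 2), (tape (i * (k + 2) + (j : ℕ)) : ℕ) * 3 ^ (k + 1 - (j : ℕ)) := by
  rw [blockContent, finFunctionFinEquiv_apply, ← Equiv.sum_comp Fin.revPerm]
  refine Finset.sum_congr rfl fun j _ => ?_
  simp only [Fin.revPerm_apply, Fin.rev_rev, Fin.val_rev]
  congr 2
  omega

/-- The configuration graph `enc_k(S)`, defined whenever `S` fits. -/
def enc (k : ℕ) (S : M.Config n) (h : Fits k S) : HostGraph where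
  V := EncNode n k
  finV := inferInstance
  graph :=
    let active : Fin (bLen k) :=
      ⟨S.head / cLen k, Nat.div_lt_of_lt_mul (by rw [Nat.mul_comm]; exact h.head_lt)⟩
    { E := EncEdge n k
      finE := inferInstance
      roots := {.center}
      nodeLabel := fun v => match v with
        | .center => lab (num S.state)
        | .input i => lab (sym (S.input i))
        | .block _ => lab .empty
        | .cache i => lab (sym (S.tape ((active : ℕ) * cLen k + i)))
      src := fun e => match e with
        | .inputFirst | .inputHead | .blockFirst | .blockActive | .cacheLast | .cacheHead =>
            .center
        | .inputRight l => .input l.1.1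
        | .inputLeft l => .input l.1.2
        | .blockRight l => .block l.1.1
        | .blockLeft l => .block l.1.2
        | .cacheRight l => .cache l.1.1
        | .cacheLeft l => .cache l.1.2
        | .content i => .block i
      tgt := fun e => match e with
        | .inputFirst => .input ⟨0, Nat.zero_lt_of_lt S.inHead.2⟩
        | .inputHead => .input S.inHead
        | .blockFirst => .block ⟨0, Nat.zero_lt_of_lt active.2⟩
        | .blockActive => .block active
        | .cacheLast => .cache (Fin.last (k + 1))
        | .cacheHead => .cache ⟨S.head % cLen k, Nat.mod_lt _ (Nat.succ_pos _)⟩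
        | .inputRight l => .input l.1.2
        | .inputLeft l => .input l.1.1
        | .blockRight l => .block l.1.2
        | .blockLeft l => .block l.1.1
        | .cacheRight l => .cache l.1.2
        | .cacheLeft l => .cache l.1.1
        | .content i =>
            if i = active then .block ⟨0, Nat.zero_lt_of_lt active.2⟩
            else .block (blockContent k S.tape i)
      edgeLabel := fun e => match e with
        | .inputFirst => ⟨.I, some .green⟩
        | .inputHead => col .green
        | .cacheHead => lab .empty
        | .blockActive | .content _ => col .dashed
        | .blockFirst | .inputLeft _ | .blockLeft _ | .cacheLeft _ => col .blue
        | .cacheLast | .inputRight _ | .blockRight _ | .cacheRight _ => col .red }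

/-! ## The program -/

/-- A node of a rule graph: its label, and whether it is a root. -/
structure Node where
  label : Label
  isRoot : Bool

/-- Unmarked node that is not a root. -/
def plain (a : Atom) : Node := ⟨lab a, false⟩

/-- Unmarked root. -/
def root (a : Atom) : Node := ⟨lab a, true⟩

/-- Marked root. -/
def mroot (m : Mark) (a : Atom) : Node := ⟨⟨a, some m⟩, true⟩

/-- A graph given by its nodes and a list of edges (source, target, label). -/
def listGraph {V W : Type} (pos : W → V) (node : V → Node) (edges : List (W × W × Label)) :
    GraphOn V where
  E := Fin edges.length
  finE := inferInstance
  roots := {v | (node v).isRoot = true}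
  src := fun e => pos (edges.get e).1
  tgt := fun e => pos (edges.get e).2.1
  nodeLabel := fun v => (node v).label
  edgeLabel := fun e => (edges.get e).2.2

/-- A rule on nodes `0, …, m - 1` that neither deletes nor creates nodes: nodes of the left-hand and
of the right-hand side, edges of the left-hand and of the right-hand side. -/
def inPlace {m : ℕ} (l r : Fin m → Node) (el er : List (Fin m × Fin m × Label)) : Rule where
  K := Fin m
  D := Empty
  N := Empty
  finK := inferInstance
  finD := inferInstance
  finN := inferInstance
  left := listGraph Sum.inl (Sum.elim l Empty.elim) el
  right := listGraph Sum.inl (Sum.elim r Empty.elim) er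

/-- A rule that keeps the nodes `inl 0, …, inl (m - 1)`, deletes no nodes and creates the nodes
`inr 0, …, inr (a - 1)`. -/
def creating {m a : ℕ} (l r : Fin m → Node) (new : Fin a → Node)
    (el : List (Fin m × Fin m × Label))
    (er : List ((Fin m ⊕ Fin a) × (Fin m ⊕ Fin a) × Label)) : Rule where
  K := Fin m
  D := Empty
  N := Fin a
  finK := inferInstance
  finD := inferInstance
  finN := inferInstance
  left := listGraph Sum.inl (Sum.elim l Empty.elim) el
  right := listGraph id (Sum.elim r new) er

/-- A call of a single rule. -/
def call1 (r : Rule) : Com := .call (fun _ : Unit => r)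

/-- The command that does nothing: a call of the rule with empty left-hand and right-hand side. -/
def skip : Com := call1 (inPlace (m := 0) ![] ![] [] [])

/-- `try C then P`. -/
def tryThen (C P : Com) : Com := .tryte C P skip

/-- `try C else Q`. -/
def tryElse (C Q : Com) : Com := .tryte C skip Q

/-- `try C`. -/
def tryCom (C : Com) : Com := .tryte C skip skip

/-- `if C then P`. -/
def ifThen (C P : Com) : Com := .ite C P skip

/-- `P; Q`. -/
infixr:60 " ;; " => Com.seq

namespace Sim

/-! ### Applying the transition function -/

/-- The label of the unmarked edge that announces the move of the working tape head. -/
def pending : Dir → Atom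
  | .L => .L
  | .R => .R
  | .S => .empty

/-- The rule for an entry `δ(q,a,x) = (p,y,X,Y)` and a symbol `b` on the input square that the input
head moves to. -/
def transitionRule (q : ℤ) (a : Fin 2) (x : Fin 3) (p : ℤ) (y : Fin 3) (X Y : Dir) (b : Fin 2) :
    Rule :=
  match X with
  | .S => inPlace
      ![root (num q), plain (sym a), plain (sym x)]
      ![root (num p), plain (sym a), plain (sym y)]
      [(0, 1, col .green), (0, 2, lab .empty)]
      [(0, 1, col .green), (0, 2, lab (pending Y))]
  | .L => inPlace
      ![root (num q), plain (sym a), plain (sym x), plain (sym b)]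
      ![root (num p), plain (sym a), plain (sym y), plain (sym b)]
      [(0, 1, col .green), (0, 2, lab .empty), (1, 3, col .blue)]
      [(0, 3, col .green), (0, 2, lab (pending Y)), (1, 3, col .blue)]
  | .R => inPlace
      ![root (num q), plain (sym a), plain (sym x), plain (sym b)]
      ![root (num p), plain (sym a), plain (sym y), plain (sym b)]
      [(0, 1, col .green), (0, 2, lab .empty), (1, 3, col .red)]
      [(0, 3, col .green), (0, 2, lab (pending Y)), (1, 3, col .red)]

def Transitions (M : OffLineTM) : Com :=
  .call (fun t : {t : (M.Q × Fin 2 × Fin 3) × (M.Q × Fin 3 × Dir × Dir) × Fin 2 //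
      M.δ t.1.1 t.1.2.1 t.1.2.2 = some t.2.1} =>
    transitionRule t.1.1.1 t.1.1.2.1 t.1.1.2.2
      t.1.2.1.1 t.1.2.1.2.1 t.1.2.1.2.2.1 t.1.2.1.2.2.2 t.1.2.2)

/-! ### Moving the working tape head inside CACHE -/

/-- The working tape head, whose edge carries the atom `a`, moves along an edge marked `m`. -/
def headMove (M : OffLineTM) (a : Atom) (m : Mark) : Com :=
  .call (fun i : M.Q × Fin 3 × Fin 3 => inPlace
    ![root (num i.1), plain (sym i.2.1), plain (sym i.2.2)]
    ![root (num i.1), plain (sym i.2.1), plain (sym i.2.2)]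
    [(0, 1, lab a), (1, 2, col m)]
    [(0, 2, lab .empty), (1, 2, col m)])

def MoveLeft (M : OffLineTM) : Com := headMove M .L .blue
def MoveRight (M : OffLineTM) : Com := headMove M .R .red
def HeadLeft (M : OffLineTM) : Com := headMove M .empty .blue
def HeadRight (M : OffLineTM) : Com := headMove M .empty .red

/-- Detects and removes the atom `a` on the edge of the working tape head. -/
def unlabel (M : OffLineTM) (a : Atom) : Com :=
  .call (fun i : M.Q × Fin 3 => inPlace
    ![root (num i.1), plain (sym i.2)]
    ![root (num i.1), plain (sym i.2)]
    [(0, 1, lab a)]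
    [(0, 1, lab .empty)])

def Left (M : OffLineTM) : Com := unlabel M .L
def Right (M : OffLineTM) : Com := unlabel M .R

/-! ### Signalling that BLOCKSET is exhausted -/

/-- The flag is the mark grey on the central node. -/
def SetFlag (M : OffLineTM) : Com :=
  .call (fun q : M.Q => inPlace ![root (num q)] ![mroot .grey (num q)] [] [])

/-- Removes the flag and resets the state. -/
def Flag (M : OffLineTM) : Com :=
  .call (fun q : M.Q => inPlace ![mroot .grey (num q)] ![root (num M.start)] [] [])

/-! ### Changing the active block -/

/-- The dashed edge of the central node moves along an edge marked `m` of BLOCKSET. -/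
def blockMove (M : OffLineTM) (m : Mark) : Com :=
  .call (fun q : M.Q => inPlace
    ![root (num q), plain .empty, plain .empty]
    ![root (num q), plain .empty, plain .empty]
    [(0, 1, col .dashed), (1, 2, col m)]
    [(0, 2, col .dashed), (1, 2, col m)])

def Next (M : OffLineTM) : Com := blockMove M .red
def Prev (M : OffLineTM) : Com := blockMove M .blue

/-! ### CACHE as a ternary counter -/

def CacheInit (M : OffLineTM) : Com :=
  .call (fun i : M.Q × Fin 3 => inPlace
    ![root (num i.1), plain (sym i.2)]
    ![root (num i.1), mroot .red (sym i.2)]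
    [(0, 1, col .red)]
    [(0, 1, col .red)])

/-- Relabels a red root from `x` to `y`. -/
def digit (x y : Fin 3) : Rule := inPlace ![mroot .red (sym x)] ![mroot .red (sym y)] [] []

def Dec : Com := .call (![digit 1 0, digit 2 1] : Fin 2 → Rule)
def Inc : Com := .call (![digit 0 1, digit 1 2] : Fin 2 → Rule)
def underflow : Com := call1 (digit 0 2)
def overflow : Com := call1 (digit 2 0)

def Finish : Com :=
  .call (fun x : Fin 3 => inPlace ![mroot .red (sym x)] ![plain (sym x)] [] [])

def Unfinished : Com := .call (fun x : Fin 3 => digit x x)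

/-- The red root moves along an edge marked `m`. -/
def redMove (m : Mark) : Com :=
  .call (fun i : Fin 3 × Fin 3 => inPlace
    ![mroot .red (sym i.1), plain (sym i.2)]
    ![plain (sym i.1), mroot .red (sym i.2)]
    [(0, 1, col m)]
    [(0, 1, col m)])

def CacheNext : Com := redMove .blue
def CachePrev : Com := redMove .red

def Reset : Com := overflow ;; tryElse CachePrev .brk

def Decrement : Com :=
  .tryte Dec (Finish ;; .brk) (underflow ;; tryElse CacheNext .brk)

def CacheDec (M : OffLineTM) : Com :=
  CacheInit M ;; .alap Decrement ;; ifThen Unfinished (.alap Reset)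

def Increment : Com :=
  .tryte Inc (Finish ;; .brk) (overflow ;; tryElse CacheNext .brk)

def CacheInc (M : OffLineTM) : Com :=
  CacheInit M ;; .alap Increment ;; ifThen Unfinished (.alap Reset ;; Finish)

/-! ### Encoding CACHE into BLOCKSET and decoding it again -/

/-- The first block node becomes a blue root. -/
def EncodeInit (M : OffLineTM) : Com :=
  .call (fun q : M.Q => inPlace
    ![root (num q), plain .empty]
    ![root (num q), mroot .blue .empty]
    [(0, 1, col .blue)]
    [(0, 1, col .blue)])

/-- The target of the dashed edge of the active block node becomes a blue root. That target may be
the active block node itself. -/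
def DecodeInit (M : OffLineTM) : Com :=
  .call (fun i : M.Q × Bool =>
    if i.2 then inPlace
      ![root (num i.1), plain .empty]
      ![root (num i.1), mroot .blue .empty]
      [(0, 1, col .dashed), (1, 1, col .dashed)]
      [(0, 1, col .dashed), (1, 1, col .dashed)]
    else inPlace
      ![root (num i.1), plain .empty, plain .empty]
      ![root (num i.1), plain .empty, mroot .blue .empty]
      [(0, 1, col .dashed), (1, 2, col .dashed)]
      [(0, 1, col .dashed), (1, 2, col .dashed)])

/-- The blue root moves along an edge marked `m`. -/
def blueMove (m : Mark) : Com :=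
  call1 (inPlace
    ![mroot .blue .empty, plain .empty]
    ![plain .empty, mroot .blue .empty]
    [(0, 1, col m)]
    [(0, 1, col m)])

def next_value : Com := blueMove .red
def prev_value : Com := blueMove .blue

/-- Redirects the dashed edge of the active block node to the blue root, which becomes an ordinary
block node. There is one rule for each way in which the active block node, the old target and
the blue root can coincide. -/
def updateRule (q : ℤ) : Fin 5 → Rule := ![
  inPlace
    ![root (num q), plain .empty, plain .empty, mroot .blue .empty]
    ![root (num q), plain .empty, plain .empty, plain .empty]
    [(0, 1, col .dashed), (1, 2, col .dashed)]
    [(0, 1, col .dashed), (1, 3, col .dashed)],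
  inPlace
    ![root (num q), plain .empty, mroot .blue .empty]
    ![root (num q), plain .empty, plain .empty]
    [(0, 1, col .dashed), (1, 1, col .dashed)]
    [(0, 1, col .dashed), (1, 2, col .dashed)],
  inPlace
    ![root (num q), mroot .blue .empty, plain .empty]
    ![root (num q), plain .empty, plain .empty]
    [(0, 1, col .dashed), (1, 2, col .dashed)]
    [(0, 1, col .dashed), (1, 1, col .dashed)],
  inPlace
    ![root (num q), plain .empty, mroot .blue .empty]
    ![root (num q), plain .empty, plain .empty]
    [(0, 1, col .dashed), (1, 2, col .dashed)]
    [(0, 1, col .dashed), (1, 2, col .dashed)],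
  inPlace
    ![root (num q), mroot .blue .empty]
    ![root (num q), plain .empty]
    [(0, 1, col .dashed), (1, 1, col .dashed)]
    [(0, 1, col .dashed), (1, 1, col .dashed)]]

def Update (M : OffLineTM) : Com := .call (fun i : M.Q × Fin 5 => updateRule i.1 i.2)

def Encoding (M : OffLineTM) : Com :=
  CacheDec M ;; tryThen Finish .brk ;; tryCom next_value

def Encode (M : OffLineTM) : Com := EncodeInit M ;; .alap (Encoding M) ;; Update M

def Decoding (M : OffLineTM) : Com := tryElse prev_value .brk ;; CacheInc M

def Decode (M : OffLineTM) : Com := DecodeInit M ;; .alap (Decoding M) ;; Update M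

def NextBlock (M : OffLineTM) : Com :=
  Encode M ;; .tryte (Next M) (.alap (HeadLeft M) ;; Decode M) (SetFlag M)

def PrevBlock (M : OffLineTM) : Com :=
  Encode M ;; Prev M ;; .alap (HeadRight M) ;; Decode M

/-! ### Restarting with a larger tape -/

/-- The central node in its initial state. -/
def center (M : OffLineTM) : Node := root (num M.start)

def RewindInput (M : OffLineTM) : Com :=
  .call (fun i : Fin 2 × Fin 2 => inPlace
    ![center M, plain (sym i.1), plain (sym i.2)]
    ![center M, plain (sym i.1), plain (sym i.2)]
    [(0, 1, ⟨.I, some .green⟩), (0, 2, col .green)]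
    [(0, 1, ⟨.I, some .green⟩), (0, 1, col .green)])

def rewind_blockset (M : OffLineTM) : Com :=
  call1 (inPlace
    ![center M, plain .empty, plain .empty]
    ![center M, plain .empty, plain .empty]
    [(0, 1, col .blue), (0, 2, col .dashed)]
    [(0, 1, col .blue), (0, 1, col .dashed)])

def RewindCache (M : OffLineTM) : Com :=
  .call (fun i : Fin 3 × Fin 3 => inPlace
    ![center M, plain (sym i.1), plain (sym i.2)]
    ![center M, plain (sym i.1), plain (sym i.2)]
    [(0, 1, lab .empty), (1, 2, col .blue)]
    [(0, 2, lab .empty), (1, 2, col .blue)])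

def RewindTapes (M : OffLineTM) : Com :=
  tryCom (RewindInput M) ;; tryCom (rewind_blockset M) ;; .alap (RewindCache M)

def blank : Atom := sym (2 : Fin 3)

/-- Makes the first CACHE node a blank red root. -/
def CInit (M : OffLineTM) : Com :=
  .call (fun x : Fin 3 => inPlace
    ![center M, plain (sym x)]
    ![center M, mroot .red blank]
    [(0, 1, lab .empty)]
    [(0, 1, lab .empty)])

def Erase : Com :=
  .call (fun x : Fin 3 => inPlace
    ![mroot .red blank, plain (sym x)]
    ![plain blank, mroot .red blank]
    [(0, 1, col .red)]
    [(0, 1, col .red)])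

/-- Appends a blank node to CACHE. -/
def finalSquare (M : OffLineTM) : Com :=
  call1 (creating (a := 1)
    ![center M, mroot .red blank]
    ![center M, plain blank]
    ![plain blank]
    [(0, 1, col .red)]
    [(.inl 0, .inr 0, col .red), (.inl 1, .inr 0, col .red), (.inr 0, .inl 1, col .blue)])

def ResetCache (M : OffLineTM) : Com := CInit M ;; .alap Erase ;; finalSquare M

/-- Makes the first block node a blue root and creates the first nodes, blue roots labelled `1` and
`2`, of two copies of BLOCKSET. Temporary blue edges labelled `1` and `2` keep track of them. -/
def binit (M : OffLineTM) : Com :=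
  call1 (creating (a := 2)
    ![center M, plain .empty]
    ![center M, mroot .blue .empty]
    ![mroot .blue (num 1), mroot .blue (num 2)]
    [(0, 1, col .blue)]
    [(.inl 0, .inl 1, col .blue), (.inl 0, .inr 0, ⟨num 1, some .blue⟩),
      (.inl 0, .inr 1, ⟨num 2, some .blue⟩)])

/-- The blue root moves to the right, and the two copies are extended by a node each. -/
def copy : Com :=
  call1 (creating (a := 2)
    ![mroot .blue .empty, plain .empty, mroot .blue (num 1), mroot .blue (num 2)]
    ![plain .empty, mroot .blue .empty, plain .empty, plain .empty]
    ![mroot .blue (num 1), mroot .blue (num 2)]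
    [(0, 1, col .red)]
    [(.inl 0, .inl 1, col .red),
      (.inl 2, .inr 0, col .red), (.inr 0, .inl 2, col .blue),
      (.inl 3, .inr 1, col .red), (.inr 1, .inl 3, col .blue)])

/-- Deletes the dashed edge that leaves the blue root. -/
def Undirect : Com :=
  .call (![
    inPlace ![mroot .blue .empty, plain .empty] ![mroot .blue .empty, plain .empty]
      [(0, 1, col .dashed)] [],
    inPlace ![mroot .blue .empty] ![mroot .blue .empty]
      [(0, 0, col .dashed)] []] : Fin 2 → Rule)

/-- Appends the two copies to BLOCKSET. Node `1` is the last node of the original, nodes `2` and `3`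
are the ends of the first copy, nodes `4` and `5` those of the second copy, and node `6` is the
penultimate node of the second copy. -/
def glue (M : OffLineTM) : Com :=
  call1 (inPlace
    ![center M, mroot .blue .empty, plain .empty, mroot .blue (num 1), plain .empty,
      mroot .blue (num 2), plain .empty]
    ![center M, plain .empty, plain .empty, plain .empty, plain .empty,
      mroot .blue (num 2), root .empty]
    [(0, 2, ⟨num 1, some .blue⟩), (0, 4, ⟨num 2, some .blue⟩), (5, 6, col .blue)]
    [(1, 2, col .red), (2, 1, col .blue), (3, 4, col .red), (4, 3, col .blue),
      (5, 6, col .blue), (5, 5, col .dashed)])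

/-- The unmarked root moves to the left and leaves a dashed edge to the final block node. -/
def direct : Com :=
  call1 (inPlace
    ![root .empty, plain .empty, mroot .blue (num 2)]
    ![plain .empty, root .empty, mroot .blue (num 2)]
    [(0, 1, col .blue)]
    [(0, 1, col .blue), (0, 2, col .dashed)])

/-- Removes the unmarked root, which is now the first block node and gets its dashed loop, and the
blue root. -/
def unroot : Com :=
  call1 (inPlace
    ![root .empty, mroot .blue (num 2)]
    ![plain .empty, plain .empty]
    []
    [(0, 0, col .dashed)])

def ResetBlockset (M : OffLineTM) : Com :=
  binit M ;; tryCom Undirect ;; .alap (copy ;; tryCom Undirect) ;; glue M ;; .alap direct ;; unroot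

def Restart (M : OffLineTM) : Com := RewindTapes M ;; ResetCache M ;; ResetBlockset M

/-! ### The loop body -/

def Simulate (M : OffLineTM) : Com :=
  Transitions M ;; tryCom (MoveLeft M) ;; tryCom (MoveRight M) ;;
    tryThen (Left M) (PrevBlock M) ;; tryThen (Right M) (NextBlock M) ;;
    tryThen (Flag M) (Restart M)

end Sim

/-! ## Simulation -/

/-- The loop `P!` simulates `M`: for every nonempty input with initial configuration `I` and all
configurations `S`, `S'` with `I ⇒* S ⇒ S'` there is a `k` such that `enc_k(S)` and `enc_k(S')`
exist, iterating the body `P` leads from `enc_0(I)` to `enc_k(S)`, and a complete execution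
of `P` leads from `enc_k(S)` to `enc_k(S')`. -/
def Simulates (P : Com) (M : OffLineTM) : Prop :=
  ∀ (n : ℕ) [NeZero n] (w : Fin n → Fin 2) (S S' : M.Config n),
    Relation.ReflTransGen M.Trans (M.init w) S → M.Trans S S' →
    ∃ (k : ℕ) (h : Fits k S) (h' : Fits k S'),
      Star (.run (.alap P) (enc 0 (M.init w) (fits_init 0 w))) (.run (.alap P) (enc k S h)) ∧
      Star (.run P (enc k S h)) (.done (enc k S' h'))

end SGP2

namespace SGP2

section

/-! ## Execution of programs -/

-- CACHE is a window on the working tape. It shows the active block, while every other block is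
-- stored in unary, by the position in BLOCKSET of the target of its dashed edge. A block of `c`
-- squares has `3 ^ c` possible contents and there are `3 ^ c` block nodes, so each content has its
-- node. To store a block, CACHE is decremented as a ternary counter while a blue root walks to the
-- right from block node 0; when the counter reaches zero, the root stands on the right node
-- (`exec_encode`). To load a block, the root walks back to the left while the counter is
-- incremented (`exec_decode`). So if `S` and `S'` both fit, one execution of the body leads from
-- `enc k S` to `enc k S'`, with a change of blocks exactly if the head leaves its block
-- (`execAll_simulate`).
--
-- If the head leaves the last block, the body raises the flag, erases everything and builds the
-- encoding of the initial configuration for `k + 1` (`execAll_simulate_restart`): CACHE gets one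
-- more node and BLOCKSET is tripled. The simulation then has to begin anew. Induction on the
-- computation of `M` therefore carries more than a run from `enc 0 I` to `enc k S`: the predicate
-- `Reached` also contains, for every `k' ≥ k`, a run from `enc k' I` to `enc k' S`. After a restart
-- this second part replays the computation on the larger tape (`Reached.exists_fits`). Since a step
-- moves the head by at most one square, one restart is enough to make room for `S'`.
--
-- Graphs are described by layouts, in which nodes and edges have fixed names; a layout determines
-- its graphs up to isomorphism. The effect of a rule is verified on names (`Rule.leads_of` and its
-- variants), and that it has no match is refuted on names (`Occurs`). The statements `Exec`,
-- `Fails` and `Breaks` compose along the syntax of the program. As derivations are defined up to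
-- isomorphism, a final rule call can end in any prescribed graph with the right layout, which is
-- what `ExecAll` records and what allows the execution to end in `enc k S'` itself.

theorem Star.trans {a b c : Conf} : Star a b → Star b c → Star a c
  | .refl, h => h
  | .head s p, h => .head s (p.trans h)

theorem Star.single {a b : Conf} (h : Step a b) : Star a b := .head h .refl

theorem Star.plus_of_step {a b c : Conf} (s : Step a b) : Star b c → Plus a c
  | .refl => .single s
  | .head s' p => .head s (p.plus_of_step s')

/-- The premises for conditions and loop bodies ask for at least one step. This is automatic for an
execution that has terminated, because a running configuration is neither a graph nor `fail`. -/
theorem Star.plus_of_ne {a b : Conf} (h : Star a b) (hab : a ≠ b) : Plus a b := by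
  cases h with
  | refl => exact absurd rfl hab
  | head s p => exact p.plus_of_step s

theorem Star.plus_done {P : Com} {G H : HostGraph} (h : Star (.run P G) (.done H)) :
    Plus (.run P G) (.done H) := h.plus_of_ne (by simp)

theorem Star.plus_fail {P : Com} {G : HostGraph} (h : Star (.run P G) .fail) :
    Plus (.run P G) .fail := h.plus_of_ne (by simp)

/-- The configuration of `P; Q` that corresponds to a configuration of `P`. -/
def Conf.andThen (Q : Com) : Conf → Conf
  | .run P G => .run (P ;; Q) G
  | .done G => .run Q G
  | .fail => .fail

/-- The three step rules for `P; Q` correspond to the three kinds of configuration that a step of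
`P` can produce; a terminated configuration has no further step. -/
theorem Star.andThen (Q : Com) {a b : Conf} : Star a b → Star (a.andThen Q) (b.andThen Q)
  | .refl => .refl
  | .head (b := c) s p => by
    refine Star.trans ?_ (p.andThen Q)
    cases a with
    | run P G =>
      cases c with
      | run P' H => exact .single (.seq1 s)
      | done H => exact .single (.seq2 s)
      | fail => exact .single (.seq3 s)
    | done G => cases s
    | fail => cases s

/-! ## Layouts: graphs with named nodes and edges -/

/-- Names of nodes. -/
inductive NodeName
  | center
  | input (i : ℕ)
  | block (i : ℕ)
  | cache (i : ℕ)

/-- Names of edges. An edge `xRight i` leads from node `i` to node `i + 1`, and `xLeft i` leads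
back. The edges `copyFirst` lead from the central node to the two copies of BLOCKSET. -/
inductive EdgeName
  | inputFirst
  | inputHead
  | blockFirst
  | blockActive
  | cacheLast
  | cacheHead
  | copyFirst (second : Bool)
  | inputRight (i : ℕ)
  | inputLeft (i : ℕ)
  | blockRight (i : ℕ)
  | blockLeft (i : ℕ)
  | cacheRight (i : ℕ)
  | cacheLeft (i : ℕ)
  | content (i : ℕ)

/-- The source of an edge. -/
def EdgeName.src : EdgeName → NodeName
  | .inputFirst | .inputHead | .blockFirst | .blockActive | .cacheLast | .cacheHead
  | .copyFirst _ => .center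
  | .inputRight i => .input i
  | .inputLeft i => .input (i + 1)
  | .blockRight i => .block i
  | .blockLeft i => .block (i + 1)
  | .cacheRight i => .cache i
  | .cacheLeft i => .cache (i + 1)
  | .content i => .block i

/-- A graph whose nodes and edges are named. -/
structure Layout where
  nodes : NodeName → Prop
  edges : EdgeName → Prop
  node : NodeName → Node
  tgt : EdgeName → NodeName
  label : EdgeName → Label

/-- Naming the nodes and edges of `G` by `ν` and `ε` shows that `G` has the layout `A`. -/
structure Naming (G : HostGraph) (A : Layout) (ν : G.V → NodeName) (ε : G.graph.E → EdgeName) :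
    Prop where
  injV : Function.Injective ν
  injE : Function.Injective ε
  rangeV : ∀ x, A.nodes x ↔ ∃ v, ν v = x
  rangeE : ∀ x, A.edges x ↔ ∃ e, ε e = x
  src_eq : ∀ e, ν (G.graph.src e) = (ε e).src
  tgt_eq : ∀ e, ν (G.graph.tgt e) = A.tgt (ε e)
  nodeLabel_eq : ∀ v, G.graph.nodeLabel v = (A.node (ν v)).label
  edgeLabel_eq : ∀ e, G.graph.edgeLabel e = A.label (ε e)
  roots_iff : ∀ v, v ∈ G.graph.roots ↔ (A.node (ν v)).isRoot = true

/-- `G` has the layout `A`. -/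
def HasLayout (G : HostGraph) (A : Layout) : Prop := ∃ ν ε, Naming G A ν ε

/-- Both namings are bijections onto the same sets of names, so one followed by the inverse of the
other is an isomorphism. -/
theorem HasLayout.iso {G H : HostGraph} {A : Layout} (hG : HasLayout G A) (hH : HasLayout H A) :
    G.Iso H := by
  obtain ⟨ν, ε, h⟩ := hG
  obtain ⟨ν', ε', h'⟩ := hH
  have eV : ∀ v, ∃ v', ν' v' = ν v := fun v => (h'.rangeV _).1 ((h.rangeV _).2 ⟨v, rfl⟩)
  have eE : ∀ e, ∃ e', ε' e' = ε e := fun e => (h'.rangeE _).1 ((h.rangeE _).2 ⟨e, rfl⟩)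
  choose φ hφ using eV
  choose ψ hψ using eE
  have bφ : Function.Bijective φ := by
    refine ⟨fun a b hab => h.injV (by rw [← hφ, hab, hφ]), fun w => ?_⟩
    obtain ⟨v, hv⟩ := (h.rangeV _).1 ((h'.rangeV _).2 ⟨w, rfl⟩)
    exact ⟨v, h'.injV (by rw [hφ, hv])⟩
  have bψ : Function.Bijective ψ := by
    refine ⟨fun a b hab => h.injE (by rw [← hψ, hab, hψ]), fun w => ?_⟩
    obtain ⟨v, hv⟩ := (h.rangeE _).1 ((h'.rangeE _).2 ⟨w, rfl⟩)
    exact ⟨v, h'.injE (by rw [hψ, hv])⟩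
  refine ⟨Equiv.ofBijective φ bφ, Equiv.ofBijective ψ bψ, fun e => h'.injV ?_, fun e => h'.injV ?_,
    fun v => ?_, fun e => ?_, fun v => ?_⟩
  · simp [hφ, hψ, h.src_eq, h'.src_eq]
  · simp [hφ, hψ, h.tgt_eq, h'.tgt_eq]
  · simp [hφ, h.nodeLabel_eq, h'.nodeLabel_eq]
  · simp [hψ, h.edgeLabel_eq, h'.edgeLabel_eq]
  · simp [hφ, h.roots_iff, h'.roots_iff]

/-- What a layout says about absent names is irrelevant. This absorbs the junk values of functions
on `ℕ` that describe finite lists. -/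
theorem HasLayout.congr {G : HostGraph} {A B : Layout} (hG : HasLayout G A)
    (hN : ∀ x, B.nodes x ↔ A.nodes x) (hE : ∀ x, B.edges x ↔ A.edges x)
    (hn : ∀ x, A.nodes x → B.node x = A.node x)
    (he : ∀ x, A.edges x → B.tgt x = A.tgt x ∧ B.label x = A.label x) : HasLayout G B := by
  obtain ⟨ν, ε, h⟩ := hG
  have mV : ∀ v, A.nodes (ν v) := fun v => (h.rangeV _).2 ⟨v, rfl⟩
  have mE : ∀ v, A.edges (ε v) := fun v => (h.rangeE _).2 ⟨v, rfl⟩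
  refine ⟨ν, ε, h.injV, h.injE, fun x => by rw [hN, h.rangeV], fun x => by rw [hE, h.rangeE],
    h.src_eq, fun e => ?_, fun v => ?_, fun e => ?_, fun v => ?_⟩
  · rw [(he _ (mE e)).1, h.tgt_eq]
  · rw [hn _ (mV v), h.nodeLabel_eq]
  · rw [(he _ (mE e)).2, h.edgeLabel_eq]
  · rw [hn _ (mV v), h.roots_iff]

-- Rule application in terms of names

/-- The rule `r` leads from graphs with layout `A` to graphs with layout `B`. -/
def Rule.Leads (r : Rule) (A B : Layout) : Prop :=
  ∀ G, HasLayout G A → ∃ H, r.Derives G H ∧ HasLayout H B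

/-- The rule `r` has no match in graphs with layout `A`. -/
def Rule.Blocked (r : Rule) (A : Layout) : Prop :=
  ∀ G, HasLayout G A → Match r G → False

theorem HostGraph.Iso.refl (G : HostGraph) : G.Iso G :=
  ⟨Equiv.refl _, Equiv.refl _, by simp, by simp, by simp, by simp, by simp⟩

open Classical in
-- The label in `result` comes from a chosen preimage of the node; injectivity of the match makes
-- that preimage unique.
theorem Match.result_nodeLabel {r : Rule} {G : HostGraph} (g : Match r G) (k : r.K)
    (h : ∀ d : r.D, g.onV (Sum.inl k) ≠ g.onV (Sum.inr d)) :
    g.result.graph.nodeLabel (Sum.inl ⟨g.onV (Sum.inl k), h⟩) = r.right.nodeLabel (Sum.inl k) := by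
  have hk : ∃ k' : r.K, g.onV (Sum.inl k') = g.onV (Sum.inl k) := ⟨k, rfl⟩
  have : hk.choose = k := Sum.inl_injective (g.injV hk.choose_spec)
  change (if h : ∃ k' : r.K, g.onV (Sum.inl k') = g.onV (Sum.inl k) then
    r.right.nodeLabel (Sum.inl h.choose) else _) = _
  rw [dif_pos hk, this]

open Classical in
theorem Match.result_nodeLabel_of_notMem {r : Rule} {G : HostGraph} (g : Match r G) (v : g.KeptV)
    (h : ¬ ∃ k : r.K, g.onV (Sum.inl k) = v.1) :
    g.result.graph.nodeLabel (Sum.inl v) = G.graph.nodeLabel v.1 := by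
  change (if h : ∃ k' : r.K, g.onV (Sum.inl k') = v.1 then
    r.right.nodeLabel (Sum.inl h.choose) else _) = _
  rw [dif_neg h]

/-- The names chosen for the left-hand side determine a match, and without deleted nodes the
dangling condition is vacuous. As interfaces contain no edges, all edges of the left-hand side are
deleted and those of the right-hand side are created. A created edge may take over the name of a
deleted one, but not that of an edge that survives; this is `fresh_fe'`. The frame hypotheses say
that `A` and `B` agree away from the rule. -/
theorem Rule.leads_of (r : Rule) [IsEmpty r.D] {A B : Layout} (f : r.K → NodeName)
    (fn : r.N → NodeName) (fe : r.left.E → EdgeName) (fe' : r.right.E → EdgeName)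
    (inj_f : Function.Injective f) (inj_fn : Function.Injective fn)
    (inj_fe : Function.Injective fe) (inj_fe' : Function.Injective fe')
    (mem_f : ∀ k, A.nodes (f k)) (fresh_fn : ∀ n, ¬ A.nodes (fn n))
    (mem_fe : ∀ e, A.edges (fe e)) (fresh_fe' : ∀ e, A.edges (fe' e) → ∃ e', fe e' = fe' e)
    (left_label : ∀ k, r.left.nodeLabel (.inl k) = (A.node (f k)).label)
    (left_root : ∀ k, .inl k ∈ r.left.roots ↔ (A.node (f k)).isRoot = true)
    (left_src : ∀ e, Sum.elim f isEmptyElim (r.left.src e) = (fe e).src)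
    (left_tgt : ∀ e, Sum.elim f isEmptyElim (r.left.tgt e) = A.tgt (fe e))
    (left_edge : ∀ e, r.left.edgeLabel e = A.label (fe e))
    (right_label : ∀ x, r.right.nodeLabel x = (B.node (Sum.elim f fn x)).label)
    (right_root : ∀ x, x ∈ r.right.roots ↔ (B.node (Sum.elim f fn x)).isRoot = true)
    (right_src : ∀ e, Sum.elim f fn (r.right.src e) = (fe' e).src)
    (right_tgt : ∀ e, Sum.elim f fn (r.right.tgt e) = B.tgt (fe' e))
    (right_edge : ∀ e, r.right.edgeLabel e = B.label (fe' e))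
    (nodes_iff : ∀ x, B.nodes x ↔ A.nodes x ∨ ∃ n, fn n = x)
    (edges_iff : ∀ x, B.edges x ↔ (A.edges x ∧ ∀ e, fe e ≠ x) ∨ ∃ e, fe' e = x)
    (frame_node : ∀ x, A.nodes x → (∀ k, f k ≠ x) → B.node x = A.node x)
    (frame_edge : ∀ x, A.edges x → (∀ e, fe e ≠ x) → B.tgt x = A.tgt x ∧ B.label x = A.label x) :
    r.Leads A B := by
  rintro G ⟨ν, ε, h⟩
  choose gV hgV using fun k => (h.rangeV _).1 (mem_f k)
  choose gE hgE using fun e => (h.rangeE _).1 (mem_fe e)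
  have hpos : ∀ x : r.K ⊕ r.D, ν (Sum.elim gV isEmptyElim x) = Sum.elim f isEmptyElim x := by
    rintro (k | d)
    · exact hgV k
    · exact isEmptyElim d
  let g : Match r G :=
    { onV := Sum.elim gV isEmptyElim
      onE := gE
      injV := by
        rintro (a | d) (b | d') hab
        · exact congrArg _ (inj_f (by rw [← hgV, ← hgV]; exact congrArg ν hab))
        · exact isEmptyElim d'
        · exact isEmptyElim d
        · exact isEmptyElim d
      injE := fun a b hab => inj_fe (by rw [← hgE, ← hgE, hab])
      src_eq := fun e => h.injV (by rw [hpos, h.src_eq, hgE, left_src])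
      tgt_eq := fun e => h.injV (by rw [hpos, h.tgt_eq, hgE, left_tgt])
      nodeLabel_eq := by
        rintro (k | d)
        · rw [left_label, h.nodeLabel_eq, ← hgV]; rfl
        · exact isEmptyElim d
      edgeLabel_eq := fun e => by rw [left_edge, h.edgeLabel_eq, hgE]
      roots_iff := by
        rintro (k | d)
        · rw [left_root, h.roots_iff, ← hgV]; rfl
        · exact isEmptyElim d
      dangling := fun d => isEmptyElim d }
  have mV : ∀ v, A.nodes (ν v) := fun v => (h.rangeV _).2 ⟨v, rfl⟩
  have mE : ∀ v, A.edges (ε v) := fun v => (h.rangeE _).2 ⟨v, rfl⟩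
  have nV : ∀ v : G.V, (¬ ∃ k, g.onV (.inl k) = v) → B.node (ν v) = A.node (ν v) := fun v hv =>
    frame_node _ (mV v) fun k hk => hv ⟨k, h.injV (by rw [← hk, ← hgV]; rfl)⟩
  -- A surviving edge never has the name of a matched one, since names are injective.
  have nE : ∀ e : g.KeptE, ∀ e', fe e' ≠ ε e.1 := fun e e' he =>
    e.2 ⟨e', h.injE (by rw [← he, ← hgE])⟩
  refine ⟨g.result, ⟨g, HostGraph.Iso.refl _⟩,
    (fun v : g.KeptV ⊕ r.N => match v with
      | .inl v => ν v.1
      | .inr n => fn n),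
    (fun e : g.KeptE ⊕ r.right.E => match e with
      | .inl e => ε e.1
      | .inr e => fe' e), ?_, ?_, ?_, ?_, ?_, ?_, ?_, ?_, ?_⟩
  · rintro (a | a) (b | b) hab
    · exact congrArg _ (Subtype.ext (h.injV hab))
    · replace hab : ν a.1 = fn b := hab
      exact absurd (hab ▸ mV a.1) (fresh_fn b)
    · replace hab : fn a = ν b.1 := hab
      exact absurd (hab ▸ mV b.1) (fresh_fn a)
    · exact congrArg _ (inj_fn hab)
  · rintro (a | a) (b | b) hab
    · exact congrArg _ (Subtype.ext (h.injE hab))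
    · replace hab : ε a.1 = fe' b := hab
      -- A name shared by a surviving and a created edge would be that of a matched edge, which does
      -- not survive.
      obtain ⟨e', he'⟩ := fresh_fe' b (hab ▸ mE a.1)
      exact absurd (he'.trans hab.symm) (nE a e')
    · replace hab : fe' a = ε b.1 := hab
      obtain ⟨e', he'⟩ := fresh_fe' a (hab ▸ mE b.1)
      exact absurd (he'.trans hab) (nE b e')
    · exact congrArg _ (inj_fe' hab)
  · intro x
    rw [nodes_iff, h.rangeV]
    constructor
    · rintro (⟨v, hv⟩ | ⟨n, hn⟩)
      · exact ⟨.inl ⟨v, fun d => isEmptyElim d⟩, hv⟩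
      · exact ⟨.inr n, hn⟩
    · rintro ⟨v | n, hv⟩
      · exact .inl ⟨v.1, hv⟩
      · exact .inr ⟨n, hv⟩
  · intro x
    rw [edges_iff]
    constructor
    · rintro (⟨hx, hx'⟩ | ⟨n, hn⟩)
      · obtain ⟨e, he⟩ := (h.rangeE _).1 hx
        refine ⟨.inl ⟨e, ?_⟩, he⟩
        rintro ⟨e', rfl⟩
        exact hx' e' (by rw [← he, ← hgE])
      · exact ⟨.inr n, hn⟩
    · rintro ⟨e | n, rfl⟩
      · exact .inl ⟨mE e.1, nE e⟩
      · exact .inr ⟨n, rfl⟩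
  · rintro (e | e)
    · exact h.src_eq e.1
    · rw [← right_src]
      change (match g.embed (r.right.src e) with
        | .inl v => ν v.1
        | .inr n => fn n) = _
      cases r.right.src e with
      | inl k => exact hgV k
      | inr n => rfl
  · rintro (e | e)
    · exact (h.tgt_eq e.1).trans (frame_edge _ (mE e.1) (nE e)).1.symm
    · rw [← right_tgt]
      change (match g.embed (r.right.tgt e) with
        | .inl v => ν v.1
        | .inr n => fn n) = _
      cases r.right.tgt e with
      | inl k => exact hgV k
      | inr n => rfl
  · rintro (v | n)
    · by_cases hv : ∃ k, g.onV (.inl k) = v.1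
      · obtain ⟨k, hk⟩ := hv
        obtain ⟨v, hv⟩ := v
        obtain rfl : _ = v := hk
        rw [g.result_nodeLabel k, right_label]
        change _ = (B.node (ν (gV k))).label
        rw [hgV]; rfl
      · rw [g.result_nodeLabel_of_notMem v hv, h.nodeLabel_eq, nV v.1 hv]
    · exact right_label (.inr n)
  · rintro (e | e)
    · exact (h.edgeLabel_eq e.1).trans (frame_edge _ (mE e.1) (nE e)).2.symm
    · exact right_edge e
  · rintro (v | n)
    · change ((v.1 ∈ G.graph.roots ∧ v.1 ∉ Set.range g.onV) ∨
        ∃ k : r.K, g.onV (Sum.inl k) = v.1 ∧ Sum.inl k ∈ r.right.roots) ↔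
        (B.node (ν v.1)).isRoot = true
      by_cases hv : ∃ k, g.onV (.inl k) = v.1
      · obtain ⟨k, hk⟩ := hv
        rw [← hk]
        change _ ↔ (B.node (ν (gV k))).isRoot = true
        rw [hgV, show f k = Sum.elim f fn (.inl k) from rfl, ← right_root]
        constructor
        · rintro (⟨_, h'⟩ | ⟨k', hk', h'⟩)
          · exact absurd ⟨_, rfl⟩ h'
          · cases g.injV hk'; exact h'
        · exact fun h' => .inr ⟨k, rfl, h'⟩
      · rw [nV v.1 hv, ← h.roots_iff]
        constructor
        · rintro (⟨h', _⟩ | ⟨k', hk', h'⟩)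
          · exact h'
          · exact absurd ⟨k', hk'⟩ hv
        · refine fun h' => .inl ⟨h', ?_⟩
          rintro ⟨k | d, hk⟩
          · exact hv ⟨k, hk⟩
          · exact isEmptyElim d
    · exact right_root (.inr n)

end

-- Criteria for rules given by lists of edges, and for their inapplicability

section

theorem forall₂_get_iff {α β : Type*} {R : α → β → Prop} {l : List α} {m : List β}
    (h : List.Forall₂ R l m) (i : Fin m.length) : R (l.get (i.cast h.length_eq.symm)) (m.get i) :=
  (List.forall₂_iff_get.1 h).2 _ _ _

theorem mem_iff_get_cast {α : Type*} {l : List α} {k : ℕ} (h : k = l.length) (x : α) :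
    x ∈ l ↔ ∃ i : Fin k, l.get (i.cast h) = x := by
  subst h
  exact List.mem_iff_get

theorem injective_get_cast {α : Type*} {l : List α} (hl : l.Nodup) {k : ℕ} (h : k = l.length) :
    Function.Injective fun i : Fin k => l.get (i.cast h) := by
  subst h
  exact hl.injective_get

/-- The edge names come as lists parallel to the edge lists of the rule. For a concrete rule the
hypotheses thus unfold to finite conjunctions and to case distinctions on names. -/
theorem leads_creating {m a : ℕ} {l r : Fin m → Node} {new : Fin a → Node}
    {el : List (Fin m × Fin m × Label)} {er : List ((Fin m ⊕ Fin a) × (Fin m ⊕ Fin a) × Label)}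
    {A B : Layout} (f : Fin m → NodeName) (fn : Fin a → NodeName) (es es' : List EdgeName)
    (inj_f : (List.ofFn f).Nodup) (inj_fn : (List.ofFn fn).Nodup)
    (nodup : es.Nodup) (nodup' : es'.Nodup)
    (left_node : ∀ i, A.nodes (f i) ∧ A.node (f i) = l i)
    (right_node : ∀ i, B.node (f i) = r i)
    (new_node : ∀ i, ¬ A.nodes (fn i) ∧ B.node (fn i) = new i)
    (left_edge : List.Forall₂ (fun w e => A.edges w ∧ w.src = f e.1 ∧ A.tgt w = f e.2.1 ∧
      A.label w = e.2.2) es el)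
    (right_edge : List.Forall₂ (fun w e => w.src = Sum.elim f fn e.1 ∧
      B.tgt w = Sum.elim f fn e.2.1 ∧ B.label w = e.2.2) es' er)
    (fresh : ∀ w ∈ es', A.edges w → w ∈ es)
    (nodes_iff : ∀ x, B.nodes x ↔ A.nodes x ∨ ∃ n, fn n = x)
    (edges_iff : ∀ x, B.edges x ↔ (A.edges x ∧ x ∉ es) ∨ x ∈ es')
    (frame_node : ∀ x, A.nodes x → (∀ i, f i ≠ x) → B.node x = A.node x)
    (frame_edge : ∀ x, A.edges x → x ∉ es → B.tgt x = A.tgt x ∧ B.label x = A.label x) :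
    (creating l r new el er).Leads A B := by
  have : IsEmpty (creating l r new el er).D := inferInstanceAs (IsEmpty Empty)
  have hL := fun i => forall₂_get_iff left_edge i
  have hR := fun i => forall₂_get_iff right_edge i
  have hmem := mem_iff_get_cast left_edge.length_eq.symm
  have hmem' := mem_iff_get_cast right_edge.length_eq.symm
  refine Rule.leads_of (creating l r new el er) (A := A) (B := B) f fn
    (fun i : Fin el.length => es.get (i.cast left_edge.length_eq.symm))
    (fun i : Fin er.length => es'.get (i.cast right_edge.length_eq.symm))
    (List.nodup_ofFn.1 inj_f) (List.nodup_ofFn.1 inj_fn)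
    (injective_get_cast nodup _) (injective_get_cast nodup' _) (fun k => (left_node k).1)
    (fun k => (new_node k).1) (fun e => (hL e).1)
    (fun e he => (hmem _).1 (fresh _ (List.get_mem _ _) he)) (fun k => ?_) (fun k => ?_)
    (fun e => (hL e).2.1.symm) (fun e => (hL e).2.2.1.symm) (fun e => (hL e).2.2.2.symm) ?_ ?_
    (fun e => (hR e).1.symm) (fun e => (hR e).2.1.symm) (fun e => (hR e).2.2.symm) nodes_iff
    (fun x => ?_) frame_node (fun x hx hx' => frame_edge x hx fun h => ?_)
  · rw [(left_node k).2]; rfl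
  · rw [(left_node k).2]; rfl
  · rintro (k | k)
    · exact congrArg Node.label (right_node k).symm
    · exact congrArg Node.label ((new_node k).2).symm
  · rintro (k | k)
    · exact Iff.of_eq (congrArg (fun x : Node => x.isRoot = true) (right_node k).symm)
    · exact Iff.of_eq (congrArg (fun x : Node => x.isRoot = true) ((new_node k).2).symm)
  · rw [edges_iff, hmem, hmem', not_exists]; rfl
  · obtain ⟨i, hi⟩ := (hmem _).1 h
    exact hx' i hi

theorem leads_inPlace {m : ℕ} {l r : Fin m → Node} {el er : List (Fin m × Fin m × Label)}
    {A B : Layout} (f : Fin m → NodeName) (es es' : List EdgeName)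
    (inj_f : (List.ofFn f).Nodup) (nodup : es.Nodup) (nodup' : es'.Nodup)
    (left_node : ∀ i, A.nodes (f i) ∧ A.node (f i) = l i)
    (right_node : ∀ i, B.node (f i) = r i)
    (left_edge : List.Forall₂ (fun w e => A.edges w ∧ w.src = f e.1 ∧ A.tgt w = f e.2.1 ∧
      A.label w = e.2.2) es el)
    (right_edge : List.Forall₂ (fun w e => w.src = f e.1 ∧ B.tgt w = f e.2.1 ∧
      B.label w = e.2.2) es' er)
    (fresh : ∀ w ∈ es', A.edges w → w ∈ es)
    (nodes_iff : ∀ x, B.nodes x ↔ A.nodes x)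
    (edges_iff : ∀ x, B.edges x ↔ (A.edges x ∧ x ∉ es) ∨ x ∈ es')
    (frame_node : ∀ x, A.nodes x → (∀ i, f i ≠ x) → B.node x = A.node x)
    (frame_edge : ∀ x, A.edges x → x ∉ es → B.tgt x = A.tgt x ∧ B.label x = A.label x) :
    (inPlace l r el er).Leads A B := by
  have : IsEmpty (inPlace l r el er).D := inferInstanceAs (IsEmpty Empty)
  have : IsEmpty (inPlace l r el er).N := inferInstanceAs (IsEmpty Empty)
  have hL := fun i => forall₂_get_iff left_edge i
  have hR := fun i => forall₂_get_iff right_edge i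
  have hmem := mem_iff_get_cast left_edge.length_eq.symm
  have hmem' := mem_iff_get_cast right_edge.length_eq.symm
  refine Rule.leads_of (inPlace l r el er) (A := A) (B := B) f isEmptyElim
    (fun i : Fin el.length => es.get (i.cast left_edge.length_eq.symm))
    (fun i : Fin er.length => es'.get (i.cast right_edge.length_eq.symm))
    (List.nodup_ofFn.1 inj_f)
    (fun a => isEmptyElim a)
    (injective_get_cast nodup _) (injective_get_cast nodup' _) (fun k => (left_node k).1)
    (fun k => isEmptyElim k) (fun e => (hL e).1)
    (fun e he => (hmem _).1 (fresh _ (List.get_mem _ _) he)) (fun k => ?_) (fun k => ?_)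
    (fun e => (hL e).2.1.symm) (fun e => (hL e).2.2.1.symm) (fun e => (hL e).2.2.2.symm) ?_ ?_
    (fun e => (hR e).1.symm) (fun e => (hR e).2.1.symm) (fun e => (hR e).2.2.symm)
    (fun x => by simp [nodes_iff])
    (fun x => ?_) frame_node (fun x hx hx' => frame_edge x hx fun h => ?_)
  · rw [(left_node k).2]; rfl
  · rw [(left_node k).2]; rfl
  · rintro (k | k)
    · exact congrArg Node.label (right_node k).symm
    · exact isEmptyElim k
  · rintro (k | k)
    · exact Iff.of_eq (congrArg (fun x : Node => x.isRoot = true) (right_node k).symm)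
    · exact isEmptyElim k
  · rw [edges_iff, hmem, hmem', not_exists]; rfl
  · obtain ⟨i, hi⟩ := (hmem _).1 h
    exact hx' i hi

/-- A rule that redirects and relabels the edges of its left-hand side. -/
theorem leads_redirect {m : ℕ} {l r : Fin m → Node} {el er : List (Fin m × Fin m × Label)}
    {A B : Layout} (f : Fin m → NodeName) (es : List EdgeName)
    (inj_f : (List.ofFn f).Nodup) (nodup : es.Nodup)
    (left_node : ∀ i, A.nodes (f i) ∧ A.node (f i) = l i)
    (right_node : ∀ i, B.node (f i) = r i)
    (left_edge : List.Forall₂ (fun w e => A.edges w ∧ w.src = f e.1 ∧ A.tgt w = f e.2.1 ∧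
      A.label w = e.2.2) es el)
    (right_edge : List.Forall₂ (fun w e => w.src = f e.1 ∧ B.tgt w = f e.2.1 ∧
      B.label w = e.2.2) es er)
    (nodes_eq : B.nodes = A.nodes) (edges_eq : B.edges = A.edges)
    (frame_node : ∀ x, A.nodes x → (∀ i, f i ≠ x) → B.node x = A.node x)
    (frame_edge : ∀ x, A.edges x → x ∉ es → B.tgt x = A.tgt x ∧ B.label x = A.label x) :
    (inPlace l r el er).Leads A B := by
  refine leads_inPlace f es es inj_f nodup nodup left_node right_node left_edge right_edge
    (fun w hw _ => hw) (fun x => by rw [nodes_eq]) (fun x => ?_) frame_node frame_edge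
  -- The matched edges are present beforehand, so deleting and recreating them leaves the set of
  -- names unchanged.
  have : x ∈ es → A.edges x := fun hx => by
    obtain ⟨i, hi⟩ := (mem_iff_get_cast left_edge.length_eq.symm x).1 hx
    exact hi ▸ (forall₂_get_iff left_edge i).1
  rw [edges_eq]
  tauto

/-- The left-hand side with nodes `l` and edges `el` has an occurrence in graphs with layout `A`. -/
def Occurs {m : ℕ} (l : Fin m → Node) (el : List (Fin m × Fin m × Label)) (A : Layout) : Prop :=
  ∃ f : Fin m → NodeName, Function.Injective f ∧ (∀ i, A.nodes (f i) ∧ A.node (f i) = l i) ∧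
    ∀ e ∈ el, ∃ w, A.edges w ∧ w.src = f e.1 ∧ A.tgt w = f e.2.1 ∧ A.label w = e.2.2

/-- A match followed by a naming is an occurrence on names, where edge labels and sources can be
inspected by cases. The maps `i` and `j` serve to treat both forms of rules at once. -/
theorem occurs_of_match {r : Rule} {m : ℕ} {l : Fin m → Node} {el : List (Fin m × Fin m × Label)}
    {A : Layout} {G : HostGraph} (hG : HasLayout G A) (g : Match r G)
    (i : Fin m → r.K ⊕ r.D) (hi : Function.Injective i) (j : Fin el.length → r.left.E)
    (label_eq : ∀ k, r.left.nodeLabel (i k) = (l k).label)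
    (root_iff : ∀ k, i k ∈ r.left.roots ↔ (l k).isRoot = true)
    (src_eq : ∀ e, r.left.src (j e) = i (el.get e).1)
    (tgt_eq : ∀ e, r.left.tgt (j e) = i (el.get e).2.1)
    (edge_eq : ∀ e, r.left.edgeLabel (j e) = (el.get e).2.2) : Occurs l el A := by
  obtain ⟨ν, ε, h⟩ := hG
  refine ⟨fun k => ν (g.onV (i k)), fun a b hab => hi (g.injV (h.injV hab)), fun k =>
    ⟨(h.rangeV _).2 ⟨_, rfl⟩, ?_⟩, fun e he => ?_⟩
  · have h1 : (A.node (ν (g.onV (i k)))).label = (l k).label := by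
      rw [← h.nodeLabel_eq, g.nodeLabel_eq, label_eq]
    have h2 : (A.node (ν (g.onV (i k)))).isRoot = true ↔ (l k).isRoot = true := by
      rw [← h.roots_iff, g.roots_iff, root_iff]
    rw [← Bool.eq_iff_iff] at h2
    cases hA : A.node (ν (g.onV (i k)))
    cases hl : l k
    simp_all
  · obtain ⟨e, rfl⟩ := List.mem_iff_get.1 he
    refine ⟨ε (g.onE (j e)), (h.rangeE _).2 ⟨_, rfl⟩, ?_, ?_, ?_⟩
    · rw [← h.src_eq, g.src_eq, src_eq]
    · rw [← h.tgt_eq, g.tgt_eq, tgt_eq]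
    · rw [← h.edgeLabel_eq, g.edgeLabel_eq, edge_eq]

theorem blocked_inPlace {m : ℕ} {l r : Fin m → Node} {el er : List (Fin m × Fin m × Label)}
    {A : Layout} (h : ¬ Occurs l el A) : (inPlace l r el er).Blocked A := fun _ hG g =>
  h (occurs_of_match hG g Sum.inl Sum.inl_injective id (fun _ => rfl) (fun _ => Iff.rfl)
    (fun _ => rfl) (fun _ => rfl) (fun _ => rfl))

theorem blocked_creating {m a : ℕ} {l r : Fin m → Node} {new : Fin a → Node}
    {el : List (Fin m × Fin m × Label)} {er : List ((Fin m ⊕ Fin a) × (Fin m ⊕ Fin a) × Label)}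
    {A : Layout} (h : ¬ Occurs l el A) : (creating l r new el er).Blocked A := fun _ hG g =>
  h (occurs_of_match hG g Sum.inl Sum.inl_injective id (fun _ => rfl) (fun _ => Iff.rfl)
    (fun _ => rfl) (fun _ => rfl) (fun _ => rfl))

/-! ## Execution of programs on layouts -/

/-- From every graph with layout `A`, a complete execution of `P` leads to a graph with
layout `B`. -/
def Exec (P : Com) (A B : Layout) : Prop :=
  ∀ G, HasLayout G A → ∃ H, HasLayout H B ∧ Star (.run P G) (.done H)

/-- From every graph with layout `A`, a complete execution of `P` leads to every graph with
layout `B`. -/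
def ExecAll (P : Com) (A B : Layout) : Prop :=
  ∀ G H, HasLayout G A → HasLayout H B → Star (.run P G) (.done H)

/-- On every graph with layout `A`, some execution of `P` fails. -/
def Fails (P : Com) (A : Layout) : Prop :=
  ∀ G, HasLayout G A → Star (.run P G) .fail

/-- From every graph with layout `A`, some execution of `P` reaches `break` with a graph with
layout `B`. -/
def Breaks (P : Com) (A B : Layout) : Prop :=
  ∀ G, HasLayout G A → ∃ H, HasLayout H B ∧ Star (.run P G) (.run .brk H)

variable {A B C : Layout} {P P' Q : Com}

theorem exec_call {ι : Type} [Finite ι] {rules : ι → Rule} (i : ι) (h : (rules i).Leads A B) :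
    Exec (.call rules) A B := fun G hG => by
  obtain ⟨H, hd, hH⟩ := h G hG
  exact ⟨H, hH, .single (.call1 ⟨i, hd⟩)⟩

theorem HostGraph.Iso.trans {G H K : HostGraph} : G.Iso H → H.Iso K → G.Iso K := by
  rintro ⟨φ, ψ, a, b, c, d, e⟩ ⟨φ', ψ', a', b', c', d', e'⟩
  exact ⟨φ.trans φ', ψ.trans ψ', by simp [a, a'], by simp [b, b'], by simp [c, c'], by simp [d, d'],
    by simp [e, e']⟩

/-- The result of the match is isomorphic to every graph with layout `B`, and a derivation may end
in any isomorphic copy. A terminating loop returns the very graph at hand, so `ExecAll` is only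
available for programs that end in a rule call. -/
theorem execAll_call {ι : Type} [Finite ι] {rules : ι → Rule} (i : ι) (h : (rules i).Leads A B) :
    ExecAll (.call rules) A B := fun G H hG hH => by
  obtain ⟨H', ⟨g, hg⟩, hH'⟩ := h G hG
  exact .single (.call1 ⟨i, g, hg.trans (hH'.iso hH)⟩)

theorem fails_call {ι : Type} [Finite ι] {rules : ι → Rule} (h : ∀ i, (rules i).Blocked A) :
    Fails (.call rules) A := fun G hG =>
  .single (.call2 fun ⟨_, i, g, _⟩ => h i G hG g)

theorem Exec.seq (h : Exec P A B) (h' : Exec Q B C) : Exec (P ;; Q) A C := fun G hG => by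
  obtain ⟨H, hH, s⟩ := h G hG
  obtain ⟨K, hK, s'⟩ := h' H hH
  exact ⟨K, hK, (s.andThen Q).trans s'⟩

theorem Exec.seqAll (h : Exec P A B) (h' : ExecAll Q B C) : ExecAll (P ;; Q) A C :=
  fun G K hG hK => by
    obtain ⟨H, hH, s⟩ := h G hG
    exact (s.andThen Q).trans (h' H K hH hK)

theorem Exec.seq_breaks (h : Exec P A B) (h' : Breaks Q B C) : Breaks (P ;; Q) A C := fun G hG => by
  obtain ⟨H, hH, s⟩ := h G hG
  obtain ⟨K, hK, s'⟩ := h' H hH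
  exact ⟨K, hK, (s.andThen Q).trans s'⟩

theorem breaks_brk : Breaks .brk A A := fun G hG => ⟨G, hG, .refl⟩

theorem Breaks.seq (h : Breaks P A B) : Breaks (P ;; Q) A B := fun G hG => by
  obtain ⟨H, hH, s⟩ := h G hG
  exact ⟨H, hH, (s.andThen Q).trans (.single .break1)⟩

theorem Fails.seq (h : Fails P A) : Fails (P ;; Q) A := fun G hG => (h G hG).andThen Q

theorem Exec.tryte (h : Exec P A B) (h' : Exec P' B C) : Exec (.tryte P P' Q) A C := fun G hG => by
  obtain ⟨H, hH, s⟩ := h G hG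
  obtain ⟨K, hK, s'⟩ := h' H hH
  exact ⟨K, hK, .head (.try1 s.plus_done) s'⟩

theorem Exec.tryteAll (h : Exec P A B) (h' : ExecAll P' B C) : ExecAll (.tryte P P' Q) A C :=
  fun G K hG hK => by
    obtain ⟨H, hH, s⟩ := h G hG
    exact .head (.try1 s.plus_done) (h' H K hH hK)

theorem Exec.tryte_breaks (h : Exec P A B) (h' : Breaks P' B C) : Breaks (.tryte P P' Q) A C :=
  fun G hG => by
    obtain ⟨H, hH, s⟩ := h G hG
    obtain ⟨K, hK, s'⟩ := h' H hH
    exact ⟨K, hK, .head (.try1 s.plus_done) s'⟩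

theorem Fails.tryte (h : Fails P A) (h' : Exec Q A B) : Exec (.tryte P P' Q) A B := fun G hG => by
  obtain ⟨K, hK, s⟩ := h' G hG
  exact ⟨K, hK, .head (.try2 (h G hG).plus_fail) s⟩

theorem Fails.tryteAll (h : Fails P A) (h' : ExecAll Q A B) : ExecAll (.tryte P P' Q) A B :=
  fun G H hG hH => .head (.try2 (h G hG).plus_fail) (h' G H hG hH)

theorem Fails.tryte_breaks (h : Fails P A) (h' : Breaks Q A B) : Breaks (.tryte P P' Q) A B :=
  fun G hG => by
    obtain ⟨K, hK, s⟩ := h' G hG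
    exact ⟨K, hK, .head (.try2 (h G hG).plus_fail) s⟩

theorem Exec.ite (h : Exec P A B) (h' : Exec P' A C) : Exec (.ite P P' Q) A C := fun G hG => by
  obtain ⟨H, hH, s⟩ := h G hG
  obtain ⟨K, hK, s'⟩ := h' G hG
  exact ⟨K, hK, .head (.if1 s.plus_done) s'⟩

theorem Fails.ite (h : Fails P A) (h' : Exec Q A C) : Exec (.ite P P' Q) A C := fun G hG => by
  obtain ⟨K, hK, s'⟩ := h' G hG
  exact ⟨K, hK, .head (.if2 (h G hG).plus_fail) s'⟩

theorem Exec.alap (h : Exec P A B) (h' : Exec (.alap P) B C) : Exec (.alap P) A C := fun G hG => by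
  obtain ⟨H, hH, s⟩ := h G hG
  obtain ⟨K, hK, s'⟩ := h' H hH
  exact ⟨K, hK, .head (.alap1 s.plus_done) s'⟩

theorem Fails.alap (h : Fails P A) : Exec (.alap P) A A := fun G hG =>
  ⟨G, hG, .single (.alap2 (h G hG).plus_fail)⟩

theorem Breaks.alap (h : Breaks P A B) : Exec (.alap P) A B := fun G hG => by
  obtain ⟨H, hH, s⟩ := h G hG
  exact ⟨H, hH, .single (.alap3 s)⟩

theorem leads_skip : (inPlace (m := 0) ![] ![] [] []).Leads A A :=
  leads_redirect ![] [] .nil .nil (fun i => i.elim0)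
    (fun i => i.elim0) .nil .nil rfl rfl (fun _ _ _ => rfl) fun _ _ _ => ⟨rfl, rfl⟩

theorem exec_skip : Exec skip A A := exec_call () leads_skip

/-- Even the empty rule may pass to an isomorphic graph, so a program whose last branch is omitted
can still end in a prescribed graph. -/
theorem execAll_skip : ExecAll skip A A := execAll_call () leads_skip

theorem Exec.tryCom (h : Exec P A B) : Exec (tryCom P) A B := h.tryte exec_skip

theorem Fails.tryCom (h : Fails P A) : Exec (tryCom P) A A := h.tryte exec_skip

theorem Fails.tryThen (h : Fails P A) : Exec (tryThen P Q) A A := h.tryte exec_skip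

theorem Exec.tryElse (h : Exec P A B) : Exec (tryElse P Q) A B := h.tryte exec_skip

end

-- Layouts of the graphs met by the program; rules for the heads, the flag and the active block

section

/-- The part of a layout outside BLOCKSET: the length and the content of the input tape, the
position of the input head, the central node, the index of the last CACHE node, the symbols of CACHE
and the position of the red root, the position of the working head and the atom on its edge, and the
index of the active block. -/
structure Tapes where
  len : ℕ
  input : ℕ → Fin 2
  inHead : ℕ
  center : Node
  last : ℕ
  cache : ℕ → Fin 3
  red : Option ℕ
  head : ℕ
  move : Atom
  active : ℕ

/-- BLOCKSET, possibly with its two copies of size `size`: the block nodes, the positions of the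
links, the node labels, the nodes with a dashed edge and the targets of these edges, and the
presence of the edges from the central node to the copies. -/
structure Blocks where
  mem : ℕ → Prop
  linked : ℕ → Prop
  node : ℕ → Node
  directed : ℕ → Prop
  content : ℕ → ℕ
  copied : Prop
  size : ℕ

/-- The layout consisting of the two parts. -/
def Tapes.layout (t : Tapes) (s : Blocks) : Layout where
  nodes := fun v => match v with
    | .center => True
    | .input i => i < t.len
    | .block i => s.mem i
    | .cache i => i ≤ t.last
  edges := fun e => match e with
    | .inputFirst | .inputHead | .blockFirst | .blockActive | .cacheLast | .cacheHead => True
    | .copyFirst _ => s.copied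
    | .inputRight i | .inputLeft i => i + 1 < t.len
    | .blockRight i | .blockLeft i => s.linked i
    | .cacheRight i | .cacheLeft i => i < t.last
    | .content i => s.directed i
  node := fun v => match v with
    | .center => t.center
    | .input i => plain (sym (t.input i))
    | .block i => s.node i
    | .cache i => if t.red = some i then mroot .red (sym (t.cache i)) else plain (sym (t.cache i))
  tgt := fun e => match e with
    | .inputFirst => .input 0
    | .inputHead => .input t.inHead
    | .blockFirst => .block 0
    | .blockActive => .block t.active
    | .cacheLast => .cache t.last
    | .cacheHead => .cache t.head
    | .copyFirst second => .block (if second then 2 * s.size else s.size)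
    | .inputRight i => .input (i + 1)
    | .inputLeft i => .input i
    | .blockRight i => .block (i + 1)
    | .blockLeft i => .block i
    | .cacheRight i => .cache (i + 1)
    | .cacheLeft i => .cache i
    | .content i => .block (s.content i)
  label := fun e => match e with
    | .inputFirst => ⟨.I, some .green⟩
    | .inputHead => col .green
    | .cacheHead => lab t.move
    | .blockActive | .content _ => col .dashed
    | .copyFirst second => ⟨num (if second then 2 else 1), some .blue⟩
    | .blockFirst | .inputLeft _ | .blockLeft _ | .cacheLeft _ => col .blue
    | .cacheLast | .inputRight _ | .blockRight _ | .cacheRight _ => col .red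

/-- BLOCKSET with `b` nodes whose dashed edges have the targets `ct`, where `blue` is the position
of the blue root. -/
def Blocks.list (b : ℕ) (ct : ℕ → ℕ) (blue : Option ℕ) : Blocks where
  mem := fun i => i < b
  linked := fun i => i + 1 < b
  node := fun i => if blue = some i then mroot .blue .empty else plain .empty
  directed := fun i => i < b
  content := ct
  copied := False
  size := b

open Sim

variable {M : OffLineTM} {t : Tapes} {s : Blocks} {q : M.Q}

/-- Like the other lemmas on single rules, this names the nodes and edges that the rule touches and
leaves the conditions of `leads_redirect` to computation. The index of the rule is read off from the
labels present. -/
theorem exec_headMove_blue {a : Atom} {h : ℕ} (hc : t.center = root (num q)) (ha : t.move = a)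
    (hh : t.head = h + 1) (hl : h + 1 ≤ t.last) (hr : t.red = none) :
    Exec (headMove M a .blue) (t.layout s) ({t with head := h, move := .empty}.layout s) := by
  refine exec_call (q, t.cache (h + 1), t.cache h)
    (leads_redirect ![.center, .cache (h + 1), .cache h] [.cacheHead, .cacheLeft h]
    ?_ ?_ ?_ ?_ ?_ ?_
    rfl rfl (fun x _ h => ?_) (fun x _ h => ?_))
  · simp
  · simp
  · simp [Fin.forall_fin_succ, Tapes.layout, hc, hr, ha, hh]; omega
  · simp [Fin.forall_fin_succ, Tapes.layout, hc, hr]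
  · simp [Tapes.layout, EdgeName.src, hc, hr, ha, hh]; omega
  · simp [Tapes.layout, EdgeName.src, hc, hr]
  · cases x <;> rfl
  · cases x <;> first | exact ⟨rfl, rfl⟩ | simp_all [Tapes.layout]

theorem exec_headMove_red {a : Atom} {h : ℕ} (hc : t.center = root (num q)) (ha : t.move = a)
    (hh : t.head = h) (hl : h + 1 ≤ t.last) (hr : t.red = none) :
    Exec (headMove M a .red) (t.layout s) ({t with head := h + 1, move := .empty}.layout s) := by
  refine exec_call (q, t.cache h, t.cache (h + 1))
    (leads_redirect ![.center, .cache h, .cache (h + 1)] [.cacheHead, .cacheRight h]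
    ?_ ?_ ?_ ?_ ?_ ?_
    rfl rfl (fun x _ h => ?_) (fun x _ h => ?_))
  · simp
  · simp
  · simp [Fin.forall_fin_succ, Tapes.layout, hc, hr, ha, hh]; omega
  · simp [Fin.forall_fin_succ, Tapes.layout, hc, hr]
  · simp [Tapes.layout, EdgeName.src, hc, hr, ha, hh]; omega
  · simp [Tapes.layout, EdgeName.src, hc, hr]
  · cases x <;> rfl
  · cases x <;> first | exact ⟨rfl, rfl⟩ | simp_all [Tapes.layout]

/-- The head edge is the only unmarked edge, so its atom decides which of the move rules can apply.
-/
theorem fails_headMove_of_ne {a : Atom} {m : Mark} (ha : t.move ≠ a) :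
    Fails (headMove M a m) (t.layout s) := by
  refine fails_call fun i => blocked_inPlace ?_
  rintro ⟨f, hf, hn, he⟩
  obtain ⟨w, -, -, -, hw⟩ := he _ (List.mem_cons_self ..)
  cases w <;> simp [Tapes.layout, lab, col, ha] at hw

/-- Being unmarked, the first edge must be the head edge, so the second one would leave CACHE node
0; but `cacheLeft i` leaves node `i + 1`. -/
theorem fails_headMove_blue {a : Atom} (h : t.head = 0) :
    Fails (headMove M a .blue) (t.layout s) := by
  refine fails_call fun i => blocked_inPlace ?_
  rintro ⟨f, hf, hn, he⟩
  simp only [List.forall_mem_cons] at he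
  obtain ⟨⟨w, -, -, ht, hw⟩, ⟨w', -, hs', -, hw'⟩, -⟩ := he
  cases w <;> simp [Tapes.layout, lab, col] at hw
  replace ht : NodeName.cache t.head = f 1 := ht
  replace hs' : w'.src = f 1 := hs'
  rw [← ht, h] at hs'
  cases w' <;> simp [EdgeName.src, Tapes.layout, lab, col] at hs' hw'

theorem fails_headMove_red {a : Atom} (h : t.head = t.last) :
    Fails (headMove M a .red) (t.layout s) := by
  refine fails_call fun i => blocked_inPlace ?_
  rintro ⟨f, hf, hn, he⟩
  simp only [List.forall_mem_cons] at he
  obtain ⟨⟨w, -, -, ht, hw⟩, ⟨w', hm', hs', -, hw'⟩, -⟩ := he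
  cases w <;> simp [Tapes.layout, lab, col] at hw
  replace ht : NodeName.cache t.head = f 1 := ht
  replace hs' : w'.src = f 1 := hs'
  rw [← ht, h] at hs'
  cases w' <;> simp [EdgeName.src, Tapes.layout, lab, col] at hs' hw' hm'
  omega

theorem exec_unlabel {a : Atom} (hc : t.center = root (num q)) (ha : t.move = a)
    (hl : t.head ≤ t.last) (hr : t.red = none) :
    Exec (unlabel M a) (t.layout s) ({t with move := .empty}.layout s) := by
  refine exec_call (q, t.cache t.head)
    (leads_redirect ![.center, .cache t.head] [.cacheHead]
    ?_ ?_ ?_ ?_ ?_ ?_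
    rfl rfl (fun x _ h => ?_) (fun x _ h => ?_))
  · simp
  · simp
  · simp [Fin.forall_fin_succ, Tapes.layout, hc, hr, ha, hl]
  · simp [Fin.forall_fin_succ, Tapes.layout, hc, hr]
  · simp [Tapes.layout, EdgeName.src, hc, hr, ha]
  · simp [Tapes.layout, EdgeName.src, hc, hr]
  · cases x <;> rfl
  · cases x <;> first | exact ⟨rfl, rfl⟩ | simp_all [Tapes.layout]

theorem fails_unlabel {a : Atom} (ha : t.move ≠ a) : Fails (unlabel M a) (t.layout s) := by
  refine fails_call fun i => blocked_inPlace ?_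
  rintro ⟨f, hf, hn, he⟩
  obtain ⟨w, -, -, -, hw⟩ := he _ (List.mem_cons_self ..)
  cases w <;> simp [Tapes.layout, lab, col, ha] at hw

theorem exec_setFlag (hc : t.center = root (num q)) :
    Exec (SetFlag M) (t.layout s) ({t with center := mroot .grey (num q)}.layout s) := by
  refine exec_call q (leads_redirect ![.center] [] ?_ ?_ ?_ ?_ ?_ ?_
    rfl rfl (fun x _ h => ?_) (fun x _ h => ?_))
  · simp
  · simp
  · simp [Tapes.layout, hc]
  · simp [Tapes.layout]
  · simp [Tapes.layout, EdgeName.src, hc]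
  · simp [Tapes.layout, EdgeName.src]
  · cases x <;> first | rfl | simp_all [Tapes.layout]
  · cases x <;> exact ⟨rfl, rfl⟩

theorem exec_flag (hc : t.center = mroot .grey (num q)) :
    Exec (Flag M) (t.layout s) ({t with center := root (num M.start)}.layout s) := by
  refine exec_call q (leads_redirect ![.center] [] ?_ ?_ ?_ ?_ ?_ ?_
    rfl rfl (fun x _ h => ?_) (fun x _ h => ?_))
  · simp
  · simp
  · simp [Tapes.layout, hc]
  · simp [Tapes.layout]
  · simp [Tapes.layout, EdgeName.src, hc]
  · simp [Tapes.layout, EdgeName.src]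
  · cases x <;> first | rfl | simp_all [Tapes.layout]
  · cases x <;> exact ⟨rfl, rfl⟩

theorem fails_flag (hc : t.center = root (num q)) (hs : ∀ i a, s.node i ≠ mroot .grey a) :
    Fails (Flag M) (t.layout s) := by
  refine fails_call fun i => blocked_inPlace ?_
  rintro ⟨f, hf, hn, he⟩
  obtain ⟨-, h⟩ := hn 0
  cases hv : f 0 with
  | block i => rw [hv] at h; exact hs _ _ h
  | cache i =>
    simp only [hv, Tapes.layout] at h
    split_ifs at h <;> simp [mroot, plain, lab] at h
  | _ => simp [hv, Tapes.layout, hc, root, mroot, plain, lab] at h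

theorem exec_blockMove_red {a : ℕ} (hc : t.center = root (num q)) (ha : t.active = a)
    (hl : s.linked a) (hm : s.mem a) (hm' : s.mem (a + 1)) (hn : s.node a = plain .empty)
    (hn' : s.node (a + 1) = plain .empty) :
    Exec (blockMove M .red) (t.layout s) ({t with active := a + 1}.layout s) := by
  refine exec_call q
    (leads_redirect ![.center, .block a, .block (a + 1)] [.blockActive, .blockRight a]
    ?_ ?_ ?_ ?_ ?_ ?_
    rfl rfl (fun x _ h => ?_) (fun x _ h => ?_))
  · simp
  · simp
  · simp [Fin.forall_fin_succ, Tapes.layout, hc, ha, hm, hm', hn, hn']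
  · simp [Fin.forall_fin_succ, Tapes.layout, hc, hn, hn']
  · simp [Tapes.layout, EdgeName.src, hc, ha, hl]
  · simp [Tapes.layout, EdgeName.src, hc]
  · cases x <;> rfl
  · cases x <;> first | exact ⟨rfl, rfl⟩ | simp_all [Tapes.layout]

theorem exec_blockMove_blue {a : ℕ} (hc : t.center = root (num q)) (ha : t.active = a + 1)
    (hl : s.linked a) (hm : s.mem a) (hm' : s.mem (a + 1)) (hn : s.node a = plain .empty)
    (hn' : s.node (a + 1) = plain .empty) :
    Exec (blockMove M .blue) (t.layout s) ({t with active := a}.layout s) := by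
  refine exec_call q
    (leads_redirect ![.center, .block (a + 1), .block a] [.blockActive, .blockLeft a]
    ?_ ?_ ?_ ?_ ?_ ?_
    rfl rfl (fun x _ h => ?_) (fun x _ h => ?_))
  · simp
  · simp
  · simp [Fin.forall_fin_succ, Tapes.layout, hc, ha, hm, hm', hn, hn']
  · simp [Fin.forall_fin_succ, Tapes.layout, hc, hn, hn']
  · simp [Tapes.layout, EdgeName.src, hc, ha, hl]
  · simp [Tapes.layout, EdgeName.src, hc]
  · cases x <;> rfl
  · cases x <;> first | exact ⟨rfl, rfl⟩ | simp_all [Tapes.layout]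

theorem fails_blockMove_red (hl : ¬ s.linked t.active) (hn : ∀ i a, s.node i ≠ root a) :
    Fails (blockMove M .red) (t.layout s) := by
  refine fails_call fun i => blocked_inPlace ?_
  rintro ⟨f, hf, hv, he⟩
  simp only [List.forall_mem_cons] at he
  obtain ⟨⟨w, -, hs, ht, hw⟩, ⟨w', hm', hs', -, hw'⟩, -⟩ := he
  obtain ⟨-, h⟩ := hv 0
  replace h : (t.layout s).node (f 0) = root (num i) := h
  replace hs : w.src = f 0 := hs
  rw [← hs] at h
  cases w <;> simp [Tapes.layout, lab, col] at hw
  · replace ht : NodeName.block t.active = f 1 := ht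
    replace hs' : w'.src = f 1 := hs'
    rw [← ht] at hs'
    cases w' <;> simp [EdgeName.src, Tapes.layout, lab, col] at hs' hw' hm'
    exact hl (hs' ▸ hm')
  -- The other edges with this label start at block nodes, none of which is an unmarked root.
  · exact hn _ _ h

-- The red root in CACHE

theorem exec_cacheInit (hc : t.center = root (num q)) (hr : t.red = none) :
    Exec (CacheInit M) (t.layout s) ({t with red := some t.last}.layout s) := by
  refine exec_call (q, t.cache t.last)
    (leads_redirect ![.center, .cache t.last] [.cacheLast]
    ?_ ?_ ?_ ?_ ?_ ?_
    rfl rfl (fun x _ h => ?_) (fun x _ h => ?_))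
  · simp
  · simp
  · simp [Fin.forall_fin_succ, Tapes.layout, hc, hr]
  · simp [Fin.forall_fin_succ, Tapes.layout, hc]
  · simp [Tapes.layout, EdgeName.src, hc, hr]
  · simp [Tapes.layout, EdgeName.src, hc]
  · cases x <;> first | rfl | simp_all [Tapes.layout]
  · cases x <;> exact ⟨rfl, rfl⟩

theorem leads_digit {r : ℕ} {x y : Fin 3} (hr : t.red = some r) (hl : r ≤ t.last)
    (hx : t.cache r = x) :
    (digit x y).Leads (t.layout s) ({t with cache := Function.update t.cache r y}.layout s) := by
  refine leads_redirect ![.cache r] [] ?_ ?_ ?_ ?_ ?_ ?_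
    rfl rfl (fun x _ h => ?_) (fun x _ h => ?_)
  · simp
  · simp
  · simp [Tapes.layout, hr, hl, hx]
  · simp [Tapes.layout, hr]
  · simp
  · simp
  · cases x with
    | cache i =>
      have hi : i ≠ r := by
        rintro rfl
        exact h 0 rfl
      simp [Tapes.layout, hi]
    | _ => rfl
  · cases x <;> exact ⟨rfl, rfl⟩

theorem exec_underflow {r : ℕ} (hr : t.red = some r) (hl : r ≤ t.last) (hx : t.cache r = 0) :
    Exec underflow (t.layout s) ({t with cache := Function.update t.cache r 2}.layout s) :=
  exec_call () (leads_digit hr hl hx)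

theorem exec_overflow {r : ℕ} (hr : t.red = some r) (hl : r ≤ t.last) (hx : t.cache r = 2) :
    Exec overflow (t.layout s) ({t with cache := Function.update t.cache r 0}.layout s) :=
  exec_call () (leads_digit hr hl hx)

theorem exec_dec {r : ℕ} (hr : t.red = some r) (hl : r ≤ t.last) (hx : t.cache r ≠ 0) :
    Exec Dec (t.layout s)
      ({t with cache := Function.update t.cache r (t.cache r - 1)}.layout s) := by
  obtain h | h : t.cache r = 1 ∨ t.cache r = 2 := by
    revert hx; generalize t.cache r = x; revert x; decide
  · rw [h]; exact exec_call 0 (leads_digit hr hl h)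
  · rw [h]; exact exec_call 1 (leads_digit hr hl h)

theorem exec_inc {r : ℕ} (hr : t.red = some r) (hl : r ≤ t.last) (hx : t.cache r ≠ 2) :
    Exec Inc (t.layout s)
      ({t with cache := Function.update t.cache r (t.cache r + 1)}.layout s) := by
  obtain h | h : t.cache r = 0 ∨ t.cache r = 1 := by
    revert hx; generalize t.cache r = x; revert x; decide
  · rw [h]; exact exec_call 0 (leads_digit hr hl h)
  · rw [h]; exact exec_call 1 (leads_digit hr hl h)

theorem exec_unfinished {r : ℕ} (hr : t.red = some r) (hl : r ≤ t.last) :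
    Exec Unfinished (t.layout s) (t.layout s) := by
  have := leads_digit (s := s) (y := t.cache r) hr hl rfl
  rw [Function.update_eq_self] at this
  exact exec_call (t.cache r) this

/-- A red root is a CACHE node. -/
theorem red_root_eq {a : Atom} (hc : t.center = root (num q)) (hs : ∀ i a, s.node i ≠ mroot .red a)
    {v : NodeName} (hv : (t.layout s).node v = mroot .red a) :
    ∃ r, v = .cache r ∧ t.red = some r ∧ sym (t.cache r) = a := by
  cases v with
  | block i => exact absurd hv (hs _ _)
  | cache i =>
    simp only [Tapes.layout] at hv
    split_ifs at hv with h
    · simp only [mroot, Node.mk.injEq, Label.mk.injEq] at hv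
      exact ⟨i, rfl, h, hv.1.1⟩
    · simp [mroot, plain, lab] at hv
  | _ => simp [Tapes.layout, hc, root, mroot, plain, lab] at hv

/-- Any red root is the marked CACHE node. A rule that asks for one is thus blocked both when there
is none and when its digit is a different one. -/
theorem blocked_of_red {m : ℕ} {l r : Fin (m + 1) → Node}
    {el er : List (Fin (m + 1) × Fin (m + 1) × Label)} (hc : t.center = root (num q))
    (hs : ∀ i a, s.node i ≠ mroot .red a) {a : Atom} (hl : l 0 = mroot .red a)
    (h : ∀ i, t.red = some i → sym (t.cache i) ≠ a) :
    (inPlace l r el er).Blocked (t.layout s) := by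
  refine blocked_inPlace ?_
  rintro ⟨f, -, hn, -⟩
  obtain ⟨i, -, hr, hx⟩ := red_root_eq hc hs ((hn 0).2.trans hl)
  exact h i hr hx

theorem fails_dec {r : ℕ} (hc : t.center = root (num q)) (hs : ∀ i a, s.node i ≠ mroot .red a)
    (hr : t.red = some r) (hx : t.cache r = 0) : Fails Dec (t.layout s) := by
  refine fails_call fun i => ?_
  fin_cases i
  all_goals
    refine blocked_of_red hc hs rfl fun i hi => ?_
    obtain rfl : r = i := by simpa [hr] using hi
    simp [hx, sym]

theorem fails_inc {r : ℕ} (hc : t.center = root (num q)) (hs : ∀ i a, s.node i ≠ mroot .red a)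
    (hr : t.red = some r) (hx : t.cache r = 2) : Fails Inc (t.layout s) := by
  refine fails_call fun i => ?_
  fin_cases i
  all_goals
    refine blocked_of_red hc hs rfl fun i hi => ?_
    obtain rfl : r = i := by simpa [hr] using hi
    simp [hx, sym]

theorem fails_finish (hc : t.center = root (num q)) (hs : ∀ i a, s.node i ≠ mroot .red a)
    (hr : t.red = none) : Fails Finish (t.layout s) :=
  fails_call fun _ => blocked_of_red hc hs rfl fun i hi => by simp [hr] at hi

theorem fails_unfinished (hc : t.center = root (num q)) (hs : ∀ i a, s.node i ≠ mroot .red a)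
    (hr : t.red = none) : Fails Unfinished (t.layout s) :=
  fails_call fun _ => blocked_of_red hc hs rfl fun i hi => by simp [hr] at hi

theorem exec_finish {r : ℕ} (hr : t.red = some r) (hl : r ≤ t.last) :
    Exec Finish (t.layout s) ({t with red := none}.layout s) := by
  refine exec_call (t.cache r) (leads_redirect ![.cache r] [] ?_ ?_ ?_ ?_ ?_ ?_
    rfl rfl (fun x _ h => ?_) (fun x _ h => ?_))
  · simp
  · simp
  · simp [Tapes.layout, hr, hl]
  · simp [Tapes.layout]
  · simp [Tapes.layout, EdgeName.src, hr]
  · simp [Tapes.layout, EdgeName.src]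
  · cases x with
    | cache i =>
      have hi : r ≠ i := by simpa using h
      simp [Tapes.layout, hr, hi]
    | _ => rfl
  · cases x <;> exact ⟨rfl, rfl⟩

theorem exec_redMove_blue {r : ℕ} (hr : t.red = some (r + 1)) (hl : r + 1 ≤ t.last) :
    Exec (redMove .blue) (t.layout s) ({t with red := some r}.layout s) := by
  refine exec_call (t.cache (r + 1), t.cache r)
    (leads_redirect ![.cache (r + 1), .cache r] [.cacheLeft r]
    ?_ ?_ ?_ ?_ ?_ ?_
    rfl rfl (fun x _ h => ?_) (fun x _ h => ?_))
  · simp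
  · simp
  · simp [Fin.forall_fin_succ, Tapes.layout, hr]; omega
  · simp [Fin.forall_fin_succ, Tapes.layout]
  · simp [Tapes.layout, EdgeName.src, hr]; omega
  · simp [Tapes.layout, EdgeName.src]
  · cases x with
    | cache i =>
      have hi : r + 1 ≠ i ∧ r ≠ i := by simpa [Fin.forall_fin_succ] using h
      simp [Tapes.layout, hr, hi]
    | _ => rfl
  · cases x <;> exact ⟨rfl, rfl⟩

theorem exec_redMove_red {r : ℕ} (hr : t.red = some r) (hl : r + 1 ≤ t.last) :
    Exec (redMove .red) (t.layout s) ({t with red := some (r + 1)}.layout s) := by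
  refine exec_call (t.cache r, t.cache (r + 1))
    (leads_redirect ![.cache r, .cache (r + 1)] [.cacheRight r]
    ?_ ?_ ?_ ?_ ?_ ?_
    rfl rfl (fun x _ h => ?_) (fun x _ h => ?_))
  · simp
  · simp
  · simp [Fin.forall_fin_succ, Tapes.layout, hr]; omega
  · simp [Fin.forall_fin_succ, Tapes.layout]
  · simp [Tapes.layout, EdgeName.src, hr]; omega
  · simp [Tapes.layout, EdgeName.src]
  · cases x with
    | cache i =>
      have hi : r ≠ i ∧ r + 1 ≠ i := by simpa [Fin.forall_fin_succ] using h
      simp [Tapes.layout, hr, hi]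
    | _ => rfl
  · cases x <;> exact ⟨rfl, rfl⟩

theorem fails_redMove_blue (hc : t.center = root (num q)) (hs : ∀ i a, s.node i ≠ mroot .red a)
    (hr : t.red = some 0) : Fails (redMove .blue) (t.layout s) := by
  refine fails_call fun i => blocked_inPlace ?_
  rintro ⟨f, hf, hn, he⟩
  obtain ⟨w, hm, hw, -, hw'⟩ := he _ (List.mem_cons_self ..)
  obtain ⟨r, hv, hr', hx⟩ := red_root_eq hc hs (hn 0).2
  obtain rfl : 0 = r := by simpa [hr] using hr'
  replace hw : w.src = f 0 := hw
  rw [hv] at hw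
  cases w <;> simp [EdgeName.src, Tapes.layout, lab, col] at hw hw'

theorem fails_redMove_red (hc : t.center = root (num q)) (hs : ∀ i a, s.node i ≠ mroot .red a)
    (hr : t.red = some t.last) : Fails (redMove .red) (t.layout s) := by
  refine fails_call fun i => blocked_inPlace ?_
  rintro ⟨f, hf, hn, he⟩
  obtain ⟨w, hm, hw, -, hw'⟩ := he _ (List.mem_cons_self ..)
  obtain ⟨r, hv, hr', hx⟩ := red_root_eq hc hs (hn 0).2
  obtain rfl : t.last = r := by simpa [hr] using hr'
  replace hw : w.src = f 0 := hw
  rw [hv] at hw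
  cases w <;> simp [EdgeName.src, Tapes.layout, lab, col] at hw hw' hm
  omega

end

-- The blue root in BLOCKSET, and the transition rules

section

open Sim

variable {M : OffLineTM} {t : Tapes} {s : Blocks} {q : M.Q} {b : ℕ} {ct : ℕ → ℕ}

theorem exec_encodeInit (hc : t.center = root (num q)) (hb : 0 < b) :
    Exec (EncodeInit M) (t.layout (.list b ct none)) (t.layout (.list b ct (some 0))) := by
  refine exec_call q (leads_redirect ![.center, .block 0] [.blockFirst] ?_ ?_ ?_ ?_ ?_ ?_
    rfl rfl (fun x _ h => ?_) (fun x _ h => ?_))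
  · simp
  · simp
  · simp [Fin.forall_fin_succ, Tapes.layout, Blocks.list, hc, hb]
  · simp [Fin.forall_fin_succ, Tapes.layout, Blocks.list, hc]
  · simp [Tapes.layout, Blocks.list, EdgeName.src, hc]
  · simp [Tapes.layout, Blocks.list, EdgeName.src, hc]
  · cases x with
    | block i =>
      have hi : 0 ≠ i := by simpa [Fin.forall_fin_succ] using h
      simp [Tapes.layout, Blocks.list, hi]
    | _ => rfl
  · cases x <;> exact ⟨rfl, rfl⟩

theorem exec_decodeInit (hc : t.center = root (num q)) (ha : t.active < b)
    (hct : ct t.active < b) :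
    Exec (DecodeInit M) (t.layout (.list b ct none))
      (t.layout (.list b ct (some (ct t.active)))) := by
  by_cases h0 : ct t.active = t.active
  · refine exec_call (q, true) (leads_redirect
      ![.center, .block t.active] [.blockActive, .content t.active] ?_ ?_ ?_ ?_ ?_ ?_
      rfl rfl (fun x _ h => ?_) (fun x _ h => ?_))
    · simp
    · simp
    · simp [Fin.forall_fin_succ, Tapes.layout, Blocks.list, hc, ha]
    · simp [Fin.forall_fin_succ, Tapes.layout, Blocks.list, hc, h0]
    · simp [Tapes.layout, Blocks.list, EdgeName.src, ha, h0]
    · simp [Tapes.layout, Blocks.list, EdgeName.src, h0]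
    · cases x with
      | block i =>
        have hi : t.active ≠ i := by
          rintro rfl
          exact h 1 rfl
        simp [Tapes.layout, Blocks.list, hi, h0]
      | _ => rfl
    · cases x <;> exact ⟨rfl, rfl⟩
  · refine exec_call (q, false) (leads_redirect
      ![.center, .block t.active, .block (ct t.active)] [.blockActive, .content t.active]
      ?_ ?_ ?_ ?_ ?_ ?_ rfl rfl (fun x _ h => ?_) (fun x _ h => ?_))
    · simp [Ne.symm h0]
    · simp
    · simp [Fin.forall_fin_succ, Tapes.layout, Blocks.list, hc, ha, hct]
    · simp [Fin.forall_fin_succ, Tapes.layout, Blocks.list, hc, h0]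
    · simp [Tapes.layout, Blocks.list, EdgeName.src, ha]
    · simp [Tapes.layout, Blocks.list, EdgeName.src]
    · cases x with
      | block i =>
        have hi : ct t.active ≠ i := by
          rintro rfl
          exact h 2 rfl
        simp [Tapes.layout, Blocks.list, hi]
      | _ => rfl
    · cases x <;> exact ⟨rfl, rfl⟩

theorem exec_blueMove_red {i : ℕ} (hb : i + 1 < b) :
    Exec (blueMove .red) (t.layout (.list b ct (some i)))
      (t.layout (.list b ct (some (i + 1)))) := by
  refine exec_call () (leads_redirect ![.block i, .block (i + 1)] [.blockRight i] ?_ ?_ ?_ ?_ ?_ ?_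
    rfl rfl (fun x _ h => ?_) (fun x _ h => ?_))
  · simp
  · simp
  · simp [Fin.forall_fin_succ, Tapes.layout, Blocks.list, hb]; omega
  · simp [Fin.forall_fin_succ, Tapes.layout, Blocks.list]
  · simp [Tapes.layout, Blocks.list, EdgeName.src, hb]
  · simp [Tapes.layout, Blocks.list, EdgeName.src]
  · cases x with
    | block j =>
      have hi : i ≠ j ∧ i + 1 ≠ j := by simpa [Fin.forall_fin_succ] using h
      simp [Tapes.layout, Blocks.list, hi]
    | _ => rfl
  · cases x <;> exact ⟨rfl, rfl⟩

theorem exec_blueMove_blue {i : ℕ} (hb : i + 1 < b) :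
    Exec (blueMove .blue) (t.layout (.list b ct (some (i + 1))))
      (t.layout (.list b ct (some i))) := by
  refine exec_call () (leads_redirect ![.block (i + 1), .block i] [.blockLeft i] ?_ ?_ ?_ ?_ ?_ ?_
    rfl rfl (fun x _ h => ?_) (fun x _ h => ?_))
  · simp
  · simp
  · simp [Fin.forall_fin_succ, Tapes.layout, Blocks.list, hb]; omega
  · simp [Fin.forall_fin_succ, Tapes.layout, Blocks.list]
  · simp [Tapes.layout, Blocks.list, EdgeName.src, hb]
  · simp [Tapes.layout, Blocks.list, EdgeName.src]
  · cases x with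
    | block j =>
      have hi : i + 1 ≠ j ∧ i ≠ j := by simpa [Fin.forall_fin_succ] using h
      simp [Tapes.layout, Blocks.list, hi]
    | _ => rfl
  · cases x <;> exact ⟨rfl, rfl⟩

/-- The blue root is block node 0, whereas the blue links of BLOCKSET leave nodes with positive
index. This is how decoding notices that it is finished. -/
theorem fails_blueMove_blue (hc : t.center = root (num q)) :
    Fails (blueMove .blue) (t.layout (.list b ct (some 0))) := by
  refine fails_call fun _ => blocked_inPlace ?_
  rintro ⟨f, hf, hn, he⟩
  obtain ⟨w, -, hw, -, hw'⟩ := he _ (List.mem_cons_self ..)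
  have h := (hn 0).2
  replace hw : w.src = f 0 := hw
  rw [← hw] at h
  cases w with
  | blockLeft i => simp [Tapes.layout, Blocks.list, EdgeName.src, mroot, plain, lab] at h
  | cacheLeft i =>
    simp only [Tapes.layout, EdgeName.src] at h
    split_ifs at h <;> simp [mroot, plain, lab] at h
  | inputLeft i => simp [Tapes.layout, EdgeName.src, mroot, plain, lab] at h
  | blockFirst => simp [Tapes.layout, EdgeName.src, mroot, hc, root, lab] at h
  | _ => simp [Tapes.layout, lab, col, num] at hw'

theorem exec_update {i : ℕ} (hc : t.center = root (num q)) (ha : t.active < b) (hi : i < b)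
    (hct : ct t.active < b) :
    Exec (Update M) (t.layout (.list b ct (some i)))
      (t.layout (.list b (Function.update ct t.active i) none)) := by
  -- The five rules touch the same two edges and have the same frame. They differ only in which
  -- nodes coincide, which an injective match cannot leave open; the cases below go through these
  -- coincidences.
  have key (k : Fin 5) {m : ℕ} (l r : Fin m → Node) (f : Fin m → NodeName)
      (el er : List (Fin m × Fin m × Label)) (hk : updateRule q k = inPlace l r el er)
      (inj : (List.ofFn f).Nodup)
      (hl : ∀ j, (t.layout (.list b ct (some i))).nodes (f j) ∧
        (t.layout (.list b ct (some i))).node (f j) = l j)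
      (hr : ∀ j, (t.layout (.list b (Function.update ct t.active i) none)).node (f j) = r j)
      (he : List.Forall₂ (fun w e => (t.layout (.list b ct (some i))).edges w ∧ w.src = f e.1 ∧
        (t.layout (.list b ct (some i))).tgt w = f e.2.1 ∧
        (t.layout (.list b ct (some i))).label w = e.2.2) [.blockActive, .content t.active] el)
      (he' : List.Forall₂ (fun w e => w.src = f e.1 ∧
        (t.layout (.list b (Function.update ct t.active i) none)).tgt w = f e.2.1 ∧
        (t.layout (.list b (Function.update ct t.active i) none)).label w = e.2.2)
        [.blockActive, .content t.active] er)
      (hf : ∃ j, f j = .block i) :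
      Exec (Update M) (t.layout (.list b ct (some i)))
        (t.layout (.list b (Function.update ct t.active i) none)) := by
    refine exec_call (q, k) ?_
    change (updateRule q k).Leads _ _
    rw [hk]
    refine leads_redirect f [.blockActive, .content t.active] inj (by simp) hl hr he he' rfl rfl
      (fun x _ h => ?_) (fun x _ h => ?_)
    · cases x with
      | block j =>
        have hj : i ≠ j := by
          rintro rfl
          obtain ⟨k, hk⟩ := hf
          exact h k hk
        simp [Tapes.layout, Blocks.list, hj]
      | _ => rfl
    · cases x with
      | content j =>
        have hj : j ≠ t.active := by simpa using h
        simp [Tapes.layout, Blocks.list, hj]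
      | _ => exact ⟨rfl, rfl⟩
  by_cases h1 : i = t.active
  · by_cases h2 : ct t.active = t.active
    · refine key 4 _ _ ![.center, .block t.active] _ _ rfl ?_ ?_ ?_ ?_ ?_ ⟨1, by rw [h1]; rfl⟩
      · simp
      · simp [Fin.forall_fin_succ, Tapes.layout, Blocks.list, hc, ha, h1]
      · simp [Fin.forall_fin_succ, Tapes.layout, Blocks.list, hc]
      · simp [Tapes.layout, Blocks.list, EdgeName.src, ha, h2]
      · simp [Tapes.layout, Blocks.list, EdgeName.src, h1]
    · refine key 2 _ _ ![.center, .block t.active, .block (ct t.active)] _ _ rfl ?_ ?_ ?_ ?_ ?_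
        ⟨1, by rw [h1]; rfl⟩
      · simp [Ne.symm h2]
      · simp [Fin.forall_fin_succ, Tapes.layout, Blocks.list, hc, ha, h1, hct, Ne.symm h2]
      · simp [Fin.forall_fin_succ, Tapes.layout, Blocks.list, hc]
      · simp [Tapes.layout, Blocks.list, EdgeName.src, ha]
      · simp [Tapes.layout, Blocks.list, EdgeName.src, h1]
  · by_cases h2 : ct t.active = t.active
    · refine key 1 _ _ ![.center, .block t.active, .block i] _ _ rfl ?_ ?_ ?_ ?_ ?_ ⟨2, rfl⟩
      · simp [Ne.symm h1]
      · simp [Fin.forall_fin_succ, Tapes.layout, Blocks.list, hc, ha, h1, hi]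
      · simp [Fin.forall_fin_succ, Tapes.layout, Blocks.list, hc]
      · simp [Tapes.layout, Blocks.list, EdgeName.src, ha, h2]
      · simp [Tapes.layout, Blocks.list, EdgeName.src]
    · by_cases h3 : ct t.active = i
      · refine key 3 _ _ ![.center, .block t.active, .block i] _ _ rfl ?_ ?_ ?_ ?_ ?_ ⟨2, rfl⟩
        · simp [Ne.symm h1]
        · simp [Fin.forall_fin_succ, Tapes.layout, Blocks.list, hc, ha, h1, hi]
        · simp [Fin.forall_fin_succ, Tapes.layout, Blocks.list, hc]
        · simp [Tapes.layout, Blocks.list, EdgeName.src, ha, h3]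
        · simp [Tapes.layout, Blocks.list, EdgeName.src]
      · refine key 0 _ _ ![.center, .block t.active, .block (ct t.active), .block i] _ _ rfl
          ?_ ?_ ?_ ?_ ?_ ⟨3, rfl⟩
        · simp [Ne.symm h1, Ne.symm h2, h3]
        · simp [Fin.forall_fin_succ, Tapes.layout, Blocks.list, hc, ha, h1, hi, hct, Ne.symm h3]
        · simp [Fin.forall_fin_succ, Tapes.layout, Blocks.list, hc]
        · simp [Tapes.layout, Blocks.list, EdgeName.src, ha]
        · simp [Tapes.layout, Blocks.list, EdgeName.src]

theorem exec_transitions {i : ℕ} {p : M.Q} {y : Fin 3} {X Y : Dir} (hc : t.center = root (num q))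
    (hr : t.red = none) (hm : t.move = .empty) (hi : t.inHead < t.len) (hi' : i < t.len)
    (hh : t.head ≤ t.last)
    (hδ : M.δ q (t.input t.inHead) (t.cache t.head) = some (p, y, X, Y))
    (hX : X.Moves t.inHead i) :
    Exec (Transitions M) (t.layout s)
      ({t with
        center := root (num p)
        cache := Function.update t.cache t.head y
        inHead := i
        move := pending Y}.layout s) := by
  have fn (x : NodeName) (h : x ≠ .center) (h' : x ≠ .cache t.head) :
      (({t with
        center := root (num p)
        cache := Function.update t.cache t.head y
        inHead := i
        move := pending Y} : Tapes).layout s).node x = (t.layout s).node x := by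
    cases x with
    | center => exact absurd rfl h
    | cache j =>
      have hj : j ≠ t.head := by
        rintro rfl
        exact h' rfl
      simp [Tapes.layout, hj]
    | _ => rfl
  -- The last component of the index is the symbol on the square that the input head moves to; it
  -- plays no role in the rule for `.S`.
  refine exec_call
    ⟨((q, t.input t.inHead, t.cache t.head), (p, y, X, Y), t.input i), hδ⟩ ?_
  change (transitionRule q (t.input t.inHead) (t.cache t.head) p y X Y (t.input i)).Leads _ _
  cases X with
  | L =>
    replace hX : t.inHead = i + 1 := hX
    refine leads_redirect ![.center, .input (i + 1), .cache t.head, .input i]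
      [.inputHead, .cacheHead, .inputLeft i] ?_ ?_ ?_ ?_ ?_ ?_ rfl rfl
      (fun x _ h => fn x (h 0).symm (h 2).symm)
      (fun x _ h => ?_)
    · simp
    · simp
    · simp [Fin.forall_fin_succ, Tapes.layout, hX, hc, hr, hh, hi']; omega
    · simp [Fin.forall_fin_succ, Tapes.layout, hX, hr]
    · simp [Tapes.layout, EdgeName.src, hX, hm]; omega
    · simp [Tapes.layout, EdgeName.src]
    · cases x <;> first | exact ⟨rfl, rfl⟩ | simp at h
  | R =>
    replace hX : i = t.inHead + 1 := hX
    subst hX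
    refine leads_redirect ![.center, .input t.inHead, .cache t.head, .input (t.inHead + 1)]
      [.inputHead, .cacheHead, .inputRight t.inHead] ?_ ?_ ?_ ?_ ?_ ?_ rfl rfl
      (fun x _ h => fn x (h 0).symm (h 2).symm)
      (fun x _ h => ?_)
    · simp
    · simp
    · simp [Fin.forall_fin_succ, Tapes.layout, hc, hr, hh, hi, hi']
    · simp [Fin.forall_fin_succ, Tapes.layout, hr]
    · simp [Tapes.layout, EdgeName.src, hm, hi']
    · simp [Tapes.layout, EdgeName.src]
    · cases x <;> first | exact ⟨rfl, rfl⟩ | simp at h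
  | S =>
    replace hX : i = t.inHead := hX
    subst hX
    refine leads_redirect ![.center, .input t.inHead, .cache t.head]
      [.inputHead, .cacheHead] ?_ ?_ ?_ ?_ ?_ ?_ rfl rfl (fun x _ h => fn x (h 0).symm (h 2).symm)
      (fun x _ h => ?_)
    · simp
    · simp
    · simp [Fin.forall_fin_succ, Tapes.layout, hc, hr, hh, hi]
    · simp [Fin.forall_fin_succ, Tapes.layout, hr]
    · simp [Tapes.layout, EdgeName.src, hm]
    · simp [Tapes.layout, EdgeName.src]
    · cases x <;> first | exact ⟨rfl, rfl⟩ | simp at h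

end

section

open Sim

/-! ## CACHE as a counter -/

/-- The number whose ternary digits are `d 0, …, d (m - 1)`, the most significant one first. -/
def value (d : ℕ → Fin 3) : ℕ → ℕ
  | 0 => 0
  | m + 1 => 3 * value d m + d m

theorem value_succ (d : ℕ → Fin 3) (m : ℕ) : value d (m + 1) = 3 * value d m + d m := rfl

theorem value_lt (d : ℕ → Fin 3) (m : ℕ) : value d m < 3 ^ m := by
  induction m with
  | zero => simp [value]
  | succ m ih => have := (d m).isLt; rw [value, pow_succ]; omega

theorem value_congr {d e : ℕ → Fin 3} {m : ℕ} (h : ∀ i < m, d i = e i) : value d m = value e m := by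
  induction m with
  | zero => rfl
  | succ m ih => rw [value, value, ih fun i hi => h i (by omega), h m (by omega)]

/-- Uniqueness of ternary digits. It recovers the symbols in CACHE from the number that decoding has
counted up to. -/
theorem eq_of_value_eq {d e : ℕ → Fin 3} {m : ℕ} (h : value d m = value e m) :
    ∀ i < m, d i = e i := by
  induction m with
  | zero => intro i hi; omega
  | succ m ih =>
    rw [value, value] at h
    have h1 := (d m).isLt
    have h2 := (e m).isLt
    intro i hi
    obtain hi | rfl : i < m ∨ i = m := by omega
    · exact ih (by omega) i hi
    · exact Fin.ext (by omega)

theorem value_const_zero {d : ℕ → Fin 3} {m : ℕ} (h : ∀ i < m, d i = 0) : value d m = 0 := by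
  induction m with
  | zero => rfl
  | succ m ih => rw [value, ih fun i hi => h i (by omega), h m (by omega)]; rfl

/-- As the blank is the digit 2, a blank block has the largest possible number, that of the last
block node. -/
theorem value_const_two {d : ℕ → Fin 3} {m : ℕ} (h : ∀ i < m, d i = 2) :
    value d m + 1 = 3 ^ m := by
  induction m with
  | zero => rfl
  | succ m ih =>
    have := ih fun i hi => h i (by omega)
    rw [value, h m (by omega), pow_succ]
    change 3 * value d m + 2 + 1 = _
    omega

theorem value_update_succ (d : ℕ → Fin 3) (m : ℕ) (x : Fin 3) :
    value (Function.update d m x) (m + 1) = 3 * value d m + x := by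
  rw [value, Function.update_self,
    value_congr fun i hi => by rw [Function.update_of_ne (Nat.ne_of_lt hi)]]

theorem value_update_self (d : ℕ → Fin 3) (m : ℕ) (x : Fin 3) :
    value (Function.update d m x) m = value d m :=
  value_congr fun i hi => by rw [Function.update_of_ne (Nat.ne_of_lt hi)]

theorem val_sub_one {x : Fin 3} (hx : x ≠ 0) : ((x - 1 : Fin 3) : ℕ) + 1 = x := by
  revert x; decide

theorem val_add_one {x : Fin 3} (hx : x ≠ 2) : ((x + 1 : Fin 3) : ℕ) = x + 1 := by
  revert x; decide

variable {M : OffLineTM} {s : Blocks} {q : M.Q}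

/-- A nonzero digit absorbs the decrement. The loop is then left without a red root, which marks
success. -/
theorem breaks_decrement {t : Tapes} {r : ℕ} (hr : t.red = some r) (hl : r ≤ t.last)
    (hx : t.cache r ≠ 0) :
    Breaks Decrement (t.layout s)
      ({t with cache := Function.update t.cache r (t.cache r - 1), red := none}.layout s) :=
  (exec_dec hr hl hx).tryte_breaks ((exec_finish
    (t := {t with cache := Function.update t.cache r (t.cache r - 1)}) hr hl).seq_breaks breaks_brk)

/-- Subtraction with borrow from the least significant digit: a zero becomes 2 and the red root goes
on to the left. Positivity guarantees that a nonzero digit is met. That digits to the right of the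
start stay unchanged is needed in the induction, where the 2 just written must survive. -/
theorem exec_alap_decrement_of_pos (hs : ∀ i a, s.node i ≠ mroot .red a) (r : ℕ) (t : Tapes)
    (hc : t.center = root (num q)) (hr : t.red = some r) (hl : r ≤ t.last)
    (hv : 0 < value t.cache (r + 1)) :
    ∃ d, value d (r + 1) + 1 = value t.cache (r + 1) ∧ (∀ i, r < i → d i = t.cache i) ∧
      Exec (.alap Decrement) (t.layout s) ({t with cache := d, red := none}.layout s) := by
  induction r generalizing t with
  | zero =>
    have hx : t.cache 0 ≠ 0 := by
      intro h
      simp [value, h] at hv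
    refine ⟨_, ?_, fun i hi => Function.update_of_ne (by omega) _ _,
      (breaks_decrement hr hl hx).alap⟩
    rw [value_update_succ, value_succ, add_assoc, val_sub_one hx]
  | succ r ih =>
    by_cases hx : t.cache (r + 1) = 0
    · have hv' : 0 < value t.cache (r + 1) := by
        rw [value, hx] at hv
        simpa using hv
      obtain ⟨d, hd, hd', he⟩ := ih
        {t with cache := Function.update t.cache (r + 1) 2, red := some r} hc rfl
        (by simp only; omega) (by simp only [value_update_self]; exact hv')
      simp only [value_update_self] at hd
      refine ⟨d, ?_, fun i hi => ?_, Exec.alap ((fails_dec hc hs hr hx).tryte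
        ((exec_underflow hr hl hx).seq ?_)) he⟩
      · rw [value_succ d (r + 1), value_succ t.cache (r + 1), hd' _ (by omega), hx]
        simp only [Function.update_self]
        -- The borrow: the remaining digits lose 1, and `3 * (u - 1) + 2 + 1 = 3 * u`.
        change 3 * value d (r + 1) + 2 + 1 = 3 * value t.cache (r + 1) + 0
        omega
      · rw [hd' i (by omega)]
        exact Function.update_of_ne (by omega) _ _
      · exact Exec.tryElse (exec_redMove_blue
          (t := {t with cache := Function.update t.cache (r + 1) 2}) hr hl)
    · refine ⟨_, ?_, fun i hi => Function.update_of_ne (by omega) _ _,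
        (breaks_decrement hr hl hx).alap⟩
      rw [value_update_succ, value_succ t.cache (r + 1), add_assoc, val_sub_one hx]

/-- The borrow runs through all digits. At node 0 there is no blue edge to follow, and the loop
breaks without `Finish`, so that the red root remains as a sign of underflow. -/
theorem exec_alap_decrement_of_zero (hs : ∀ i a, s.node i ≠ mroot .red a) (r : ℕ) (t : Tapes)
    (hc : t.center = root (num q)) (hr : t.red = some r) (hl : r ≤ t.last)
    (hv : ∀ i ≤ r, t.cache i = 0) :
    ∃ d, (∀ i ≤ r, d i = 2) ∧ (∀ i, r < i → d i = t.cache i) ∧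
      Exec (.alap Decrement) (t.layout s) ({t with cache := d, red := some 0}.layout s) := by
  induction r generalizing t with
  | zero =>
    have hx := hv 0 le_rfl
    refine ⟨Function.update t.cache 0 2, fun i hi => ?_,
      fun i hi => Function.update_of_ne (by omega) _ _, Breaks.alap ?_⟩
    · obtain rfl : i = 0 := by omega
      simp
    -- The red root has not moved: `some 0` is still the original value.
    · rw [← hr]
      exact (fails_dec hc hs hr hx).tryte_breaks ((exec_underflow hr hl hx).seq_breaks
        ((fails_redMove_blue
          (t := {t with cache := Function.update t.cache 0 2}) hc hs hr).tryte_breaks breaks_brk))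
  | succ r ih =>
    have hx := hv _ le_rfl
    obtain ⟨d, hd, hd', he⟩ := ih
      {t with cache := Function.update t.cache (r + 1) 2, red := some r} hc rfl
      (by simp only; omega) (fun i hi => by
        simp only
        rw [Function.update_of_ne (by omega), hv i (by omega)])
    refine ⟨d, fun i hi => ?_, fun i hi => ?_, Exec.alap ((fails_dec hc hs hr hx).tryte
      ((exec_underflow hr hl hx).seq ?_)) he⟩
    · obtain hi | rfl : i ≤ r ∨ i = r + 1 := by omega
      · exact hd i hi
      · rw [hd' _ (by omega)]
        exact Function.update_self ..
    · rw [hd' i (by omega)]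
      exact Function.update_of_ne (by omega) _ _
    · exact Exec.tryElse (exec_redMove_blue
        (t := {t with cache := Function.update t.cache (r + 1) 2}) hr hl)

/-- The sweep back to the right turns the wrapped digits 2 into 0, so that an underflow leaves the
counter at zero. The induction is on the distance `k` of the red root from the last node. -/
theorem exec_alap_reset (hs : ∀ i a, s.node i ≠ mroot .red a) (k r : ℕ) (t : Tapes)
    (hc : t.center = root (num q)) (hr : t.red = some r) (hl : r + k = t.last)
    (hv : ∀ i, r ≤ i → i ≤ t.last → t.cache i = 2) :
    ∃ d, (∀ i, r ≤ i → i ≤ t.last → d i = 0) ∧ (∀ i < r, d i = t.cache i) ∧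
      Exec (.alap Reset) (t.layout s) ({t with cache := d, red := some t.last}.layout s) := by
  induction k generalizing r t with
  | zero =>
    have hx := hv r le_rfl (by omega)
    refine ⟨Function.update t.cache r 0, fun i hi hi' => ?_,
      fun i hi => Function.update_of_ne (by omega) _ _, Breaks.alap ?_⟩
    · obtain rfl : i = r := by omega
      simp
    · obtain rfl : r = t.last := hl
      rw [← hr]
      exact (exec_overflow hr le_rfl hx).seq_breaks
        ((fails_redMove_red
          (t := {t with cache := Function.update t.cache t.last 0}) hc hs hr).tryte_breaks
            breaks_brk)
  | succ k ih =>
    have hx := hv r le_rfl (by omega)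
    obtain ⟨d, hd, hd', he⟩ := ih (r + 1)
      {t with cache := Function.update t.cache r 0, red := some (r + 1)} hc rfl
      (by simp only; omega) (fun i hi hi' => by
        simp only at hi' ⊢
        rw [Function.update_of_ne (by omega), hv i (by omega) hi'])
    refine ⟨d, fun i hi hi' => ?_, fun i hi => ?_,
      Exec.alap ((exec_overflow hr (by omega) hx).seq ?_) he⟩
    · obtain hi | rfl : r + 1 ≤ i ∨ i = r := by omega
      · exact hd i hi hi'
      · rw [hd' _ (by omega)]
        exact Function.update_self ..
    · rw [hd' i (by omega)]
      exact Function.update_of_ne (by omega) _ _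
    · exact Exec.tryElse (exec_redMove_red
        (t := {t with cache := Function.update t.cache r 0}) hr (by simp only; omega))

variable {t : Tapes}

theorem exec_cacheDec_of_pos (hs : ∀ i a, s.node i ≠ mroot .red a) (hc : t.center = root (num q))
    (hr : t.red = none) (hv : 0 < value t.cache (t.last + 1)) :
    ∃ d, value d (t.last + 1) + 1 = value t.cache (t.last + 1) ∧
      Exec (CacheDec M) (t.layout s) ({t with cache := d, red := none}.layout s) := by
  obtain ⟨d, hd, -, he⟩ := exec_alap_decrement_of_pos hs t.last {t with red := some t.last} hc rfl
    le_rfl hv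
  exact ⟨d, hd, (exec_cacheInit hc hr).seq (he.seq
    ((fails_unfinished (t := {t with cache := d, red := none}) hc hs rfl).ite exec_skip))⟩

/-- The counter stays at zero and the red root survives on the last node. Its presence is the test
for zero in `Encoding`, where `Finish` succeeds precisely then. -/
theorem exec_cacheDec_of_zero (hs : ∀ i a, s.node i ≠ mroot .red a) (hc : t.center = root (num q))
    (hr : t.red = none) (hv : value t.cache (t.last + 1) = 0) :
    ∃ d, value d (t.last + 1) = 0 ∧
      Exec (CacheDec M) (t.layout s) ({t with cache := d, red := some t.last}.layout s) := by
  have h0 := eq_of_value_eq (e := fun _ => 0) (hv.trans (value_const_zero fun _ _ => rfl).symm)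
  obtain ⟨d, hd, -, he⟩ := exec_alap_decrement_of_zero hs t.last {t with red := some t.last} hc rfl
    le_rfl fun i hi => h0 i (by omega)
  obtain ⟨d', hd', -, he'⟩ := exec_alap_reset hs t.last 0 {t with cache := d, red := some 0} hc rfl
    (Nat.zero_add _) fun i _ hi => hd i hi
  exact ⟨d', value_const_zero fun i hi => hd' i (Nat.zero_le _) (by simp only; omega),
    (exec_cacheInit hc hr).seq (he.seq
      ((exec_unfinished (t := {t with cache := d, red := some 0}) rfl (Nat.zero_le _)).ite he'))⟩

theorem breaks_increment {t : Tapes} {r : ℕ} (hr : t.red = some r) (hl : r ≤ t.last)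
    (hx : t.cache r ≠ 2) :
    Breaks Increment (t.layout s)
      ({t with cache := Function.update t.cache r (t.cache r + 1), red := none}.layout s) :=
  (exec_inc hr hl hx).tryte_breaks ((exec_finish
    (t := {t with cache := Function.update t.cache r (t.cache r + 1)}) hr hl).seq_breaks breaks_brk)

/-- Addition with carry. The bound excludes a counter full of 2s, so the carry is always absorbed,
and the branch of `CacheInc` that resets the counter is never entered. -/
theorem exec_alap_increment (hs : ∀ i a, s.node i ≠ mroot .red a) (r : ℕ) (t : Tapes)
    (hc : t.center = root (num q)) (hr : t.red = some r) (hl : r ≤ t.last)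
    (hv : value t.cache (r + 1) + 1 < 3 ^ (r + 1)) :
    ∃ d, value d (r + 1) = value t.cache (r + 1) + 1 ∧ (∀ i, r < i → d i = t.cache i) ∧
      Exec (.alap Increment) (t.layout s) ({t with cache := d, red := none}.layout s) := by
  induction r generalizing t with
  | zero =>
    have hx : t.cache 0 ≠ 2 := by
      intro h
      simp [value, h] at hv
    refine ⟨_, ?_, fun i hi => Function.update_of_ne (by omega) _ _,
      (breaks_increment hr hl hx).alap⟩
    rw [value_update_succ, value_succ, val_add_one hx, add_assoc]
  | succ r ih =>
    by_cases hx : t.cache (r + 1) = 2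
    · have hv' : value t.cache (r + 1) + 1 < 3 ^ (r + 1) := by
        rw [value, hx, pow_succ] at hv
        change 3 * value t.cache (r + 1) + 2 + 1 < _ at hv
        omega
      obtain ⟨d, hd, hd', he⟩ := ih
        {t with cache := Function.update t.cache (r + 1) 0, red := some r} hc rfl
        (by simp only; omega) (by simp only [value_update_self]; exact hv')
      simp only [value_update_self] at hd
      refine ⟨d, ?_, fun i hi => ?_, Exec.alap ((fails_inc hc hs hr hx).tryte
        ((exec_overflow hr hl hx).seq ?_)) he⟩
      · rw [value_succ d (r + 1), value_succ t.cache (r + 1), hd' _ (by omega), hx]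
        simp only [Function.update_self]
        change 3 * value d (r + 1) + 0 = 3 * value t.cache (r + 1) + 2 + 1
        omega
      · rw [hd' i (by omega)]
        exact Function.update_of_ne (by omega) _ _
      · exact Exec.tryElse (exec_redMove_blue
          (t := {t with cache := Function.update t.cache (r + 1) 0}) hr hl)
    · refine ⟨_, ?_, fun i hi => Function.update_of_ne (by omega) _ _,
        (breaks_increment hr hl hx).alap⟩
      rw [value_update_succ, value_succ t.cache (r + 1), val_add_one hx, add_assoc]

theorem exec_cacheInc (hs : ∀ i a, s.node i ≠ mroot .red a) (hc : t.center = root (num q))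
    (hr : t.red = none) (hv : value t.cache (t.last + 1) + 1 < 3 ^ (t.last + 1)) :
    ∃ d, value d (t.last + 1) = value t.cache (t.last + 1) + 1 ∧
      Exec (CacheInc M) (t.layout s) ({t with cache := d, red := none}.layout s) := by
  obtain ⟨d, hd, -, he⟩ := exec_alap_increment hs t.last {t with red := some t.last} hc rfl
    le_rfl hv
  exact ⟨d, hd, (exec_cacheInit hc hr).seq (he.seq
    ((fails_unfinished (t := {t with cache := d, red := none}) hc hs rfl).ite exec_skip))⟩

/-! ## Encoding and decoding -/

variable {b : ℕ} {ct : ℕ → ℕ}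

theorem Blocks.list_node_ne_red (b : ℕ) (ct : ℕ → ℕ) (blue : Option ℕ) (i : ℕ) (a : Atom) :
    (Blocks.list b ct blue).node i ≠ mroot .red a := by
  simp only [Blocks.list]
  split_ifs <;> simp [mroot, plain, lab]

theorem Blocks.list_node_ne_root (b : ℕ) (ct : ℕ → ℕ) (i : ℕ) (a : Atom) :
    (Blocks.list b ct none).node i ≠ root a := by
  simp [Blocks.list, plain, root]

theorem Blocks.list_node_ne_grey (b : ℕ) (ct : ℕ → ℕ) (i : ℕ) (a : Atom) :
    (Blocks.list b ct none).node i ≠ mroot .grey a := by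
  simp [Blocks.list, plain, mroot]

/-- The sum of the counter and the index of the blue root is invariant. Each round decrements the
one and moves the other to the right; at zero the red root left by `CacheDec` is cleared and the
loop breaks. -/
theorem exec_alap_encoding (v i : ℕ) (t : Tapes) (hc : t.center = root (num q))
    (hr : t.red = none) (hv : value t.cache (t.last + 1) = v) (hb : v + i < b) :
    ∃ d, value d (t.last + 1) = 0 ∧
      Exec (.alap (Encoding M)) (t.layout (.list b ct (some i)))
        ({t with cache := d, red := none}.layout (.list b ct (some (v + i)))) := by
  induction v generalizing i t with
  | zero =>
    obtain ⟨d, hd, he⟩ := exec_cacheDec_of_zero (Blocks.list_node_ne_red b ct (some i)) hc hr hv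
    rw [Nat.zero_add]
    exact ⟨d, hd, Breaks.alap (he.seq_breaks (Breaks.seq
      ((exec_finish (t := {t with cache := d, red := some t.last}) rfl le_rfl).tryte_breaks
        breaks_brk)))⟩
  | succ v ih =>
    obtain ⟨d, hd, he⟩ := exec_cacheDec_of_pos (Blocks.list_node_ne_red b ct (some i)) hc hr
      (by omega)
    obtain ⟨d', hd', he'⟩ := ih (i + 1) {t with cache := d, red := none} hc rfl
      (by simp only; omega) (by omega)
    rw [show v + (i + 1) = v + 1 + i by omega] at he'
    exact ⟨d', hd', Exec.alap (he.seq ((Fails.tryThen (fails_finish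
      (t := {t with cache := d, red := none})
      hc (Blocks.list_node_ne_red b ct (some i)) rfl)).seq
        (Exec.tryCom (exec_blueMove_red (by omega))))) he'⟩

theorem exec_encode (hc : t.center = root (num q)) (hr : t.red = none) (ha : t.active < b)
    (hct : ct t.active < b) (hv : value t.cache (t.last + 1) < b) :
    ∃ d, value d (t.last + 1) = 0 ∧
      Exec (Encode M) (t.layout (.list b ct none)) ({t with cache := d, red := none}.layout
        (.list b (Function.update ct t.active (value t.cache (t.last + 1))) none)) := by
  obtain ⟨d, hd, he⟩ := exec_alap_encoding (ct := ct) _ 0 t hc hr rfl hv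
  exact ⟨d, hd, (exec_encodeInit hc (by omega)).seq (he.seq
    (exec_update (t := {t with cache := d, red := none}) hc ha hv hct))⟩

/-- The same invariant as for encoding, read backwards. The loop breaks when the blue root cannot
leave node 0. -/
theorem exec_alap_decoding (i : ℕ) (t : Tapes) (hc : t.center = root (num q))
    (hr : t.red = none) (hb : i < b) (hv : value t.cache (t.last + 1) + i < 3 ^ (t.last + 1)) :
    ∃ d, value d (t.last + 1) = value t.cache (t.last + 1) + i ∧
      Exec (.alap (Decoding M)) (t.layout (.list b ct (some i)))
        ({t with cache := d, red := none}.layout (.list b ct (some 0))) := by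
  induction i generalizing t with
  | zero =>
    refine ⟨t.cache, rfl, ?_⟩
    rw [← hr]
    exact Breaks.alap (Breaks.seq ((fails_blueMove_blue hc).tryte_breaks breaks_brk))
  | succ i ih =>
    obtain ⟨d, hd, he⟩ := exec_cacheInc (Blocks.list_node_ne_red b ct (some i)) hc hr (by omega)
    obtain ⟨d', hd', he'⟩ := ih {t with cache := d, red := none} hc rfl (by omega)
      (by simp only; omega)
    exact ⟨d', by simp only at hd'; omega,
      Exec.alap ((Exec.tryElse (exec_blueMove_blue hb)).seq he) he'⟩

/-- Decoding counts up from zero, the value that the preceding `Encode` leaves in CACHE. Afterwards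
the blue root is on node 0, and `Update` gives the active block node its dashed edge to that node.
The bound `hb` keeps the counter from overflowing. -/
theorem exec_decode (hc : t.center = root (num q)) (hr : t.red = none) (ha : t.active < b)
    (hct : ct t.active < b) (hb : b ≤ 3 ^ (t.last + 1)) (hv : value t.cache (t.last + 1) = 0) :
    ∃ d, value d (t.last + 1) = ct t.active ∧
      Exec (Decode M) (t.layout (.list b ct none)) ({t with cache := d, red := none}.layout
        (.list b (Function.update ct t.active 0) none)) := by
  obtain ⟨d, hd, he⟩ := exec_alap_decoding (ct := ct) (ct t.active) t hc hr hct (by omega)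
  exact ⟨d, by omega, (exec_decodeInit hc ha hct).seq (he.seq
    (exec_update (t := {t with cache := d, red := none}) hc ha (by omega) hct))⟩

/-! ## Changing the active block -/

theorem exec_alap_headLeft (h : ℕ) (t : Tapes) (hc : t.center = root (num q))
    (hr : t.red = none) (hm : t.move = .empty) (hh : t.head = h) (hl : h ≤ t.last) :
    Exec (.alap (HeadLeft M)) (t.layout s) ({t with head := 0}.layout s) := by
  induction h generalizing t with
  | zero =>
    rw [← hh]
    exact (fails_headMove_blue hh).alap
  | succ h ih =>
    have := ih {t with head := h, move := .empty} hc hr rfl rfl (by simp only; omega)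
    rw [← hm] at this
    exact Exec.alap (exec_headMove_blue hc hm hh hl hr) (hm ▸ this)

theorem exec_alap_headRight (k : ℕ) (t : Tapes) (hc : t.center = root (num q))
    (hr : t.red = none) (hm : t.move = .empty) (hh : t.head + k = t.last) :
    Exec (.alap (HeadRight M)) (t.layout s) ({t with head := t.last}.layout s) := by
  induction k generalizing t with
  | zero =>
    obtain ⟨⟩ := t
    simp only [Nat.add_zero] at hh
    subst hh
    exact (fails_headMove_red rfl).alap
  | succ k ih =>
    have := ih {t with head := t.head + 1, move := .empty} hc hr rfl (by simp only; omega)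
    rw [← hm] at this
    exact Exec.alap (exec_headMove_red hc hm rfl (by omega) hr) (hm ▸ this)

/-- Encoding changes only the entry of the old active block, so the entry `a + 1` that is decoded
next is still the stored one. Encoding and decoding both need `b` to be the number of contents of
CACHE. -/
theorem exec_nextBlock {a : ℕ} (hc : t.center = root (num q)) (hr : t.red = none)
    (hm : t.move = .empty)
    (hh : t.head ≤ t.last) (ha' : t.active = a) (ha : a + 1 < b) (hct : ∀ i < b, ct i < b)
    (hb : b = 3 ^ (t.last + 1)) :
    ∃ d, value d (t.last + 1) = ct (a + 1) ∧
      Exec (NextBlock M) (t.layout (.list b ct none))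
        ({t with cache := d, red := none, head := 0, active := a + 1}.layout
          (.list b (Function.update
            (Function.update ct a (value t.cache (t.last + 1))) (a + 1) 0) none)) := by
  subst ha'
  have hv := value_lt t.cache (t.last + 1)
  rw [← hb] at hv
  obtain ⟨d, hd, he⟩ := exec_encode hc hr (by omega) (hct _ (by omega)) hv
  obtain ⟨d', hd', he'⟩ := exec_decode (b := b)
    (ct := Function.update ct t.active (value t.cache (t.last + 1)))
    (t := {t with cache := d, red := none, active := t.active + 1, head := 0}) hc rfl ha
    (by simpa using hct _ ha) hb.le hd
  refine ⟨d', by simpa using hd', he.seq (Exec.tryte (exec_blockMove_red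
    (t := {t with cache := d, red := none}) hc rfl ha
    (by simp only [Blocks.list]; omega) ha rfl rfl) ((exec_alap_headLeft (q := q) t.head
    {t with cache := d, red := none, active := t.active + 1} ?_ ?_ ?_ ?_ ?_).seq he'))⟩
  · exact hc
  · rfl
  · exact hm
  · rfl
  · exact hh

/-- No red edge leaves the last block node, so `Next` fails and the flag is set. The contents are
about to be erased; only their range matters, because `Undirect` has to match the targets of the
dashed edges as ordinary block nodes. -/
theorem exec_nextBlock_of_last (hc : t.center = root (num q)) (hr : t.red = none)
    (ha : t.active + 1 = b) (hct : ∀ i < b, ct i < b)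
    (hb : b = 3 ^ (t.last + 1)) :
    ∃ d ct', Exec (NextBlock M) (t.layout (.list b ct none))
      ({t with cache := d, red := none, center := mroot .grey (num q)}.layout
        (.list b ct' none)) ∧ ∀ i < b, ct' i < b := by
  have hv := value_lt t.cache (t.last + 1)
  rw [← hb] at hv
  obtain ⟨d, hd, he⟩ := exec_encode hc hr (by omega) (hct _ (by omega)) hv
  refine ⟨d, _, he.seq (Fails.tryte (fails_blockMove_red ?_ (Blocks.list_node_ne_root _ _))
    (exec_setFlag (t := {t with cache := d, red := none}) hc)), fun i hi => ?_⟩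
  · simp only [Blocks.list]; omega
  · rw [Function.update_apply]
    split_ifs
    · exact hv
    · exact hct i hi

theorem exec_prevBlock {a : ℕ} (hc : t.center = root (num q)) (hr : t.red = none)
    (hm : t.move = .empty) (hh : t.head ≤ t.last) (ha' : t.active = a + 1) (ha : a + 1 < b)
    (hct : ∀ i < b, ct i < b) (hb : b = 3 ^ (t.last + 1)) :
    ∃ d, value d (t.last + 1) = ct a ∧
      Exec (PrevBlock M) (t.layout (.list b ct none))
        ({t with cache := d, red := none, head := t.last, active := a}.layout
          (.list b (Function.update
            (Function.update ct (a + 1) (value t.cache (t.last + 1))) a 0) none)) := by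
  have hv := value_lt t.cache (t.last + 1)
  rw [← hb] at hv
  obtain ⟨d, hd, he⟩ := exec_encode hc hr (by omega) (hct _ (by omega)) hv
  rw [ha'] at he
  obtain ⟨d', hd', he'⟩ := exec_decode (b := b)
    (ct := Function.update ct (a + 1) (value t.cache (t.last + 1)))
    (t := {t with cache := d, red := none, active := a, head := t.last}) hc rfl
    (by simp only; omega) (by simpa using hct _ (by omega)) hb.le hd
  refine ⟨d', by simpa using hd', he.seq ((exec_blockMove_blue
    (t := {t with cache := d, red := none, active := a + 1}) hc rfl ha
    (by simp only [Blocks.list]; omega) ha rfl rfl).seq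
      ((exec_alap_headRight (q := q) (t.last - t.head)
      {t with cache := d, red := none, active := a} ?_ ?_ ?_ ?_).seq he'))⟩
  · exact hc
  · rfl
  · exact hm
  · simp only; omega

end

section

open Sim

variable {M : OffLineTM} {t : Tapes} {s : Blocks}

/-! ## Rewinding the tapes and resetting CACHE -/

theorem exec_rewindInput (hc : t.center = center M) (hl : t.inHead < t.len) :
    Exec (tryCom (RewindInput M)) (t.layout s) ({t with inHead := 0}.layout s) := by
  by_cases h0 : t.inHead = 0
  · rw [← h0]
    -- The scanned square is already the first one, and an injective match would need two different
    -- input nodes.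
    refine Fails.tryCom (fails_call fun i => blocked_inPlace ?_)
    rintro ⟨f, hf, -, he⟩
    simp only [List.forall_mem_cons] at he
    obtain ⟨⟨w, -, -, ht, hw⟩, ⟨w', -, -, ht', hw'⟩, -⟩ := he
    cases w <;> simp [Tapes.layout, lab, col, num] at hw
    cases w' <;> simp [Tapes.layout, lab, col, num] at hw'
    replace ht : NodeName.input 0 = f 1 := ht
    replace ht' : NodeName.input t.inHead = f 2 := ht'
    rw [h0, ht] at ht'
    exact absurd (hf ht') (by decide)
  · refine Exec.tryCom (exec_call (t.input 0, t.input t.inHead) (leads_redirect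
      ![.center, .input 0, .input t.inHead] [.inputFirst, .inputHead] ?_ ?_ ?_ ?_ ?_ ?_
      rfl rfl (fun x _ h => ?_) (fun x _ h => ?_)))
    · simp [Ne.symm h0]
    · simp
    · simp [Fin.forall_fin_succ, Tapes.layout, hc, hl]; omega
    · simp [Fin.forall_fin_succ, Tapes.layout, hc]
    · simp [Tapes.layout, EdgeName.src]
    · simp [Tapes.layout, EdgeName.src]
    · cases x <;> rfl
    · cases x <;> first | exact ⟨rfl, rfl⟩ | simp at h

theorem exec_rewind_blockset {b : ℕ} {ct : ℕ → ℕ} (hc : t.center = center M) (ha : t.active < b)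
    (h0 : t.active ≠ 0) :
    Exec (rewind_blockset M) (t.layout (.list b ct none))
      ({t with active := 0}.layout (.list b ct none)) := by
  refine exec_call () (leads_redirect
    ![.center, .block 0, .block t.active] [.blockFirst, .blockActive] ?_ ?_ ?_ ?_ ?_ ?_
    rfl rfl (fun x _ h => ?_) (fun x _ h => ?_))
  · simp [Ne.symm h0]
  · simp
  · simp [Fin.forall_fin_succ, Tapes.layout, Blocks.list, hc, ha]; omega
  · simp [Fin.forall_fin_succ, Tapes.layout, Blocks.list, hc]
  · simp [Tapes.layout, EdgeName.src]
  · simp [Tapes.layout, EdgeName.src]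
  · cases x <;> rfl
  · cases x <;> first | exact ⟨rfl, rfl⟩ | simp at h

theorem exec_rewindCache {h : ℕ} (hc : t.center = center M) (ha : t.move = .empty)
    (hh : t.head = h + 1) (hl : h + 1 ≤ t.last) (hr : t.red = none) :
    Exec (RewindCache M) (t.layout s) ({t with head := h}.layout s) := by
  refine exec_call (t.cache (h + 1), t.cache h) (leads_redirect
    ![.center, .cache (h + 1), .cache h] [.cacheHead, .cacheLeft h] ?_ ?_ ?_ ?_ ?_ ?_
    rfl rfl (fun x _ h => ?_) (fun x _ h => ?_))
  · simp
  · simp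
  · simp [Fin.forall_fin_succ, Tapes.layout, hc, hr]; omega
  · simp [Fin.forall_fin_succ, Tapes.layout, hc, hr]
  · simp [Tapes.layout, EdgeName.src, hh, ha]; omega
  · simp [Tapes.layout, EdgeName.src, ha]
  · cases x <;> rfl
  · cases x <;> first | exact ⟨rfl, rfl⟩ | simp_all [Tapes.layout]

theorem fails_rewindCache (h : t.head = 0) : Fails (RewindCache M) (t.layout s) := by
  refine fails_call fun i => blocked_inPlace ?_
  rintro ⟨f, hf, hn, he⟩
  simp only [List.forall_mem_cons] at he
  obtain ⟨⟨w, -, -, ht, hw⟩, ⟨w', -, hs', -, hw'⟩, -⟩ := he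
  cases w <;> simp [Tapes.layout, lab, col] at hw
  replace ht : NodeName.cache t.head = f 1 := ht
  replace hs' : w'.src = f 1 := hs'
  rw [← ht, h] at hs'
  cases w' <;> simp [EdgeName.src, Tapes.layout, lab, col] at hs' hw'

theorem exec_alap_rewindCache (h : ℕ) (t : Tapes) (hc : t.center = center M)
    (hr : t.red = none) (hm : t.move = .empty) (hh : t.head = h) (hl : h ≤ t.last) :
    Exec (.alap (RewindCache M)) (t.layout s) ({t with head := 0}.layout s) := by
  induction h generalizing t with
  | zero =>
    rw [← hh]
    exact (fails_rewindCache hh).alap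
  | succ h ih =>
    exact Exec.alap (exec_rewindCache hc hm hh hl hr)
      (ih {t with head := h} hc hr hm rfl (by simp only; omega))

theorem exec_cInit (hc : t.center = center M) (hr : t.red = none) (hm : t.move = .empty)
    (hh : t.head = 0) :
    Exec (CInit M) (t.layout s)
      ({t with cache := Function.update t.cache 0 2, red := some 0}.layout s) := by
  refine exec_call (t.cache 0) (leads_redirect
    ![.center, .cache 0] [.cacheHead] ?_ ?_ ?_ ?_ ?_ ?_
    rfl rfl (fun x _ h => ?_) (fun x _ h => ?_))
  · simp
  · simp
  · simp [Fin.forall_fin_succ, Tapes.layout, hc, hr]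
  · simp [Fin.forall_fin_succ, Tapes.layout, hc, blank]
  · simp [Tapes.layout, EdgeName.src, hh, hm]
  · simp [Tapes.layout, EdgeName.src, hh, hm]
  · cases x with
    | cache i =>
      have hi : i ≠ 0 := by
        rintro rfl
        exact h 1 rfl
      simp [Tapes.layout, hi, hr, Ne.symm hi]
    | _ => rfl
  · cases x <;> exact ⟨rfl, rfl⟩

theorem exec_erase {r : ℕ} (hr : t.red = some r) (hl : r + 1 ≤ t.last) (hx : t.cache r = 2) :
    Exec Erase (t.layout s)
      ({t with cache := Function.update t.cache (r + 1) 2, red := some (r + 1)}.layout s) := by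
  refine exec_call (t.cache (r + 1)) (leads_redirect
    ![.cache r, .cache (r + 1)] [.cacheRight r] ?_ ?_ ?_ ?_ ?_ ?_
    rfl rfl (fun x _ h => ?_) (fun x _ h => ?_))
  · simp
  · simp
  · simp [Fin.forall_fin_succ, Tapes.layout, hr, hx, blank]; omega
  · simp [Fin.forall_fin_succ, Tapes.layout, blank, hx]
  · simp [Tapes.layout, EdgeName.src]; omega
  · simp [Tapes.layout, EdgeName.src]
  · cases x with
    | cache i =>
      have hi : i ≠ r := by
        rintro rfl
        exact h 0 rfl
      have hi' : i ≠ r + 1 := by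
        rintro rfl
        exact h 1 rfl
      simp [Tapes.layout, hr, hi', Ne.symm hi, Ne.symm hi']
    | _ => rfl
  · cases x <;> exact ⟨rfl, rfl⟩

theorem fails_erase (hc : t.center = center M) (hs : ∀ i a, s.node i ≠ mroot .red a)
    (hr : t.red = some t.last) : Fails Erase (t.layout s) := by
  refine fails_call fun i => blocked_inPlace ?_
  rintro ⟨f, hf, hn, he⟩
  obtain ⟨w, hm, hw, -, hw'⟩ := he _ (List.mem_cons_self ..)
  obtain ⟨r, hv, hr', hx⟩ := red_root_eq (q := M.start) hc hs (hn 0).2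
  obtain rfl : t.last = r := by simpa [hr] using hr'
  replace hw : w.src = f 0 := hw
  rw [hv] at hw
  cases w <;> simp [EdgeName.src, Tapes.layout, lab, col] at hw hw' hm
  omega

theorem exec_alap_erase (hs : ∀ i a, s.node i ≠ mroot .red a) (k r : ℕ) (t : Tapes)
    (hc : t.center = center M) (hr : t.red = some r) (hl : r + k = t.last)
    (hv : ∀ i ≤ r, t.cache i = 2) :
    ∃ d, (∀ i ≤ t.last, d i = 2) ∧
      Exec (.alap Erase) (t.layout s) ({t with cache := d, red := some t.last}.layout s) := by
  induction k generalizing r t with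
  | zero =>
    obtain rfl : r = t.last := hl
    refine ⟨t.cache, hv, ?_⟩
    rw [← hr]
    exact (fails_erase hc hs hr).alap
  | succ k ih =>
    obtain ⟨d, hd, he⟩ := ih (r + 1)
      {t with cache := Function.update t.cache (r + 1) 2, red := some (r + 1)} hc rfl
      (by simp only; omega) (fun i hi => by
        simp only [Function.update_apply]
        split_ifs
        · rfl
        · exact hv i (by omega))
    exact ⟨d, hd, Exec.alap (exec_erase hr (by omega) (hv r le_rfl)) he⟩

/-- The edge to the last node is deleted and created again with a new target, so its name occurs on
both sides; only the two new links have fresh names. -/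
theorem exec_finalSquare (hc : t.center = center M) (hr : t.red = some t.last)
    (hx : t.cache t.last = 2) :
    Exec (finalSquare M) (t.layout s) ({t with
      last := t.last + 1
      cache := Function.update t.cache (t.last + 1) 2
      red := none}.layout s) := by
  refine exec_call () (leads_creating ![.center, .cache t.last] ![.cache (t.last + 1)]
    [.cacheLast] [.cacheLast, .cacheRight t.last, .cacheLeft t.last]
    ?_ ?_ ?_ ?_ ?_ ?_ ?_ ?_ ?_ ?_ (fun x => ?_) (fun x => ?_) (fun x hx h => ?_) (fun x _ h => ?_))
  · simp
  · simp
  · simp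
  · simp
  · simp [Fin.forall_fin_succ, Tapes.layout, hc, hr, hx, blank]
  · simp [Fin.forall_fin_succ, Tapes.layout, hc, hx, blank]
  · simp [Tapes.layout, blank]
  · simp [Tapes.layout, EdgeName.src]
  · simp [Tapes.layout, EdgeName.src]
  · simp [Tapes.layout]
  · cases x with
    | cache i => simp [Tapes.layout]; omega
    | _ => simp [Tapes.layout]
  · cases x with
    | cacheRight i => simp [Tapes.layout]; omega
    | cacheLeft i => simp [Tapes.layout]; omega
    | _ => simp [Tapes.layout]
  · cases x with
    | cache i =>
      have hi : i ≠ t.last := by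
        rintro rfl
        exact h 1 rfl
      have hi' : i ≠ t.last + 1 := by
        replace hx : i ≤ t.last := hx
        omega
      simp [Tapes.layout, hi', hr, Ne.symm hi]
    | _ => rfl
  · cases x <;> first | exact ⟨rfl, rfl⟩ | simp at h

/-- The red root sweeps from the first to the last node and leaves blanks behind. The node appended
at the end provides the additional digit of the larger encoding. -/
theorem exec_resetCache (hs : ∀ i a, s.node i ≠ mroot .red a) (hc : t.center = center M)
    (hr : t.red = none) (hm : t.move = .empty) (hh : t.head = 0) :
    ∃ d, (∀ i ≤ t.last + 1, d i = 2) ∧ Exec (ResetCache M) (t.layout s)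
      ({t with last := t.last + 1, cache := d, red := none}.layout s) := by
  obtain ⟨d, hd, he⟩ := exec_alap_erase hs t.last 0
    {t with cache := Function.update t.cache 0 2, red := some 0} hc rfl (Nat.zero_add _)
    (fun i hi => by
      obtain rfl : i = 0 := by omega
      simp)
  refine ⟨_, fun i hi => ?_, (exec_cInit hc hr hm hh).seq (he.seq (exec_finalSquare
    (t := {t with cache := d, red := some t.last}) hc rfl (hd _ le_rfl)))⟩
  simp only [Function.update_apply]
  split_ifs
  · rfl
  · exact hd i (by simp only; omega)

/-! ## Enlarging BLOCKSET -/

/-- BLOCKSET with `b` nodes and copies of its nodes `0, …, j`, where the dashed edges of the first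
`m` nodes have been deleted. -/
def Blocks.copying (b : ℕ) (ct : ℕ → ℕ) (j m : ℕ) : Blocks where
  mem := fun i => i < b ∨ (b ≤ i ∧ i ≤ b + j) ∨ (2 * b ≤ i ∧ i ≤ 2 * b + j)
  linked := fun i => i + 1 < b ∨ (b ≤ i ∧ i < b + j) ∨ (2 * b ≤ i ∧ i < 2 * b + j)
  node := fun i => if i = j then mroot .blue .empty else if i = b + j then mroot .blue (num 1)
    else if i = 2 * b + j then mroot .blue (num 2) else plain .empty
  directed := fun i => m ≤ i ∧ i < b
  content := ct
  copied := True
  size := b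

/-- BLOCKSET with `3 * e + 3` nodes, where the nodes to the right of node `r` have a dashed edge to
the last node. -/
def Blocks.directing (e r : ℕ) : Blocks where
  mem := fun i => i < 3 * e + 3
  linked := fun i => i + 1 < 3 * e + 3
  node := fun i => if i = r then root .empty else if i = 3 * e + 2 then mroot .blue (num 2)
    else plain .empty
  directed := fun i => r < i ∧ i < 3 * e + 3
  content := fun _ => 3 * e + 2
  copied := False
  size := 0

variable {b j e r : ℕ} {ct : ℕ → ℕ}

/-- The copies are numbered from `b` and from `2 * b` on. Gluing then produces a list numbered
consecutively up to `3 * b - 1`, without any renaming. -/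
theorem exec_binit (hc : t.center = center M) (hb : 0 < b) :
    Exec (binit M) (t.layout (.list b ct none)) (t.layout (.copying b ct 0 0)) := by
  have h2 : b ≠ 2 * b := by omega
  refine exec_call () (leads_creating ![.center, .block 0] ![.block b, .block (2 * b)]
    [.blockFirst] [.blockFirst, .copyFirst false, .copyFirst true]
    ?_ ?_ ?_ ?_ ?_ ?_ ?_ ?_ ?_ ?_ (fun x => ?_) (fun x => ?_) (fun x hx h => ?_) (fun x _ h => ?_))
  · simp
  · simp [h2]
  · simp
  · simp
  · simp [Fin.forall_fin_succ, Tapes.layout, Blocks.list, hc, hb]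
  · simp [Fin.forall_fin_succ, Tapes.layout, Blocks.copying, hc]
  · simp [Fin.forall_fin_succ, Tapes.layout, Blocks.list, Blocks.copying, hb.ne', h2.symm]
    omega
  · simp [Tapes.layout, EdgeName.src]
  · simp [Tapes.layout, Blocks.copying, EdgeName.src]
  · simp [Tapes.layout, Blocks.list]
  · cases x with
    | block i => simp [Tapes.layout, Blocks.list, Blocks.copying, Fin.exists_fin_succ]; omega
    | _ => simp [Tapes.layout, Fin.exists_fin_succ]
  · cases x with
    | copyFirst i => simp [Tapes.layout, Blocks.list, Blocks.copying]
    | _ => simp [Tapes.layout, Blocks.list, Blocks.copying]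
  · cases x with
    | block i =>
      have hi : i ≠ 0 := by
        rintro rfl
        exact h 1 rfl
      replace hx : i < b := hx
      simp only [Tapes.layout, Blocks.list, Blocks.copying]
      rw [if_neg hi, if_neg (by omega), if_neg (by omega), if_neg (by simp)]
    | _ => rfl
  · cases x <;> exact ⟨rfl, rfl⟩

theorem exec_undirect (hj : j < b) (hct : ct j < b) :
    Exec Undirect (t.layout (.copying b ct j j)) (t.layout (.copying b ct j (j + 1))) := by
  have hE (x : EdgeName) : (t.layout (.copying b ct j (j + 1))).edges x ↔
      ((t.layout (.copying b ct j j)).edges x ∧ x ∉ [EdgeName.content j]) ∨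
        x ∈ ([] : List EdgeName) := by
    cases x with
    | content i => simp [Tapes.layout, Blocks.copying]; omega
    | _ => simp [Tapes.layout, Blocks.copying]
  by_cases h : ct j = j
  · refine exec_call 1 (leads_inPlace ![.block j] [.content j] [] ?_ ?_ ?_ ?_ ?_ ?_ ?_ ?_
      (fun x => Iff.rfl) hE (fun x _ _ => ?_) (fun x _ _ => ?_))
    · simp
    · simp
    · simp
    · simp [Tapes.layout, Blocks.copying, hj]
    · simp [Tapes.layout, Blocks.copying]
    · simp [Tapes.layout, Blocks.copying, EdgeName.src, h, hj]
    · simp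
    · simp
    · cases x <;> rfl
    · cases x <;> exact ⟨rfl, rfl⟩
  -- A target below `b` and different from `j` is an ordinary node: the other marked nodes belong to
  -- the copies.
  · have hn : (if ct j = j then mroot .blue .empty else if ct j = b + j then mroot .blue (num 1)
        else if ct j = 2 * b + j then mroot .blue (num 2) else plain .empty) = plain .empty := by
      rw [if_neg h, if_neg (by omega), if_neg (by omega)]
    refine exec_call 0 (leads_inPlace ![.block j, .block (ct j)] [.content j] []
      ?_ ?_ ?_ ?_ ?_ ?_ ?_ ?_ (fun x => Iff.rfl) hE (fun x _ _ => ?_) (fun x _ _ => ?_))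
    · simp [Ne.symm h]
    · simp
    · simp
    · simp only [Fin.forall_fin_succ, Tapes.layout, Blocks.copying]
      simp [hj, hct, hn]
    · simp only [Fin.forall_fin_succ, Tapes.layout, Blocks.copying]
      simp [hn]
    · simp [Tapes.layout, Blocks.copying, EdgeName.src, hj]
    · simp
    · simp
    · cases x <;> rfl
    · cases x <;> exact ⟨rfl, rfl⟩


theorem exec_copy (hj : j + 1 < b) :
    Exec copy (t.layout (.copying b ct j (j + 1)))
      (t.layout (.copying b ct (j + 1) (j + 1))) := by
  have h4 : j + 1 ≠ b + j := by omega
  have h5 : j + 1 ≠ 2 * b + j := by omega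
  have h6 : b + j ≠ 2 * b + (j + 1) := by omega
  have h7 : 2 * b + j ≠ b + (j + 1) := by omega
  have h10 : b ≠ 0 := by omega
  have h11 : 2 * b + j ≠ j + 1 := by omega
  have h12 : j ≠ b + (j + 1) := by omega
  have h13 : j ≠ 2 * b + (j + 1) := by omega
  have h15 : b + j ≠ j + 1 := by omega
  refine exec_call () (leads_creating
    ![.block j, .block (j + 1), .block (b + j), .block (2 * b + j)]
    ![.block (b + (j + 1)), .block (2 * b + (j + 1))]
    [.blockRight j] [.blockRight j, .blockRight (b + j), .blockLeft (b + j),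
      .blockRight (2 * b + j), .blockLeft (2 * b + j)]
    ?_ ?_ ?_ ?_ ?_ ?_ ?_ ?_ ?_ ?_ (fun x => ?_) (fun x => ?_) (fun x hx h => ?_) (fun x _ h => ?_))
  · simp; omega
  · simp; omega
  · simp
  · simp; omega
  · simp [Fin.forall_fin_succ, Tapes.layout, Blocks.copying, h4, h5, h10]
    omega
  · simp [Fin.forall_fin_succ, Tapes.layout, Blocks.copying, h6, h7, h11, h12, h13, h15]
  · simp [Fin.forall_fin_succ, Tapes.layout, Blocks.copying, h10]
    omega
  · simp [Tapes.layout, Blocks.copying, EdgeName.src, hj]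
  · simp [Tapes.layout, Blocks.copying, EdgeName.src, add_assoc]
  · simp [Tapes.layout, Blocks.copying]
    omega
  · cases x with
    | block i => simp [Tapes.layout, Blocks.copying, Fin.exists_fin_succ]; omega
    | _ => simp [Tapes.layout, Fin.exists_fin_succ]
  · cases x with
    | blockRight i => simp [Tapes.layout, Blocks.copying]; omega
    | blockLeft i => simp [Tapes.layout, Blocks.copying]; omega
    | _ => simp [Tapes.layout, Blocks.copying]
  · cases x with
    | block i =>
      have hi : i ≠ j := by
        rintro rfl
        exact h 0 rfl
      have hi1 : i ≠ j + 1 := by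
        rintro rfl
        exact h 1 rfl
      have hi2 : i ≠ b + j := by
        rintro rfl
        exact h 2 rfl
      have hi3 : i ≠ 2 * b + j := by
        rintro rfl
        exact h 3 rfl
      replace hx : i < b ∨ (b ≤ i ∧ i ≤ b + j) ∨ (2 * b ≤ i ∧ i ≤ 2 * b + j) := hx
      simp only [Tapes.layout, Blocks.copying]
      rw [if_neg hi, if_neg hi1, if_neg hi2, if_neg hi3, if_neg (by omega), if_neg (by omega)]
    | _ => rfl
  · cases x <;> exact ⟨rfl, rfl⟩

/-- The blue root of atom `empty` is on the last original node, and the copies are not yet linked to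
it, so no red edge leaves it. -/
theorem fails_copy (hc : t.center = center M) :
    Fails copy (t.layout (.copying (e + 1) ct e (e + 1))) := by
  refine fails_call fun _ => blocked_creating ?_
  rintro ⟨f, hf, hn, he⟩
  obtain ⟨w, hm, hw, -, hw'⟩ := he _ (List.mem_cons_self ..)
  have h := (hn 0).2
  replace hw : w.src = f 0 := hw
  rw [← hw] at h
  cases w with
  | blockRight i =>
    simp only [Tapes.layout, Blocks.copying] at hm
    simp only [Tapes.layout, Blocks.copying, EdgeName.src] at h
    split_ifs at h with h1 h2 h3
    · omega
    all_goals simp [mroot, plain, lab, num] at h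
  | cacheRight i =>
    simp only [Tapes.layout, EdgeName.src] at h
    split_ifs at h <;> simp [mroot, plain, lab] at h
  | inputRight i => simp [Tapes.layout, EdgeName.src, mroot, plain, lab] at h
  | cacheLast => simp [Tapes.layout, EdgeName.src, mroot, hc, root, lab, center] at h
  | _ => simp [Tapes.layout, lab, col, num] at hw'

theorem exec_alap_copy (hc : t.center = center M) (hct : ∀ i ≤ e, ct i ≤ e) (k j : ℕ)
    (h : j + k = e) :
    Exec (.alap (copy ;; tryCom Undirect)) (t.layout (.copying (e + 1) ct j (j + 1)))
      (t.layout (.copying (e + 1) ct e (e + 1))) := by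
  induction k generalizing j with
  | zero =>
    obtain rfl : j = e := h
    exact Fails.alap (fails_copy hc).seq
  | succ k ih =>
    have := hct (j + 1) (by omega)
    exact Exec.alap ((exec_copy (by omega)).seq (Exec.tryCom (exec_undirect (by omega) (by omega))))
      (ih (j + 1) (by omega))

/-- The rule names both the first and the penultimate node of the second copy, which must be
different; hence at least three block nodes are needed. -/
theorem exec_glue (hc : t.center = center M) (he : 2 ≤ e) :
    Exec (glue M) (t.layout (.copying (e + 1) ct e (e + 1)))
      (t.layout (.directing e (3 * e + 1))) := by
  -- With `b = g + 3` the copies occupy `g + 3, …, 2 * g + 5` and `2 * g + 6, …, 3 * g + 8`.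
  obtain ⟨g, rfl⟩ : ∃ g, e = g + 2 := ⟨e - 2, by omega⟩
  refine exec_call () (leads_inPlace
    ![.center, .block (g + 2), .block (g + 3), .block (2 * g + 5), .block (2 * g + 6),
      .block (3 * g + 8), .block (3 * g + 7)]
    [.copyFirst false, .copyFirst true, .blockLeft (3 * g + 7)]
    [.blockRight (g + 2), .blockLeft (g + 2), .blockRight (2 * g + 5), .blockLeft (2 * g + 5),
      .blockLeft (3 * g + 7), .content (3 * g + 8)]
    ?_ ?_ ?_ ?_ ?_ ?_ ?_ ?_ (fun x => ?_) (fun x => ?_) (fun x hx h => ?_) (fun x hx h => ?_))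
  · simp; omega
  · simp
  · simp; omega
  · have hn (i : ℕ) : (Blocks.copying (g + 2 + 1) ct (g + 2) (g + 2 + 1)).node i =
        if i = g + 2 then mroot .blue .empty
        else if i = g + 2 + 1 + (g + 2) then mroot .blue (num 1)
        else if i = 2 * (g + 2 + 1) + (g + 2) then mroot .blue (num 2) else plain .empty := rfl
    have n2 := hn (g + 3)
    have n3 := hn (2 * g + 5)
    have n4 := hn (2 * g + 6)
    have n5 := hn (3 * g + 8)
    have n6 := hn (3 * g + 7)
    rw [if_neg (by omega), if_neg (by omega), if_neg (by omega)] at n2 n4 n6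
    rw [if_neg (by omega), if_pos (by omega)] at n3
    rw [if_neg (by omega), if_neg (by omega), if_pos (by omega)] at n5
    have hm {i : ℕ} (hi : i < 3 * g + 9) :
        (Blocks.copying (g + 2 + 1) ct (g + 2) (g + 2 + 1)).mem i := by
      simp only [Blocks.copying]
      omega
    simp only [Fin.forall_fin_succ]
    exact ⟨⟨trivial, hc⟩, ⟨hm (by omega), if_pos rfl⟩, ⟨hm (by omega), n2⟩, ⟨hm (by omega), n3⟩,
      ⟨hm (by omega), n4⟩, ⟨hm (by omega), n5⟩, ⟨hm (by omega), n6⟩, fun i => i.elim0⟩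
  · have hn (i : ℕ) : (Blocks.directing (g + 2) (3 * (g + 2) + 1)).node i =
        if i = 3 * (g + 2) + 1 then root .empty
        else if i = 3 * (g + 2) + 2 then mroot .blue (num 2) else plain .empty := rfl
    have n1 := hn (g + 2)
    have n2 := hn (g + 3)
    have n3 := hn (2 * g + 5)
    have n4 := hn (2 * g + 6)
    have n5 := hn (3 * g + 8)
    have n6 := hn (3 * g + 7)
    rw [if_neg (by omega), if_neg (by omega)] at n1 n2 n3 n4
    rw [if_neg (by omega), if_pos (by omega)] at n5
    rw [if_pos (by omega)] at n6
    simp only [Fin.forall_fin_succ]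
    exact ⟨hc, n1, n2, n3, n4, n5, n6, fun i => i.elim0⟩
  · simp [Tapes.layout, Blocks.copying, EdgeName.src]
    omega
  · simp [Tapes.layout, Blocks.directing, EdgeName.src]
    omega
  · simp [Tapes.layout, Blocks.copying]
    omega
  · cases x with
    | block i => simp [Tapes.layout, Blocks.copying, Blocks.directing]; omega
    | _ => simp [Tapes.layout]
  · cases x with
    | blockRight i => simp [Tapes.layout, Blocks.copying, Blocks.directing]; omega
    | blockLeft i => simp [Tapes.layout, Blocks.copying, Blocks.directing]; omega
    | copyFirst i => cases i <;> simp [Tapes.layout, Blocks.copying, Blocks.directing]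
    | content i => simp [Tapes.layout, Blocks.copying, Blocks.directing]; omega
    | _ => simp [Tapes.layout]
  · cases x with
    | block i =>
      have hi : i ≠ g + 2 := by
        rintro rfl
        exact h 1 rfl
      have hi1 : i ≠ 2 * g + 5 := by
        rintro rfl
        exact h 3 rfl
      have hi2 : i ≠ 3 * g + 8 := by
        rintro rfl
        exact h 5 rfl
      have hi3 : i ≠ 3 * g + 7 := by
        rintro rfl
        exact h 6 rfl
      simp only [Tapes.layout, Blocks.copying, Blocks.directing]
      rw [if_neg (by omega), if_neg (by omega), if_neg (by omega), if_neg (by omega),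
        if_neg (by omega)]
    | _ => rfl
  · cases x with
    | copyFirst i => cases i <;> simp at h
    | content i => simp [Tapes.layout, Blocks.copying] at hx; omega
    | _ => exact ⟨rfl, rfl⟩

theorem exec_direct (hr : r ≤ 3 * e) :
    Exec direct (t.layout (.directing e (r + 1))) (t.layout (.directing e r)) := by
  have h1 : r ≠ 3 * e + 2 := by omega
  have h2 : r + 1 ≠ 3 * e + 2 := by omega
  have h3 : 3 * e + 2 ≠ r := by omega
  have h4 : 3 * e + 1 ≠ r := by omega
  have h5 : 3 * e + 2 ≠ r + 1 := by omega
  refine exec_call () (leads_inPlace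
    ![.block (r + 1), .block r, .block (3 * e + 2)] [.blockLeft r] [.blockLeft r, .content (r + 1)]
    ?_ ?_ ?_ ?_ ?_ ?_ ?_ ?_ (fun x => Iff.rfl) (fun x => ?_) (fun x hx h => ?_) (fun x hx h => ?_))
  · simp [h4.symm, h1]
  · simp
  · simp
  · simp [Fin.forall_fin_succ, Tapes.layout, Blocks.directing, h1, h5]
    omega
  · simp [Fin.forall_fin_succ, Tapes.layout, Blocks.directing, h3]
    omega
  · simp [Tapes.layout, Blocks.directing, EdgeName.src]
    omega
  · simp [Tapes.layout, Blocks.directing, EdgeName.src]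
  · simp [Tapes.layout, Blocks.directing]
  · cases x with
    | content i => simp [Tapes.layout, Blocks.directing]; omega
    | blockLeft i => simp [Tapes.layout, Blocks.directing]; omega
    | _ => simp [Tapes.layout, Blocks.directing]
  · cases x with
    | block i =>
      have hi : i ≠ r + 1 := by
        rintro rfl
        exact h 0 rfl
      have hi1 : i ≠ r := by
        rintro rfl
        exact h 1 rfl
      simp only [Tapes.layout, Blocks.directing]
      rw [if_neg hi, if_neg hi1]
    | _ => rfl
  · cases x <;> exact ⟨rfl, rfl⟩

theorem fails_direct (hc : t.center = center M) : Fails direct (t.layout (.directing e 0)) := by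
  refine fails_call fun _ => blocked_inPlace ?_
  rintro ⟨f, hf, hn, he⟩
  obtain ⟨w, hm, hw, -, hw'⟩ := he _ (List.mem_cons_self ..)
  have h := (hn 0).2
  replace hw : w.src = f 0 := hw
  rw [← hw] at h
  cases w with
  | blockLeft i =>
    simp only [Tapes.layout, Blocks.directing, EdgeName.src] at h
    rw [if_neg (by omega)] at h
    split_ifs at h <;> simp [mroot, plain, lab, num, root] at h
  | cacheLeft i =>
    simp only [Tapes.layout, EdgeName.src] at h
    split_ifs at h <;> simp [mroot, plain, lab, root] at h
  | inputLeft i => simp [Tapes.layout, EdgeName.src, root, plain, lab] at h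
  | blockFirst => simp [Tapes.layout, EdgeName.src, hc, root, lab, center, num] at h
  | _ => simp [Tapes.layout, lab, col, num] at hw'

theorem exec_alap_direct (hc : t.center = center M) (r : ℕ) (hr : r ≤ 3 * e + 1) :
    Exec (.alap direct) (t.layout (.directing e r)) (t.layout (.directing e 0)) := by
  induction r with
  | zero => exact (fails_direct hc).alap
  | succ r ih => exact Exec.alap (exec_direct (by omega)) (ih (by omega))

theorem execAll_unroot :
    ExecAll unroot (t.layout (.directing e 0))
      (t.layout (.list (3 * e + 3) (fun i => if i = 0 then 0 else 3 * e + 2) none)) := by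
  refine execAll_call () (leads_inPlace
    ![.block 0, .block (3 * e + 2)] [] [.content 0]
    ?_ ?_ ?_ ?_ ?_ ?_ ?_ ?_ (fun x => Iff.rfl) (fun x => ?_) (fun x hx h => ?_) (fun x hx h => ?_))
  · simp
  · simp
  · simp
  · simp [Fin.forall_fin_succ, Tapes.layout, Blocks.directing]
  · simp [Fin.forall_fin_succ, Tapes.layout, Blocks.list]
  · simp
  · simp [Tapes.layout, Blocks.list, EdgeName.src]
  · simp [Tapes.layout, Blocks.directing]
  · cases x with
    | content i => simp [Tapes.layout, Blocks.directing, Blocks.list]; omega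
    | _ => simp [Tapes.layout, Blocks.directing, Blocks.list]
  · cases x with
    | block i =>
      have hi : i ≠ 0 := by
        rintro rfl
        exact h 0 rfl
      have hi1 : i ≠ 3 * e + 2 := by
        rintro rfl
        exact h 1 rfl
      simp [Tapes.layout, Blocks.directing, Blocks.list, hi, hi1]
    | _ => rfl
  · cases x with
    | content i =>
      have hi : i ≠ 0 := Nat.ne_of_gt hx.1
      simp [Tapes.layout, Blocks.directing, Blocks.list, hi]
    | copyFirst _ => exact False.elim hx
    | _ => exact ⟨rfl, rfl⟩

/-- All dashed edges now lead to the last node, the number of a blank block, except for the loop at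
node 0, which becomes the active block. -/
theorem execAll_resetBlockset (hc : t.center = center M) (he : 2 ≤ e) (hct : ∀ i ≤ e, ct i ≤ e) :
    ExecAll (ResetBlockset M) (t.layout (.list (e + 1) ct none))
      (t.layout (.list (3 * e + 3) (fun i => if i = 0 then 0 else 3 * e + 2) none)) :=
  (exec_binit hc (by omega)).seqAll ((exec_undirect (by omega) (by
    have := hct 0 (by omega)
    omega)).tryCom.seqAll ((exec_alap_copy hc hct e 0 (by omega)).seqAll ((exec_glue hc he).seqAll
      ((exec_alap_direct hc _ le_rfl).seqAll execAll_unroot))))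

theorem execAll_restart (hc : t.center = center M) (hi : t.inHead < t.len)
    (hr : t.red = none) (hm : t.move = .empty) (hh : t.head ≤ t.last) (ha : t.active ≠ 0)
    (ha' : t.active < e + 1) (he : 2 ≤ e) (hct : ∀ i ≤ e, ct i ≤ e) :
    ∃ d, (∀ i ≤ t.last + 1, d i = 2) ∧
      ExecAll (Restart M) (t.layout (.list (e + 1) ct none))
        ({t with
          inHead := 0, active := 0, head := 0, last := t.last + 1, cache := d, red := none}.layout
            (.list (3 * e + 3) (fun i => if i = 0 then 0 else 3 * e + 2) none)) := by
  obtain ⟨d, hd, h⟩ := exec_resetCache (M := M)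
    (t := {t with inHead := 0, active := 0, head := 0})
    (Blocks.list_node_ne_red (e + 1) ct none) hc hr hm rfl
  refine ⟨d, hd, Exec.seqAll ((exec_rewindInput hc hi).seq (Exec.seq (Exec.tryCom
    (exec_rewind_blockset (t := {t with inHead := 0}) hc ha' ha))
      (exec_alap_rewindCache t.head _ hc hr hm rfl hh))) (h.seqAll
        (execAll_resetBlockset ?_ he hct))⟩
  exact hc

end

section

open Sim OffLineTM

variable {M : OffLineTM} {n : ℕ}

/-! ## The layout of configuration graphs -/

/-- The Horner form suits the counter, the sum is the form of `blockContent_val`; this lemma links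
the two. -/
theorem value_eq_sum (d : ℕ → Fin 3) (m : ℕ) :
    value d (m + 1) = ∑ j : Fin (m + 1), (d j : ℕ) * 3 ^ (m - (j : ℕ)) := by
  induction m with
  | zero => simp [value]
  | succ m ih =>
    rw [value_succ, ih, Finset.mul_sum]
    conv_rhs => rw [Fin.sum_univ_castSucc]
    simp only [Fin.val_castSucc, Fin.val_last, Nat.sub_self, pow_zero, mul_one]
    congr 1
    refine Finset.sum_congr rfl fun j _ => ?_
    rw [Nat.succ_sub (Nat.le_of_lt_succ j.isLt), pow_succ]
    ring

/-- The part of the layout of `enc k S` outside BLOCKSET. -/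
def encTapes (k : ℕ) (S : M.Config n) : Tapes where
  len := n
  -- The default is never seen, since the layout has no input nodes from `n` on.
  input := fun i => if h : i < n then S.input ⟨i, h⟩ else 0
  inHead := S.inHead
  center := root (num S.state)
  last := k + 1
  cache := fun i => S.tape (S.head / (k + 2) * (k + 2) + i)
  red := none
  head := S.head % (k + 2)
  move := .empty
  active := S.head / (k + 2)

/-- The number of the block node to which the dashed edge of block node `i` leads, where `a` is the
active block. -/
def encContent (k : ℕ) (tape : ℕ → Fin 3) (a i : ℕ) : ℕ :=
  if i = a then 0 else value (fun j => tape (i * (k + 2) + j)) (k + 2)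

theorem encContent_lt (k : ℕ) (tape : ℕ → Fin 3) (a i : ℕ) :
    encContent k tape a i < 3 ^ (k + 2) := by
  rw [encContent]
  split_ifs
  · positivity
  · exact value_lt _ _

/-- The layout of `enc k S`. -/
def encLayout (k : ℕ) (S : M.Config n) : Layout :=
  (encTapes k S).layout (.list (3 ^ (k + 2)) (encContent k S.tape (S.head / (k + 2))) none)

/-- The name of a node of a configuration graph. -/
def EncNode.name {k : ℕ} : EncNode n k → NodeName
  | .center => .center
  | .input i => .input i
  | .block i => .block i
  | .cache i => .cache i

/-- The name of an edge of a configuration graph. -/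
def EncEdge.name {k : ℕ} : EncEdge n k → EdgeName
  | .inputFirst => .inputFirst
  | .inputHead => .inputHead
  | .blockFirst => .blockFirst
  | .blockActive => .blockActive
  | .cacheLast => .cacheLast
  | .cacheHead => .cacheHead
  | .inputRight l => .inputRight l.1.1
  | .inputLeft l => .inputLeft l.1.1
  | .blockRight l => .blockRight l.1.1
  | .blockLeft l => .blockLeft l.1.1
  | .cacheRight l => .cacheRight l.1.1
  | .cacheLeft l => .cacheLeft l.1.1
  | .content i => .content i

theorem Link.ext {m : ℕ} {l l' : Link m} (h : (l.1.1 : ℕ) = l'.1.1) : l = l' := by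
  have h1 := l.2
  have h2 := l'.2
  exact Subtype.ext (Prod.ext (Fin.ext h) (Fin.ext (by omega)))

theorem EncNode.name_injective {k : ℕ} : Function.Injective (EncNode.name (n := n) (k := k)) := by
  intro a b h
  cases a <;> cases b <;> simp [EncNode.name, Fin.val_inj] at h <;> simp [h]

theorem EncEdge.name_injective {k : ℕ} : Function.Injective (EncEdge.name (n := n) (k := k)) := by
  intro a b h
  cases a <;> cases b <;> first
    | rfl
    | (simp [EncEdge.name] at h; done)
    | (simp only [EncEdge.name, EdgeName.inputRight.injEq, EdgeName.inputLeft.injEq,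
        EdgeName.blockRight.injEq, EdgeName.blockLeft.injEq, EdgeName.cacheRight.injEq,
        EdgeName.cacheLeft.injEq, EdgeName.content.injEq] at h
       first
        | rw [Link.ext h]
        | rw [Fin.ext h])

theorem hasLayout_enc (k : ℕ) (S : M.Config n) (h : Fits k S) :
    HasLayout (enc k S h) (encLayout k S) := by
  refine ⟨EncNode.name, EncEdge.name, EncNode.name_injective, EncEdge.name_injective,
    fun x => ?_, fun x => ?_, fun e => ?_, fun e => ?_, fun v => ?_, fun e => ?_, fun v => ?_⟩
  · constructor
    · intro hx
      cases x with
      | center => exact ⟨.center, rfl⟩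
      | input i => exact ⟨.input ⟨i, hx⟩, rfl⟩
      | block i => exact ⟨.block ⟨i, hx⟩, rfl⟩
      | cache i => exact ⟨.cache ⟨i, Nat.lt_succ_of_le hx⟩, rfl⟩
    · rintro ⟨v, rfl⟩
      cases v with
      | center => trivial
      | input i => exact i.isLt
      | block i => exact i.isLt
      | cache i => exact Nat.le_of_lt_succ i.isLt
  · constructor
    · intro hx
      cases x with
      | inputFirst => exact ⟨.inputFirst, rfl⟩
      | inputHead => exact ⟨.inputHead, rfl⟩
      | blockFirst => exact ⟨.blockFirst, rfl⟩
      | blockActive => exact ⟨.blockActive, rfl⟩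
      | cacheLast => exact ⟨.cacheLast, rfl⟩
      | cacheHead => exact ⟨.cacheHead, rfl⟩
      | copyFirst _ => exact False.elim hx
      | inputRight i => exact ⟨.inputRight ⟨(⟨i, Nat.lt_of_succ_lt hx⟩, ⟨i + 1, hx⟩), rfl⟩, rfl⟩
      | inputLeft i => exact ⟨.inputLeft ⟨(⟨i, Nat.lt_of_succ_lt hx⟩, ⟨i + 1, hx⟩), rfl⟩, rfl⟩
      | blockRight i => exact ⟨.blockRight ⟨(⟨i, Nat.lt_of_succ_lt hx⟩, ⟨i + 1, hx⟩), rfl⟩, rfl⟩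
      | blockLeft i => exact ⟨.blockLeft ⟨(⟨i, Nat.lt_of_succ_lt hx⟩, ⟨i + 1, hx⟩), rfl⟩, rfl⟩
      | cacheRight i =>
        exact ⟨.cacheRight ⟨(⟨i, Nat.lt_succ_of_lt hx⟩, ⟨i + 1, Nat.succ_lt_succ hx⟩), rfl⟩, rfl⟩
      | cacheLeft i =>
        exact ⟨.cacheLeft ⟨(⟨i, Nat.lt_succ_of_lt hx⟩, ⟨i + 1, Nat.succ_lt_succ hx⟩), rfl⟩, rfl⟩
      | content i => exact ⟨.content ⟨i, hx⟩, rfl⟩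
    · rintro ⟨e, rfl⟩
      cases e with
      | inputRight l => exact lt_of_eq_of_lt l.2 l.1.2.isLt
      | inputLeft l => exact lt_of_eq_of_lt l.2 l.1.2.isLt
      | blockRight l => exact lt_of_eq_of_lt l.2 l.1.2.isLt
      | blockLeft l => exact lt_of_eq_of_lt l.2 l.1.2.isLt
      | cacheRight l =>
        exact Nat.lt_of_succ_lt_succ (lt_of_eq_of_lt l.2 l.1.2.isLt)
      | cacheLeft l =>
        exact Nat.lt_of_succ_lt_succ (lt_of_eq_of_lt l.2 l.1.2.isLt)
      | content i => exact i.isLt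
      | _ => trivial
  · cases e with
    | inputLeft l => exact congrArg NodeName.input l.2.symm
    | blockLeft l => exact congrArg NodeName.block l.2.symm
    | cacheLeft l => exact congrArg NodeName.cache l.2.symm
    | _ => rfl
  · cases e with
    | inputRight l => exact congrArg NodeName.input l.2.symm
    | blockRight l => exact congrArg NodeName.block l.2.symm
    | cacheRight l => exact congrArg NodeName.cache l.2.symm
    | content i =>
      change EncNode.name (if i = ⟨S.head / cLen k, _⟩ then .block ⟨0, _⟩
        else .block (blockContent k S.tape i)) = NodeName.block (encContent k S.tape _ i)
      rw [encContent]
      by_cases hi : (i : ℕ) = S.head / (k + 2)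
      · rw [if_pos hi, if_pos (Fin.ext hi)]
        rfl
      · rw [if_neg hi, if_neg fun h => hi (congrArg Fin.val h)]
        refine congrArg NodeName.block ?_
        -- Both sides are now the same ternary sum.
        rw [blockContent_val, value_eq_sum]
    | _ => rfl
  · cases v with
    | input i => simp [enc, encLayout, encTapes, Tapes.layout, EncNode.name, plain]
    | _ => rfl
  · cases e <;> rfl
  · cases v with
    | center => exact iff_of_true rfl rfl
    | input i =>
      exact iff_of_false (fun h : EncNode.input i = EncNode.center => by cases h)
        (by simp [encLayout, encTapes, Tapes.layout, Blocks.list, EncNode.name, plain])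
    | block i =>
      exact iff_of_false (fun h : EncNode.block i = EncNode.center => by cases h)
        (by simp [encLayout, encTapes, Tapes.layout, Blocks.list, EncNode.name, plain])
    | cache i =>
      exact iff_of_false (fun h : EncNode.cache i = EncNode.center => by cases h)
        (by simp [encLayout, encTapes, Tapes.layout, Blocks.list, EncNode.name, plain])

/-- Only the `t.last + 1` nodes of CACHE and the `b` block nodes exist. The lemmas on the counter
fix the final functions only on these ranges. -/
theorem hasLayout_congr {G : HostGraph} {t : Tapes} {d : ℕ → Fin 3} {b : ℕ} {ct ct' : ℕ → ℕ}
    (hd : ∀ i ≤ t.last, d i = t.cache i) (hct : ∀ i < b, ct' i = ct i)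
    (h : HasLayout G (t.layout (.list b ct none))) :
    HasLayout G ({t with cache := d}.layout (.list b ct' none)) := by
  refine h.congr (fun x => Iff.rfl) (fun x => Iff.rfl) (fun x hx => ?_) (fun x hx => ?_)
  · cases x with
    | cache i => simp only [Tapes.layout, hd i hx]
    | _ => rfl
  · cases x with
    | content i => simp only [Tapes.layout, Blocks.list, hct i hx, and_self]
    | _ => exact ⟨rfl, rfl⟩

theorem ExecAll.congr {P : Com} {A B B' : Layout} (h : ExecAll P A B)
    (hB : ∀ H, HasLayout H B' → HasLayout H B) : ExecAll P A B' :=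
  fun G H hG hH => h G H hG (hB H hH)

theorem ExecAll.congr_list {P : Com} {A : Layout} {t : Tapes} {d : ℕ → Fin 3} {b : ℕ}
    {ct ct' : ℕ → ℕ} (h : ExecAll P A ({t with cache := d}.layout (.list b ct none)))
    (hd : ∀ i ≤ t.last, d i = t.cache i) (hct : ∀ i < b, ct i = ct' i) :
    ExecAll P A (t.layout (.list b ct' none)) :=
  h.congr fun _ hH => hasLayout_congr hd hct hH

/-! ## Simulating a transition -/

theorem mul_add_ne {c i j h : ℕ} (hj : j < c) (hi : i ≠ h / c) : i * c + j ≠ h := by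
  rintro rfl
  refine hi ?_
  rw [Nat.mul_comm, Nat.mul_add_div (by omega), Nat.div_eq_of_lt hj, Nat.add_zero]

/-- Writing a symbol affects only the block of the head, and a change of the active block affects
only the entries of the old and the new one. -/
theorem encContent_update {k h a a' i : ℕ} {tape : ℕ → Fin 3} {y : Fin 3}
    (hi : i ≠ h / (k + 2)) (ha : i ≠ a) (ha' : i ≠ a') :
    encContent k (Function.update tape h y) a i = encContent k tape a' i := by
  rw [encContent, encContent, if_neg ha, if_neg ha']
  exact value_congr fun j hj => Function.update_of_ne (mul_add_ne hj hi) ..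

theorem cache_update (k h : ℕ) (tape : ℕ → Fin 3) (y : Fin 3) (j : ℕ) :
    Function.update (fun i => tape (h / (k + 2) * (k + 2) + i)) (h % (k + 2)) y j =
      Function.update tape h y (h / (k + 2) * (k + 2) + j) := by
  have := Nat.div_add_mod' h (k + 2)
  rw [Function.update_apply, Function.update_apply]
  by_cases hj : j = h % (k + 2)
  · rw [if_pos hj, if_pos (by omega)]
  · rw [if_neg hj, if_neg (by omega)]

/-- After the moves of the heads. -/
theorem execAll_noMove {t : Tapes} {q : M.Q} {b : ℕ} {ct : ℕ → ℕ} (hc : t.center = root (num q))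
    (hm : t.move = .empty) :
    ExecAll (tryThen (Left M) (PrevBlock M) ;; tryThen (Right M) (NextBlock M) ;;
      tryThen (Flag M) (Restart M)) (t.layout (.list b ct none)) (t.layout (.list b ct none)) :=
  (fails_unlabel (by simp [hm])).tryThen.seqAll ((fails_unlabel (by simp [hm])).tryThen.seqAll
    ((fails_flag hc (Blocks.list_node_ne_grey b ct)).tryteAll execAll_skip))

/-- The tapes after a call of `Transitions`. -/
def movedTapes (k : ℕ) (S S' : M.Config n) (y : Fin 3) (Y : Dir) : Tapes :=
  { encTapes k S with
    center := root (num S'.state)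
    cache := Function.update (encTapes k S).cache (S.head % (k + 2)) y
    inHead := S'.inHead
    move := pending Y }

theorem exec_movedTapes {k : ℕ} {S S' : M.Config n} {y : Fin 3} {X Y : Dir} {s : Blocks}
    (hδ : M.δ S.state (S.input S.inHead) (S.tape S.head) = some (S'.state, y, X, Y))
    (hX : X.Moves S.inHead S'.inHead) :
    Exec (Transitions M) ((encTapes k S).layout s) ((movedTapes k S S' y Y).layout s) := by
  refine exec_transitions (t := encTapes k S) (q := S.state) rfl rfl rfl S.inHead.isLt
    S'.inHead.isLt (Nat.le_of_lt_succ (Nat.mod_lt _ (Nat.succ_pos _))) ?_ hX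
  simp only [encTapes, Fin.is_lt, dite_true, Fin.eta, Nat.div_add_mod']
  exact hδ

theorem div_mod_eq {h c a r : ℕ} (hr : r < c) (h' : a * c + r = h) : h / c = a ∧ h % c = r :=
  (Nat.div_mod_unique (by omega)).2 ⟨by rw [Nat.mul_comm]; omega, hr⟩

theorem execAll_simulate {k : ℕ} {S S' : M.Config n} (h : M.Trans S S')
    (hS : S.head < 3 ^ (k + 2) * (k + 2)) (hS' : S'.head < 3 ^ (k + 2) * (k + 2)) :
    ExecAll (Simulate M) (encLayout k S) (encLayout k S') := by
  obtain ⟨p, y, X, Y, hδ, rfl, hin, htape, hX, hY⟩ := h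
  obtain ⟨a, ha⟩ : ∃ a, a = S.head / (k + 2) := ⟨_, rfl⟩
  obtain ⟨r, hr⟩ : ∃ r, r = S.head % (k + 2) := ⟨_, rfl⟩
  have hr' : r < k + 2 := hr ▸ Nat.mod_lt _ (Nat.succ_pos _)
  have har : a * (k + 2) + r = S.head := by rw [ha, hr, Nat.div_add_mod']
  have hab : a < 3 ^ (k + 2) := by
    rw [ha]
    exact Nat.div_lt_of_lt_mul (by rwa [Nat.mul_comm])
  have hcache (j : ℕ) : (movedTapes k S S' y Y).cache j = S'.tape (a * (k + 2) + j) := by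
    rw [htape, ha, ← cache_update]
    rfl
  have hct (a' i : ℕ) (hi : i ≠ a) (hi' : i ≠ a') :
      encContent k S'.tape a' i = encContent k S.tape a i := by
    rw [htape]
    exact encContent_update (ha ▸ hi) hi' hi
  have hA : encLayout k S = (encTapes k S).layout
      (.list (3 ^ (k + 2)) (encContent k S.tape a) none) := by rw [ha]; rfl
  -- All cases end here: it remains to give the block and the offset of the new head and to compare
  -- CACHE and the dashed edges with those of `S'`.
  have final {P : Com} {A : Layout} {a' r' : ℕ} {d : ℕ → Fin 3} {ct' : ℕ → ℕ}
      (hr' : r' < k + 2) (h' : a' * (k + 2) + r' = S'.head)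
      (hd : ∀ i ≤ k + 1, d i = S'.tape (a' * (k + 2) + i))
      (hct' : ∀ i < 3 ^ (k + 2), ct' i = encContent k S'.tape a' i)
      (hE : ExecAll P A ({movedTapes k S S' y Y with
        cache := d, red := none, head := r', active := a', move := .empty}.layout
          (.list (3 ^ (k + 2)) ct' none))) : ExecAll P A (encLayout k S') := by
    obtain ⟨rfl, rfl⟩ := div_mod_eq hr' h'
    refine ExecAll.congr_list (t := encTapes k S') (d := d) (ct := ct') ?_ hd hct'
    simpa only [encTapes, movedTapes, hin] using hE
  -- If the head stays in its block, the block contents need no update: only the active block has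
  -- changed, and its entry is 0 whatever its symbols are.
  have stay {r' : ℕ} {B : Layout} (hr' : r' < k + 2) (h' : a * (k + 2) + r' = S'.head)
      (hL : Exec (tryCom (MoveLeft M)) ((movedTapes k S S' y Y).layout
        (.list (3 ^ (k + 2)) (encContent k S.tape a) none)) B)
      (hR : Exec (tryCom (MoveRight M)) B
        ({movedTapes k S S' y Y with head := r', active := a, move := .empty}.layout
          (.list (3 ^ (k + 2)) (encContent k S.tape a) none))) :
      ExecAll (Simulate M) (encLayout k S) (encLayout k S') := by
    refine final hr' h' (fun i _ => hcache i) (fun i _ => ?_) ((exec_movedTapes hδ hX).seqAll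
      (Exec.seqAll (ha ▸ hL) (hR.seqAll (execAll_noMove (q := S'.state) rfl rfl))))
    by_cases hi : i = a
    · rw [encContent, encContent, if_pos hi, if_pos hi]
    · exact (hct a i hi hi).symm
  have hval : value (movedTapes k S S' y Y).cache (k + 2) =
      value (fun j => S'.tape (a * (k + 2) + j)) (k + 2) := value_congr fun i _ => hcache i
  have hlast : (encTapes k S).head ≤ k + 1 := Nat.le_of_lt_succ (Nat.mod_lt _ (Nat.succ_pos _))
  cases Y with
  | S =>
    replace hY : S'.head = S.head := hY
    refine stay (B := _) hr' (by omega)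
      (fails_headMove_of_ne (by simp [movedTapes, pending])).tryCom ?_
    subst ha hr
    exact (fails_headMove_of_ne (t := movedTapes k S S' y .S)
      (by simp [movedTapes, pending])).tryCom
  | L =>
    replace hY : S.head = S'.head + 1 := hY
    cases r with
    | succ r =>
      refine stay (r' := r) (by omega) (by omega)
        (exec_headMove_blue (q := S'.state) rfl rfl hr.symm (Nat.le_of_lt_succ hr') rfl).tryCom ?_
      rw [ha]
      exact (fails_headMove_of_ne (by simp)).tryCom
    | zero =>
      -- The head is on the first square of its block but not on square 0, as it can still move
      -- left.
      obtain ⟨b, rfl⟩ : ∃ b, a = b + 1 := by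
        cases a with
        | zero => omega
        | succ b => exact ⟨b, rfl⟩
      have hb : b * (k + 2) + (k + 1) = S'.head := by
        rw [Nat.add_mul] at har
        omega
      obtain ⟨d, hd, hE⟩ := exec_prevBlock (M := M) (q := S'.state) (a := b) (b := 3 ^ (k + 2))
        (ct := encContent k S.tape (b + 1))
        (t := {movedTapes k S S' y .L with move := .empty}) rfl rfl rfl hlast ha.symm hab
        (fun i _ => encContent_lt ..) rfl
      rw [hA]
      refine final (by omega) hb (fun i hi => ?_) (fun i _ => ?_) ((exec_movedTapes hδ hX).seqAll
        (Exec.seqAll (Fails.tryCom (fails_headMove_blue hr.symm))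
          (Exec.seqAll (Fails.tryCom (fails_headMove_of_ne (by simp [movedTapes, pending])))
            (Exec.seqAll (Exec.tryte (exec_unlabel (q := S'.state) rfl rfl hlast rfl) hE)
              ((fails_unlabel (by simp)).tryThen.seqAll
                ((fails_flag (q := S'.state) rfl (Blocks.list_node_ne_grey _ _)).tryteAll
                  execAll_skip))))))
      -- Decoding has produced the number of the previous block, which the transition did not alter;
      -- its digits are the symbols of that block.
      · exact eq_of_value_eq (e := fun i => S'.tape (b * (k + 2) + i)) (m := k + 2)
          (hd.trans ((hct (b + 1) b (by omega) (by omega)).symm.trans (if_neg (by omega)))) i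
          (by omega)
      · by_cases hi : i = b
        · rw [hi, Function.update_self, encContent, if_pos rfl]
        · rw [Function.update_of_ne hi]
          by_cases hi' : i = b + 1
          · rw [hi', Function.update_self, encContent, if_neg (by omega)]
            -- The block just left was encoded after the write, so its number is that of the new
            -- tape.
            exact hval
          · rw [Function.update_of_ne hi', hct b i hi' hi]
  | R =>
    replace hY : S'.head = S.head + 1 := hY
    by_cases hk : r = k + 1
    · have hb : (a + 1) * (k + 2) + 0 = S'.head := by
        rw [Nat.add_mul]
        omega
      have hab' : a + 1 < 3 ^ (k + 2) := by
        rw [← hb, Nat.add_zero] at hS'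
        exact Nat.lt_of_mul_lt_mul_right hS'
      obtain ⟨d, hd, hE⟩ := exec_nextBlock (M := M) (q := S'.state) (b := 3 ^ (k + 2))
        (ct := encContent k S.tape a)
        (t := {movedTapes k S S' y .R with move := .empty}) rfl rfl rfl hlast ha.symm hab'
        (fun i _ => encContent_lt ..) rfl
      rw [hA]
      refine final (a' := a + 1) (by omega) hb (fun i hi => ?_) (fun i _ => ?_)
        ((exec_movedTapes hδ hX).seqAll
        (Exec.seqAll (Fails.tryCom (fails_headMove_of_ne (by simp [movedTapes, pending])))
          (Exec.seqAll (Fails.tryCom (fails_headMove_red (hr.symm.trans hk)))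
            (Exec.seqAll (Fails.tryThen (fails_unlabel (by simp [movedTapes, pending])))
              (Exec.seqAll (Exec.tryte (exec_unlabel (q := S'.state) rfl rfl hlast rfl) hE)
                ((fails_flag (q := S'.state) rfl (Blocks.list_node_ne_grey _ _)).tryteAll
                  execAll_skip))))))
      · exact eq_of_value_eq (e := fun i => S'.tape ((a + 1) * (k + 2) + i)) (m := k + 2)
          (hd.trans ((hct a (a + 1) (by omega) (by omega)).symm.trans (if_neg (by omega)))) i
          (by omega)
      · by_cases hi : i = a + 1
        · rw [hi, Function.update_self, encContent, if_pos rfl]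
        · rw [Function.update_of_ne hi]
          by_cases hi' : i = a
          · rw [hi', Function.update_self, encContent, if_neg (by omega)]
            exact hval
          · rw [Function.update_of_ne hi', hct (a + 1) i hi' hi]
    · refine stay (r' := r + 1) (by omega) (by omega)
        (fails_headMove_of_ne (by simp [movedTapes, pending])).tryCom ?_
      rw [ha]
      exact (exec_headMove_red (q := S'.state) rfl rfl hr.symm
        (by simp only [movedTapes, encTapes]; omega) rfl).tryCom

/-- Tripling the number of blocks matches one more digit in CACHE. -/
theorem three_mul_pow_sub {k e : ℕ} (he : e + 1 = 3 ^ (k + 2)) : 3 * e + 3 = 3 ^ (k + 1 + 2) := by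
  rw [show k + 1 + 2 = (k + 2) + 1 by omega, pow_succ, ← he]
  ring

/-- If the working head leaves the last block, then the simulation starts again with a larger
tape. -/
theorem execAll_simulate_restart [NeZero n] {k : ℕ} {w : Fin n → Fin 2} {S S' : M.Config n}
    (hw : S.input = w) (h : M.Trans S S') (hS : S.head < 3 ^ (k + 2) * (k + 2))
    (hS' : ¬ S'.head < 3 ^ (k + 2) * (k + 2)) :
    ExecAll (Simulate M) (encLayout k S) (encLayout (k + 1) (M.init w)) := by
  subst hw
  obtain ⟨p, y, X, Y, hδ, rfl, hin, htape, hX, hY⟩ := h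
  obtain ⟨e, he⟩ : ∃ e, e + 1 = 3 ^ (k + 2) := ⟨3 ^ (k + 2) - 1, by
    have : 0 < 3 ^ (k + 2) := by positivity
    omega⟩
  have he2 : 2 ≤ e := by
    have : 3 ^ 1 ≤ 3 ^ (k + 2) := Nat.pow_le_pow_right (by omega) (by omega)
    omega
  -- The tape can only be left to the right, and only from its very last square.
  have hYR : Y = .R ∧ S.head + 1 = (e + 1) * (k + 2) := by
    rw [he]
    cases Y with
    | L => replace hY : S.head = S'.head + 1 := hY; omega
    | R => replace hY : S'.head = S.head + 1 := hY; exact ⟨rfl, by omega⟩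
    | S => replace hY : S'.head = S.head := hY; omega
  obtain ⟨rfl, hh⟩ := hYR
  obtain ⟨ha, hr⟩ : S.head / (k + 2) = e ∧ S.head % (k + 2) = k + 1 :=
    div_mod_eq (by omega) (by rw [Nat.add_mul] at hh; omega)
  obtain ⟨d, ct, hE, hct⟩ := exec_nextBlock_of_last (M := M) (q := S'.state) (b := 3 ^ (k + 2))
    (ct := encContent k S.tape (S.head / (k + 2)))
    (t := {movedTapes k S S' y .R with move := .empty}) rfl rfl (by rw [← he, ← ha]; rfl)
    (fun i _ => encContent_lt ..) rfl
  rw [← he] at hE hct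
  obtain ⟨d', hd', hR⟩ := execAll_restart (M := M) (e := e) (ct := ct)
    (t := {movedTapes k S S' y .R with
      cache := d, red := none, center := center M, move := .empty}) rfl S'.inHead.isLt rfl rfl
    hr.le (by change S.head / (k + 2) ≠ 0; omega) (by change S.head / (k + 2) < e + 1; omega) he2
    (fun i hi => Nat.le_of_lt_succ (hct i (Nat.lt_succ_of_le hi)))
  have h0 : (0 : ℕ) / (k + 1 + 2) = 0 := Nat.zero_div _
  refine ExecAll.congr_list (t := encTapes (k + 1) (M.init S.input)) (d := d')
    (ct := fun i => if i = 0 then 0 else 3 * e + 2) ?_ (fun i hi => hd' i hi) (fun i hi => ?_)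
  · rw [← three_mul_pow_sub he]
    rw [encLayout, ← he]
    refine (exec_movedTapes hδ hX).seqAll
      (Exec.seqAll (Fails.tryCom (fails_headMove_of_ne (by simp [movedTapes, pending])))
        (Exec.seqAll (Fails.tryCom (fails_headMove_red hr))
          (Exec.seqAll (Fails.tryThen (fails_unlabel (by simp [movedTapes, pending])))
            (Exec.seqAll (Exec.tryte (exec_unlabel (q := S'.state) rfl rfl hr.le rfl) hE)
              (Exec.tryteAll (exec_flag (q := S'.state) rfl) ?_)))))
    simpa only [encTapes, movedTapes, init, h0, Nat.zero_mod, Fin.val_zero, center] using hR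
  · simp only [init, h0, encContent]
    split_ifs with hi0
    · rfl
    -- A blank block has number `3 ^ (k + 3) - 1 = 3 * e + 2`.
    · have := value_const_two (d := fun _ => 2) (m := k + 1 + 2) fun _ _ => rfl
      rw [← three_mul_pow_sub he] at this
      omega

/-! ## The main theorem -/

theorem Fits.mono {k k' : ℕ} {S : M.Config n} (h : Fits k S) (hk : k ≤ k') : Fits k' S := by
  have : bLen k * cLen k ≤ bLen k' * cLen k' :=
    Nat.mul_le_mul (Nat.pow_le_pow_right (by omega) (by omega)) (by simp only [cLen]; omega)
  exact ⟨h.head_lt.trans_le this, fun i hi => h.blank i (this.trans hi)⟩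

theorem blank_of_trans {k : ℕ} {S S' : M.Config n} (hS : Fits k S) (h : M.Trans S S') (i : ℕ)
    (hi : bLen k * cLen k ≤ i) : S'.tape i = 2 := by
  obtain ⟨p, y, X, Y, -, -, -, ht, -, -⟩ := h
  have := hS.head_lt
  rw [ht, Function.update_of_ne (by omega), hS.blank i hi]

theorem head_le_of_trans {S S' : M.Config n} (h : M.Trans S S') : S'.head ≤ S.head + 1 := by
  obtain ⟨p, y, X, Y, -, -, -, -, -, hY⟩ := h
  cases Y with
  | L => replace hY : S.head = S'.head + 1 := hY; omega
  | R => replace hY : S'.head = S.head + 1 := hY; omega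
  | S => replace hY : S'.head = S.head := hY; omega

theorem fits_succ_of_trans {k : ℕ} {S S' : M.Config n} (hS : Fits k S) (h : M.Trans S S') :
    Fits (k + 1) S' := by
  have h1 := hS.head_lt
  have h2 := head_le_of_trans h
  have h3 : bLen k * cLen k < bLen (k + 1) * cLen (k + 1) :=
    Nat.mul_lt_mul_of_lt_of_le (Nat.pow_lt_pow_right (by omega) (by omega))
      (by simp only [cLen]; omega) (by simp only [cLen]; omega)
  exact ⟨by omega, fun i hi => blank_of_trans hS h i (h3.le.trans hi)⟩

theorem star_simulate {k : ℕ} {S S' : M.Config n} (h : M.Trans S S') (hS : Fits k S)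
    (hS' : Fits k S') :
    Star (.run (Simulate M) (enc k S hS)) (.done (enc k S' hS')) :=
  execAll_simulate h hS.head_lt hS'.head_lt _ _ (hasLayout_enc k S hS) (hasLayout_enc k S' hS')

theorem Star.alap {P : Com} {G H : HostGraph} (h : Star (.run P G) (.done H)) :
    Star (.run (.alap P) G) (.run (.alap P) H) :=
  .single (.alap1 h.plus_done)

/-- The loop reaches the encoding of `S`, for all sufficiently large tapes. -/
def Reached {n : ℕ} [NeZero n] (M : OffLineTM) (w : Fin n → Fin 2) (k : ℕ) (S : M.Config n) :
    Prop :=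
  (∃ h : Fits k S, Star (.run (.alap (Simulate M)) (enc 0 (M.init w) (fits_init 0 w)))
    (.run (.alap (Simulate M)) (enc k S h))) ∧
  ∀ k', k ≤ k' → ∃ h : Fits k' S,
    Star (.run (.alap (Simulate M)) (enc k' (M.init w) (fits_init k' w)))
      (.run (.alap (Simulate M)) (enc k' S h))

/-- One more execution of the body is appended to each of the runs; a configuration that fits for
`k` also fits for all larger values. -/
theorem Reached.trans [NeZero n] {w : Fin n → Fin 2} {k : ℕ} {S S' : M.Config n}
    (hS : Reached M w k S) (h : M.Trans S S') (h' : Fits k S') : Reached M w k S' := by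
  obtain ⟨⟨hf, hs⟩, hr⟩ := hS
  refine ⟨⟨h', hs.trans (star_simulate h hf h').alap⟩, fun k' hk => ?_⟩
  obtain ⟨hf', hs'⟩ := hr k' hk
  exact ⟨h'.mono hk, hs'.trans (star_simulate h hf' (h'.mono hk)).alap⟩

/-- If `S'` is too large, executing the body on `enc k S` restarts with the initial configuration
for `k + 1`. The second part of `Reached` then leads back to `S` on the larger tape, where `S'` fits
too. -/
theorem Reached.exists_fits [NeZero n] {w : Fin n → Fin 2} {k : ℕ} {S S' : M.Config n}
    (hS : Reached M w k S) (hw : S.input = w) (h : M.Trans S S') :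
    ∃ k', Reached M w k' S ∧ Fits k' S' := by
  by_cases h' : S'.head < 3 ^ (k + 2) * (k + 2)
  · obtain ⟨⟨hf, -⟩, -⟩ := id hS
    exact ⟨k, hS, h', blank_of_trans hf h⟩
  · obtain ⟨⟨hf, hs⟩, hr⟩ := hS
    obtain ⟨hf', hs'⟩ := hr (k + 1) (by omega)
    have := execAll_simulate_restart hw h hf.head_lt h' _ _ (hasLayout_enc k S hf)
      (hasLayout_enc (k + 1) (M.init w) (fits_init (k + 1) w))
    exact ⟨k + 1, ⟨⟨hf', hs.trans (this.alap.trans hs')⟩, fun k' hk => hr k' (by omega)⟩,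
      fits_succ_of_trans hf h⟩

/-- The claim on the input is needed because a restart leads to the initial configuration for the
current input tape, which has to be `w`. -/
theorem exists_reached [NeZero n] {w : Fin n → Fin 2} {S : M.Config n}
    (h : Relation.ReflTransGen M.Trans (M.init w) S) :
    S.input = w ∧ ∃ k, Reached M w k S := by
  induction h with
  | refl => exact ⟨rfl, 0, ⟨fits_init 0 w, .refl⟩, fun k' _ => ⟨fits_init k' w, .refl⟩⟩
  | tail _ h ih =>
    obtain ⟨hw, k, hk⟩ := ih
    obtain ⟨k', hk', hf⟩ := hk.exists_fits hw h
    obtain ⟨p, y, X, Y, -, -, hi, -⟩ := id h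
    exact ⟨hi.trans hw, k', hk'.trans h hf⟩

end

end SGP2

theorem mainTheorem2 (M : SGP2.OffLineTM) : SGP2.Simulates (SGP2.Sim.Simulate M) M := by
  intro n _ w S S' hS h
  obtain ⟨hw, k, hk⟩ := SGP2.exists_reached hS
  obtain ⟨k', ⟨⟨hf, hs⟩, -⟩, hf'⟩ := hk.exists_fits hw h
  exact ⟨k', hf, hf', hs, SGP2.star_simulate h hf hf'⟩
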